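/- **Setting.** Let $W$ be a standard Brownian motion, $\sigma:[0,1]\to(0,\infty)$ measurable and square integrable, $z_0\in\mathbb R$, and let $\mathbb P_\sigma$ denote the law under which $Z_t=z_0+\int_0^t\sigma(s)\,dW_s$, $t\in[0,1]$. One observes $\mathbf Z_n=(Z_0,Z_{1/n},\dots,Z_1)$. Write $\|\sigma\|_{L^2}^2=\int_0^1\sigma(s)^2ds$. **Test.** Let $\psi:\mathbb R\to[0,\infty)$ be a kernel with $1=\psi(0)\ge\psi(x)$ for all $x$ and support in $[-1,1]$, of bounded variation, and such that $|\psi(x)-\psi(y)|\le|x-y|^\gamma$ for all $x,y$, for some $\gamma\in(0,1]$. Put $$\lambda_k(t,h)=\sqrt n\int_{(k-1)/n}^{k/n}\psi\Big(\frac{s-t}{h}\Big)ds,\qquad \Lambda_n(t,h)=\Big(\sum_{k=1}^n\lambda_k(t,h)^2\Big)^{1/2},\qquad \hat c_n^2=\sum_{k=1}^n(Z_{k/n}-Z_{(k-1)/n})^2,$$ $$\hat\Psi_{n,t,h}=\frac{\frac1{\sqrt2}\sum_{k=1}^n\lambda_k(t,h)\big(n(Z_{k/n}-Z_{(k-1)/n})^2-\hat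 c_n^2\big)}{\hat c_n^2\,\Lambda_n(t,h)},\qquad G_n(\eta,\delta)=\sqrt{2\eta}+\frac{2\eta}{\max\{1,\sqrt n\,\delta\}},$$ $\mathcal T_n(K)=\{(t,h): h\in[K/n,1/2),\ t\in[h,1-h]\}$, and let $K_\psi>0$ be a constant such that $\Lambda_n(t,h)^2\ge 1/n$ for all $n\ge1$ and all $(t,h)\in\mathcal T_n(K_\psi)$ (such constants exist). Let $$S_n=\sup_{(t,h)\in\mathcal T_n(K_\psi)}\Big(|\hat\Psi_{n,t,h}|-G_n\big(2\log(1/\Lambda_n(t,h)),\Lambda_n(t,h)\big)\Big).$$ For $\alpha\in(0,1)$ let $\kappa_n^\alpha=\inf\{r\in\mathbb R:\mathbb P_1(S_n\le r)\ge1-\alpha\}$ ($\mathbb P_1$ being $\mathbb P_\sigma$ for $\sigma\equiv1$) and $T_n(\mathbf Z_n)=\mathbf 1\{S_n>\kappa_n^\alpha\}$. **Alternatives.** For $\beta,L>0$ let $\lfloor\beta\rfloor$ be the largest integer strictly smaller than $\beta$ and $\mathcal H(\beta,L)$ the class of $f$ whose first $\lfloor\beta\rfloor$ derivatives exist and satisfy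 $|f^{(\lfloor\beta\rfloor)}(x)-f^{(\lfloor\beta\rfloor)}(y)|\le L|x-y|^{\beta-\lfloor\beta\rfloor}$; a function on $[0,1]$ is said to be in $\mathcal H(\beta,L)$ if it is the restriction of such an $f:\mathbb R\to\mathbb R$. For a compact interval $J\subset(0,1)$ put $$d_J(\sigma,H_0)=\sup_{t\in J}\Big|\frac{\sigma(t)^2}{\|\sigma\|_{L^2}^2}-1\Big|,\qquad \rho_n(\beta)=\Big(\frac{\log n}{n}\Big)^{\frac{\beta}{2\beta+1}},\qquad c_*(\beta,L)=\Big(\frac{4L^{1/\beta}}{(2\beta+1)\|\psi_\beta\|_{L^2(\mathbb R)}^2}\Big)^{\frac{\beta}{2\beta+1}},$$ where, for $0<\beta\le1$, $\psi_\beta(x)=\mathbf 1\{|x|\le1\}(1-|x|^\beta)$, which is a minimizer of $\|\psi\|_{L^2(\mathbb R)}$ over all $\psi\in\mathcal H(\beta,1)$ with $\psi(0)\ge1$ and is itself a kernel with the properties required above. **Theorem 4 (Adaptivity).** (i) For every kernel $\psi$ as above there are constants $c=c(\beta,L,\psi)>0$, bounded over $(\beta,L)$ in compact subsets of $(0,\infty)^2$,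 such that for every $\alpha\in(0,1)$, every compact interval $J\subset(0,1)$, every sequence $\epsilon_n>0$ with $\epsilon_n\to0$ and $\epsilon_n^2\log n\to\infty$, and every $[\beta_1,\beta_2]\times[L_1,L_2]\subset(0,\infty)^2$, $$\lim_{n\to\infty}\ \inf_{(\beta,L)\in[\beta_1,\beta_2]\times[L_1,L_2]}\ \inf_{\substack{\sigma^2/\|\sigma\|_{L^2}^2\in\mathcal H(\beta,L)\\ d_J(\sigma,H_0)\ge(1+\epsilon_n)c(\beta,L,\psi)\rho_n(\beta)}}\mathbb P_\sigma\big(T_n(\mathbf Z_n)=1\big)=1 .$$ (ii) Let $0<\beta\le1$ and let $T_n$ be built with $\psi=\psi_\beta$. Then for all $\alpha$, $J$, $\epsilon_n$ as in (i) and every $[L_1,L_2]\subset(0,\infty)$, $$\lim_{n\to\infty}\ \inf_{L\in[L_1,L_2]}\ \inf_{\substack{\sigma^2/\|\sigma\|_{L^2}^2\in\mathcal H(\beta,L)\\ d_J(\sigma,H_0)\ge(1+\epsilon_n)c_*(\beta,L)\rho_n(\beta)}}\mathbb P_\sigma\big(T_n(\mathbf Z_n)=1\big)=1 .$$ -/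

import Mathlib

open MeasureTheory ProbabilityTheory Filter Topology Set
open scoped NNReal ENNReal

namespace VolTest

noncomputable section

/-! ### The Gaussian white noise model `dZ_t = σ(t) dW_t`, `Z_0 = z₀`, `t ∈ [0,1]` -/

/-- A volatility function `σ : [0,1] → (0,∞)`: measurable, positive and square integrable.
Functions on `[0,1]` are represented by functions on `ℝ`, whose values off `[0,1]` are never used. -/
structure IsVolatility (σ : ℝ → ℝ) : Prop where
  measurable : Measurable ((Icc (0 : ℝ) 1).domRestrict σ)
  pos : ∀ t ∈ Icc (0 : ℝ) 1, 0 < σ t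
  sq_integrable : IntegrableOn (fun t => σ t ^ 2) (Icc 0 1)

/-- A step function `∑ i, a i • 1_{(s i, t i]}` on `[0,1]`. -/
structure Step where
  m : ℕ
  a : Fin m → ℝ
  s : Fin m → ℝ≥0
  t : Fin m → ℝ≥0
  s_le : ∀ i, s i ≤ t i
  t_le : ∀ i, t i ≤ 1

/-- The step function as a function of time. -/
def Step.toFun (S : Step) (u : ℝ) : ℝ :=
  ∑ i, (Ioc (S.s i : ℝ) (S.t i)).indicator (fun _ => S.a i) u

/-- The elementary integral `∑ i, a i (W_{t i} - W_{s i})` of a step function. -/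
def Step.integral {Ω : Type*} (S : Step) (W : ℝ≥0 → Ω → ℝ) (ω : Ω) : ℝ :=
  ∑ i, S.a i * (W (S.t i) ω - W (S.s i) ω)

/-- `X` is (a version of) the Wiener integral `∫_0^1 f dW`: the `L²(P)`-limit of the elementary
integrals of step functions that converge to `f` in `L²([0,1])`. -/
def IsWienerIntegral {Ω : Type*} [MeasurableSpace Ω] (P : Measure Ω) (W : ℝ≥0 → Ω → ℝ)
    (f : ℝ → ℝ) (X : Ω → ℝ) : Prop :=
  AEMeasurable X P ∧ ∃ S : ℕ → Step,
    Tendsto (fun j => eLpNorm (fun u => f u - (S j).toFun u) 2 (volume.restrict (Icc 0 1)))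
      atTop (𝓝 0) ∧
    Tendsto (fun j => eLpNorm (fun ω => X ω - (S j).integral W ω) 2 P) atTop (𝓝 0)

/-- `Z` is a solution of `dZ_t = σ(t) dW_t`, `Z_0 = z₀`, on `[0,1]`, that is,
`Z_t = z₀ + ∫_0^t σ dW` almost surely for every `t ∈ [0,1]`. -/
def IsSolution {Ω : Type*} [MeasurableSpace Ω] (P : Measure Ω) (W : ℝ≥0 → Ω → ℝ)
    (σ : ℝ → ℝ) (z₀ : ℝ) (Z : ℝ≥0 → Ω → ℝ) : Prop :=
  ∀ t : ℝ≥0, t ≤ 1 →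
    IsWienerIntegral P W ((Ioc (0 : ℝ) t).indicator σ) (fun ω => Z t ω - z₀)

/-- The observations `(Z_0, Z_{1/n}, …, Z_1)`. -/
def observe {Ω : Type*} (n : ℕ) (Z : ℝ≥0 → Ω → ℝ) (ω : Ω) : Fin (n + 1) → ℝ :=
  fun k => Z ((k : ℕ) / (n : ℝ≥0)) ω

/-- The law of `(Z_0, Z_{1/n}, …, Z_1)` for `σ = 1`: a random walk started in `z₀` with `n`
independent `N(0, 1/n)` steps. -/
def nullLaw (z₀ : ℝ) (n : ℕ) : Measure (Fin (n + 1) → ℝ) :=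
  (Measure.pi fun _ : Fin n => gaussianReal 0 (n : ℝ≥0)⁻¹).map
    (fun x k => z₀ + ∑ i : Fin n with i.castSucc < k, x i)

/-! ### The multiscale test -/

/-- The kernels `ψ ≥ 0` with `1 = ψ(0) ≥ ψ(x)` and support in `[-1,1]` that are of bounded variation
and Hölder continuous with Hölder constant one. -/
structure IsKernel (ψ : ℝ → ℝ) : Prop where
  nonneg : ∀ x, 0 ≤ ψ x
  zero : ψ 0 = 1
  le_one : ∀ x, ψ x ≤ 1
  support : Function.support ψ ⊆ Icc (-1) 1
  boundedVariation : BoundedVariationOn ψ univ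
  holder : ∃ γ : ℝ≥0, 0 < γ ∧ γ ≤ 1 ∧ HolderWith 1 γ ψ

/-- `λ_{k+1}(t,h) = √n ∫_{k/n}^{(k+1)/n} ψ((s-t)/h) ds`, `k = 0, …, n-1`. -/
def weight (ψ : ℝ → ℝ) (n : ℕ) (t h : ℝ) (k : Fin n) : ℝ :=
  √n * ∫ s in ((k : ℕ) / n : ℝ)..(((k : ℕ) + 1) / n : ℝ), ψ ((s - t) / h)

/-- `Λ_n(t,h)`. -/
def Lam (ψ : ℝ → ℝ) (n : ℕ) (t h : ℝ) : ℝ :=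
  √(∑ k, weight ψ n t h k ^ 2)

/-- The index set `𝒯_n(K)` of pairs `(t,h)`. -/
def scales (n : ℕ) (K : ℝ) : Set (ℝ × ℝ) :=
  {p | p.2 ∈ Ico (K / n) (1 / 2) ∧ p.1 ∈ Icc p.2 (1 - p.2)}

/-- `K` is a possible choice of the constant `K_ψ`: `Λ_n(t,h)² ≥ 1/n` on `𝒯_n(K)` for all `n`. -/
def IsScaleConstant (ψ : ℝ → ℝ) (K : ℝ) : Prop :=
  0 < K ∧ ∀ n : ℕ, 1 ≤ n → ∀ p ∈ scales n K, 1 / (n : ℝ) ≤ Lam ψ n p.1 p.2 ^ 2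

/-- The quadratic variation estimator `ĉ_n²`. -/
def cHatSq {n : ℕ} (z : Fin (n + 1) → ℝ) : ℝ :=
  ∑ k : Fin n, (z k.succ - z k.castSucc) ^ 2

/-- The local statistic with the squared volatility level `c²` replaced by its estimator. -/
def localStat (ψ : ℝ → ℝ) {n : ℕ} (t h : ℝ) (z : Fin (n + 1) → ℝ) : ℝ :=
  (1 / √2 * ∑ k : Fin n, weight ψ n t h k * (n * (z k.succ - z k.castSucc) ^ 2 - cHatSq z)) /
    (cHatSq z * Lam ψ n t h)

/-- The correction `G_n(η,δ)`. -/
def corr (n : ℕ) (η δ : ℝ) : ℝ :=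
  √(2 * η) + 2 * η / max 1 (√n * δ)

/-- The multiscale statistic. -/
def multiStat (ψ : ℝ → ℝ) (K : ℝ) {n : ℕ} (z : Fin (n + 1) → ℝ) : ℝ :=
  ⨆ p : scales n K, (|localStat ψ p.1.1 p.1.2 z| -
    corr n (2 * Real.log (1 / Lam ψ n p.1.1 p.1.2)) (Lam ψ n p.1.1 p.1.2))

/-- The critical value `κ_n^α`: the `(1-α)`-quantile of the multiscale statistic for `σ = 1`. -/
def critValue (ψ : ℝ → ℝ) (K α z₀ : ℝ) (n : ℕ) : ℝ :=
  sInf {r : ℝ | 1 - α ≤ (nullLaw z₀ n).real {z | multiStat ψ K z ≤ r}}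

/-- The test `T_n`. -/
def test (ψ : ℝ → ℝ) (K α z₀ : ℝ) (n : ℕ) : (Fin (n + 1) → ℝ) → ℝ :=
  indicator {z | critValue ψ K α z₀ n < multiStat ψ K z} 1

/-! ### Hölder classes, distance to constancy, rate and constant -/

/-- The Hölder class `ℋ(β,L)` on `ℝ`; for `β > 0`, `⌈β⌉₊ - 1` is the largest integer strictly
smaller than `β`. -/
def holderClass (β L : ℝ) : Set (ℝ → ℝ) :=
  {f | ContDiff ℝ ((⌈β⌉₊ - 1 : ℕ) : ℕ∞) f ∧ ∀ x y : ℝ,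
    |iteratedDeriv (⌈β⌉₊ - 1) f x - iteratedDeriv (⌈β⌉₊ - 1) f y| ≤
      L * |x - y| ^ (β - (⌈β⌉₊ - 1 : ℕ))}

/-- `‖σ‖²` in `L²([0,1])`. -/
def normSq (σ : ℝ → ℝ) : ℝ := ∫ t in (0 : ℝ)..1, σ t ^ 2

/-- `σ² / ‖σ‖²`. -/
def ratio (σ : ℝ → ℝ) (t : ℝ) : ℝ := σ t ^ 2 / normSq σ

/-- The distance `d_J(σ, H₀)` to the constant functions. -/
def distConst (J : Set ℝ) (σ : ℝ → ℝ) : ℝ := ⨆ t : J, |ratio σ t - 1|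

/-- The volatilities `σ` on `[0,1]` with `σ²/‖σ‖² ∈ ℋ(β,L)` (as a function on `[0,1]`, that is, as
the restriction to `[0,1]` of an element of the class) and `d_J(σ, H₀) ≥ r`. -/
def alternatives (β L : ℝ) (J : Set ℝ) (r : ℝ) : Set (ℝ → ℝ) :=
  {σ | IsVolatility σ ∧ (∃ g ∈ holderClass β L, EqOn (ratio σ) g (Icc 0 1)) ∧ r ≤ distConst J σ}

/-- `ρ_n(β) = (log n / n)^{β/(2β+1)}`. -/
def rate (β : ℝ) (n : ℕ) : ℝ := (Real.log n / n) ^ (β / (2 * β + 1))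

/-- `φ` minimizes the `L²(ℝ)`-norm over all `χ ∈ ℋ(β,1)` with `χ(0) ≥ 1`. -/
def IsOptimalRecoveryKernel (β : ℝ) (φ : ℝ → ℝ) : Prop :=
  (φ ∈ holderClass β 1 ∧ 1 ≤ φ 0) ∧
    ∀ χ ∈ holderClass β 1, 1 ≤ χ 0 → eLpNorm φ 2 volume ≤ eLpNorm χ 2 volume

/-- The optimal recovery kernel `ψ_β` for `0 < β ≤ 1`. -/
def recoveryKernel (β x : ℝ) : ℝ := if |x| ≤ 1 then 1 - |x| ^ β else 0

/-- The constant `c_*(β,L)` for `0 < β ≤ 1`. -/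
def cStar (β L : ℝ) : ℝ :=
  (4 * L ^ (1 / β) / ((2 * β + 1) * ∫ x, recoveryKernel β x ^ 2)) ^ (β / (2 * β + 1))

/-- At sample size `n`, the test rejects with probability at least `p` under `P_σ`, whatever the
probability space, the Brownian motion `W` and the solution `Z` of `dZ_t = σ(t) dW_t`, `Z_0 = z₀`,
by which `P_σ` is realized. -/
def HasPower.{u} (ψ : ℝ → ℝ) (K α z₀ : ℝ) (n : ℕ) (σ : ℝ → ℝ) (p : ℝ) : Prop :=
  ∀ (Ω : Type u) [MeasurableSpace Ω] (P : Measure Ω) [IsProbabilityMeasure P]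
    (W Z : ℝ≥0 → Ω → ℝ), IsBrownianReal W P → IsSolution P W σ z₀ Z →
    p ≤ P.real {ω | test ψ K α z₀ n (observe n Z ω) = 1}

end

end VolTest

open VolTest

namespace VolTest

noncomputable section

/-! ### Weighted sums of centred chi-square variables -/

/-! Under `P_σ` the squared increments satisfy n(ΔZ_k)² = ‖σ‖² θ_k ξ_k², where the ξ_k are
independent standard normal and θ_k is the average of σ²/‖σ‖² over the k-th cell, so that the θ_k
have mean one (`exists_std_increments`). The factor ‖σ‖² cancels in the statistic (`localStat_eq`).
The numerator is then the sum of a weighted centred chi-square variable, the deterministic signal ∑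
λ_k(θ_k - 1), and an error from estimating the level, of relative order n^{-1/2}
(`sum_weight_mul_sub`).

Null hypothesis. The critical values have to stay bounded. The Laurent–Massart inequality
`chiSum_tail` with v = Λ and b = n^{-1/2}, divided by √2 Λ, gives a threshold of at most G_n(x,Λ) at
tail probability 2e^{-x}; the choice x = log(1/Λ²) pays for the roughly 1/h essentially different
locations at bandwidth h. All (t,h) are reached by chaining over dyadic grids. For 2^{-i-1} < h ≤
2^{-i} the chain starts at relative mesh 2^{-√i}. This is fine enough that the Λ of the starting
point differs from the target Λ by a factor 1 + O(q^{√i}) with q < 1, and coarse enough that the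
number of starting points adds only O(√i) to the exponent x, which moves √x by O(1). The outcome is
`exists_kernelChi_le`, hence `exists_critValue_le`.

Alternatives. A probability density in a Hölder class is bounded (`exists_density_le`), so the noise
at one fixed (t,h) is O(Λ). Rejection is therefore likely as soon as the normalized signal at a
single (t,h) exceeds G_n by a large constant (`exists_hasPower`). What remains is deterministic.

For the rate, a Taylor polynomial and a Markov inequality show that a deviation r at t₀ forces a
deviation r/4 of constant sign on an interval of length of order h = (r/L)^{1/β}
(`exists_subinterval`, `exists_ratio_deviation`); this also covers β > 1. The signal-to-noise ratio
is of order √(n r² h), which at r = cρ_n is a large multiple of √(log n).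

For the sharp constant with β ≤ 1, the kernel is centred at the point of deviation with h =
(r/L)^{1/β}. The Hölder condition makes the deviation dominate r ψ_β((s-t)/h), so the ratio is at
least about √(n r² h ‖ψ_β‖²/2). The constant c_* turns this into (1+ε_n)√(2q log n) with q =
1/(2β+1), while G_n ≤ √(2q log n) + O(1) because Λ² is at least of order (log n/n)^q. The surplus
ε_n √(log n) diverges. -/

/-- The law of `n` independent standard normal variables. -/
abbrev stdGauss (n : ℕ) : Measure (Fin n → ℝ) := Measure.pi fun _ => gaussianReal 0 1

/-- The weighted sum `∑ a_k (ξ_k² - 1)`. -/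
def chiSum {n : ℕ} (a ξ : Fin n → ℝ) : ℝ := ∑ k, a k * (ξ k ^ 2 - 1)

lemma gaussianPDFReal_mul_exp (u x : ℝ) :
    gaussianPDFReal 0 1 x * Real.exp (u * (x ^ 2 - 1)) =
      (√(2 * Real.pi))⁻¹ * Real.exp (-u) * Real.exp (-(1 / 2 - u) * x ^ 2) := by
  simp only [gaussianPDFReal, NNReal.coe_one, mul_one, sub_zero]
  rw [mul_assoc, mul_assoc, ← Real.exp_add, ← Real.exp_add]
  congr 2
  ring

lemma integrable_exp_sq_sub_one {u : ℝ} (hu : u < 1 / 2) :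
    Integrable (fun x : ℝ => Real.exp (u * (x ^ 2 - 1))) (gaussianReal 0 1) := by
  rw [gaussianReal_of_var_ne_zero _ one_ne_zero,
    integrable_withDensity_iff_integrable_smul' (measurable_gaussianPDF 0 1)
      (ae_of_all _ fun _ => gaussianPDF_lt_top)]
  simp only [toReal_gaussianPDF, smul_eq_mul, gaussianPDFReal_mul_exp]
  exact (integrable_exp_neg_mul_sq (by linarith)).const_mul _

lemma integral_exp_sq_sub_one {u : ℝ} (hu : u < 1 / 2) :
    ∫ x : ℝ, Real.exp (u * (x ^ 2 - 1)) ∂gaussianReal 0 1 = Real.exp (-u) / √(1 - 2 * u) := by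
  rw [integral_gaussianReal_eq_integral_smul one_ne_zero]
  simp only [smul_eq_mul, gaussianPDFReal_mul_exp]
  rw [integral_const_mul, integral_gaussian]
  have h1 : Real.pi / (1 / 2 - u) = (2 * Real.pi) / (1 - 2 * u) := by
    have : 1 - 2 * u ≠ 0 := by linarith
    have : 1 / 2 - u ≠ 0 := by linarith
    field_simp
  rw [h1, Real.sqrt_div (by positivity)]
  have h2 : √(2 * Real.pi) ≠ 0 := by positivity
  field_simp

/-- Sub-gamma bound for the log-moment generating function of ξ² - 1. For u ≥ 0 it is log w ≤
sinh(log w) with w = 1/(1-2u); for u ≤ 0 it follows from log(1+x) ≥ 2x/(x+2). -/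
lemma neg_log_one_sub_two_mul_le {u : ℝ} (hu : |u| < 1 / 2) :
    -u - Real.log (1 - 2 * u) / 2 ≤ u ^ 2 / (1 - 2 * |u|) := by
  rcases le_total 0 u with h | h
  · rw [abs_of_nonneg h] at hu ⊢
    have hy : 0 < 1 - 2 * u := by linarith
    have hw : 1 ≤ (1 - 2 * u)⁻¹ := (one_le_inv₀ hy).2 (by linarith)
    have := Real.self_le_sinh_iff.2 (Real.log_nonneg hw)
    rw [Real.sinh_log (by positivity), Real.log_inv, inv_inv] at this
    have e : ((1 - 2 * u)⁻¹ - (1 - 2 * u)) / 2 = 2 * (u + u ^ 2 / (1 - 2 * u)) := by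
      field_simp
      ring
    linarith
  · rw [abs_of_nonpos h] at hu ⊢
    have h1 := Real.le_log_one_add_of_nonneg (x := -2 * u) (by linarith)
    have h2 : 1 - 2 * u = 1 + -2 * u := by ring
    rw [h2]
    have h3 : -2 * u - (-2 * u) ^ 2 / 2 ≤ 2 * (-2 * u) / (-2 * u + 2) := by
      rw [le_div_iff₀ (by linarith)]
      nlinarith [mul_nonneg (sq_nonneg u) (neg_nonneg.2 h)]
    have h4 : u ^ 2 ≤ u ^ 2 / (1 - 2 * -u) := by
      rw [le_div_iff₀ (by linarith)]
      nlinarith [mul_nonneg (sq_nonneg u) (neg_nonneg.2 h)]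
    nlinarith

lemma integral_exp_sq_sub_one_le {u : ℝ} (hu : |u| < 1 / 2) :
    ∫ x : ℝ, Real.exp (u * (x ^ 2 - 1)) ∂gaussianReal 0 1 ≤ Real.exp (u ^ 2 / (1 - 2 * |u|)) := by
  have h1 : u < 1 / 2 := (le_abs_self u).trans_lt hu
  rw [integral_exp_sq_sub_one h1]
  have h2 : √(1 - 2 * u) = Real.exp (Real.log (1 - 2 * u) / 2) := by
    rw [Real.exp_half, Real.exp_log (by linarith)]
  rw [h2, ← Real.exp_sub]
  exact Real.exp_le_exp.2 (neg_log_one_sub_two_mul_le hu)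

/-- Chernoff's method: independence factorizes the moment generating function, and each factor is
sub-gamma with the common scale b. -/
lemma chiSum_upper_tail {n : ℕ} (a : Fin n → ℝ) {v b x : ℝ} (hv : 0 ≤ v) (hb : 0 ≤ b)
    (hx : 0 ≤ x) (hav : ∑ k, a k ^ 2 ≤ v ^ 2) (hab : ∀ k, |a k| ≤ b) :
    (stdGauss n).real {ξ | 2 * v * √x + 2 * b * x < chiSum a ξ} ≤ Real.exp (-x) := by
  rcases hv.eq_or_lt with rfl | hv
  -- Degenerate case: for v = 0 the denominator D below may vanish, but then all coefficients are
  -- zero and the event is empty.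
  · have ha : ∀ k, a k = 0 := fun k => by
      have : a k ^ 2 ≤ 0 := by
        refine (Finset.single_le_sum (f := fun k => a k ^ 2) (fun _ _ => sq_nonneg _)
          (Finset.mem_univ k)).trans (by simpa using hav)
      nlinarith [sq_nonneg (a k), pow_eq_zero_iff (two_ne_zero) |>.1 (le_antisymm this (sq_nonneg _))]
    have : {ξ : Fin n → ℝ | 2 * 0 * √x + 2 * b * x < chiSum a ξ} = ∅ := by
      ext ξ
      simp only [chiSum, ha, mem_ofPred_eq, mem_empty_iff_false, iff_false, not_lt]
      simp only [zero_mul, Finset.sum_const_zero]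
      positivity
    rw [this]
    simpa using (Real.exp_pos _).le
  set D := v + 2 * b * √x with hD
  have hD0 : 0 < D := by positivity
  -- This parameter gives 1 - 2sb = v/D, and the Chernoff exponent becomes exactly -x.
  set s := √x / D with hs
  have hs0 : 0 ≤ s := by positivity
  have hsb : 1 - 2 * (s * b) = v / D := by rw [hs]; field_simp; rw [hD]; ring
  have hvD : 0 < v / D := by positivity
  have hsa : ∀ k, |s * a k| ≤ s * b := fun k => by
    rw [abs_mul, abs_of_nonneg hs0]; exact mul_le_mul_of_nonneg_left (hab k) hs0
  have hsa2 : ∀ k, |s * a k| < 1 / 2 := fun k => (hsa k).trans_lt (by linarith)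
  have hprod : ∀ ξ : Fin n → ℝ,
      Real.exp (s * chiSum a ξ) = ∏ k, Real.exp (s * a k * (ξ k ^ 2 - 1)) := fun ξ => by
    rw [← Real.exp_sum, chiSum, Finset.mul_sum]; simp only [mul_assoc]
  have hint : Integrable (fun ξ => Real.exp (s * chiSum a ξ)) (stdGauss n) := by
    simp only [hprod]
    exact Integrable.fintype_prod fun k =>
      integrable_exp_sq_sub_one ((le_abs_self _).trans_lt (hsa2 k))
  have hmgf : mgf (chiSum a) (stdGauss n) s ≤ Real.exp (s ^ 2 * v ^ 2 / (v / D)) := by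
    rw [mgf]
    simp only [hprod]
    rw [integral_fintype_prod_eq_prod (fun k (y : ℝ) => Real.exp (s * a k * (y ^ 2 - 1)))]
    calc _ ≤ ∏ k, Real.exp ((s * a k) ^ 2 / (v / D)) := by
          refine Finset.prod_le_prod (fun k _ => integral_nonneg fun _ => (Real.exp_pos _).le)
            fun k _ => (integral_exp_sq_sub_one_le (hsa2 k)).trans (Real.exp_le_exp.2 ?_)
          refine div_le_div_of_nonneg_left (sq_nonneg _) hvD ?_
          linarith [hsa k]
      _ = Real.exp (s ^ 2 * (∑ k, a k ^ 2) / (v / D)) := by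
          rw [← Real.exp_sum, ← Finset.sum_div, Finset.mul_sum]; simp only [mul_pow]
      _ ≤ _ := by gcongr
  calc _ ≤ (stdGauss n).real {ξ | 2 * v * √x + 2 * b * x ≤ chiSum a ξ} :=
        measureReal_mono (ofPred_subset_ofPred.2 fun ξ h => le_of_lt h)
    _ ≤ Real.exp (-s * (2 * v * √x + 2 * b * x)) * mgf (chiSum a) (stdGauss n) s :=
        measure_ge_le_exp_mul_mgf _ hs0 hint
    _ ≤ Real.exp (-s * (2 * v * √x + 2 * b * x)) * Real.exp (s ^ 2 * v ^ 2 / (v / D)) := by gcongr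
    _ = Real.exp (-x) := by
        rw [← Real.exp_add]
        congr 1
        have hxx : √x ^ 2 = x := Real.sq_sqrt hx
        rw [hs]
        field_simp
        rw [hD]
        linear_combination (-v) * hxx

/-- The Laurent–Massart deviation inequality, two-sided. -/
lemma chiSum_tail {n : ℕ} (a : Fin n → ℝ) {v b x : ℝ} (hv : 0 ≤ v) (hb : 0 ≤ b)
    (hx : 0 ≤ x) (hav : ∑ k, a k ^ 2 ≤ v ^ 2) (hab : ∀ k, |a k| ≤ b) :
    (stdGauss n).real {ξ | 2 * v * √x + 2 * b * x < |chiSum a ξ|} ≤ 2 * Real.exp (-x) := by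
  have h1 := chiSum_upper_tail a hv hb hx hav hab
  have h2 := chiSum_upper_tail (fun k => - a k) hv hb hx (by simpa using hav) (by simpa using hab)
  have h3 : ∀ ξ, chiSum (fun k => - a k) ξ = - chiSum a ξ := fun ξ => by simp [chiSum]
  simp only [h3] at h2
  have : {ξ | 2 * v * √x + 2 * b * x < |chiSum a ξ|} ⊆
      {ξ | 2 * v * √x + 2 * b * x < chiSum a ξ} ∪ {ξ | 2 * v * √x + 2 * b * x < -chiSum a ξ} :=
    ofPred_or ▸ ofPred_subset_ofPred.2 fun ξ h => lt_abs.1 h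
  linarith [measureReal_mono (μ := stdGauss n) this (measure_ne_top _ _),
    measureReal_union_le (μ := stdGauss n) {ξ | 2 * v * √x + 2 * b * x < chiSum a ξ}
      {ξ | 2 * v * √x + 2 * b * x < -chiSum a ξ}]

end

end VolTest

namespace VolTest

noncomputable section

/-! ### Cell integrals and kernel weights -/

/-- The integral of `u` over the cell `[k/n, (k+1)/n]`. -/
def cellInt (n : ℕ) (u : ℝ → ℝ) (k : Fin n) : ℝ :=
  ∫ s in ((k : ℕ) / n : ℝ)..(((k : ℕ) + 1) / n : ℝ), u s

/-- The rescaled kernel `s ↦ ψ ((s - t) / h)`. -/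
def rescale (ψ : ℝ → ℝ) (t h s : ℝ) : ℝ := ψ ((s - t) / h)

lemma weight_eq (ψ : ℝ → ℝ) (n : ℕ) (t h : ℝ) (k : Fin n) :
    weight ψ n t h k = √n * cellInt n (rescale ψ t h) k := rfl

lemma cell_nonneg {n : ℕ} (k : Fin n) : (0 : ℝ) ≤ (k : ℕ) / n := by positivity

lemma cell_le {n : ℕ} (k : Fin n) : ((k : ℕ) / n : ℝ) ≤ ((k : ℕ) + 1) / n := by
  gcongr; linarith

lemma cell_le_one {n : ℕ} (k : Fin n) : (((k : ℕ) + 1) / n : ℝ) ≤ 1 := by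
  refine div_le_one_of_le₀ ?_ (by positivity)
  exact_mod_cast k.2

lemma cell_length {n : ℕ} (k : Fin n) :
    (((k : ℕ) + 1) / n : ℝ) - (k : ℕ) / n = 1 / n := by ring

lemma cell_subset {n : ℕ} (k : Fin n) :
    Icc ((k : ℕ) / n : ℝ) (((k : ℕ) + 1) / n) ⊆ Icc 0 1 :=
  Icc_subset_Icc (cell_nonneg k) (cell_le_one k)

lemma intervalIntegrable_cell {n : ℕ} {u : ℝ → ℝ} (hu : IntervalIntegrable u volume 0 1)
    (k : Fin n) : IntervalIntegrable u volume ((k : ℕ) / n : ℝ) (((k : ℕ) + 1) / n) := by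
  refine hu.mono_set ?_
  rw [uIcc_of_le (cell_le k), uIcc_of_le zero_le_one]
  exact cell_subset k

lemma sum_cellInt {n : ℕ} (hn : 1 ≤ n) {u : ℝ → ℝ} (hu : IntervalIntegrable u volume 0 1) :
    ∑ k : Fin n, cellInt n u k = ∫ s in (0 : ℝ)..1, u s := by
  have hn0 : (n : ℝ) ≠ 0 := by positivity
  have h := intervalIntegral.sum_integral_adjacent_intervals (f := u) (μ := volume)
    (a := fun k : ℕ => (k / n : ℝ)) (n := n) (fun k hk => by
      simpa using intervalIntegrable_cell hu ⟨k, hk⟩)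
  simp only [Nat.cast_zero, zero_div, div_self hn0] at h
  rw [← h, ← Fin.sum_univ_eq_sum_range (fun k : ℕ => ∫ x in (k / n : ℝ)..((k + 1 : ℕ) / n : ℝ), u x)]
  simp [cellInt]

lemma cellInt_mono {n : ℕ} {u v : ℝ → ℝ} (hu : IntervalIntegrable u volume 0 1)
    (hv : IntervalIntegrable v volume 0 1) (k : Fin n)
    (h : ∀ s ∈ Icc ((k : ℕ) / n : ℝ) (((k : ℕ) + 1) / n), u s ≤ v s) :
    cellInt n u k ≤ cellInt n v k :=
  intervalIntegral.integral_mono_on (cell_le k) (intervalIntegrable_cell hu k)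
    (intervalIntegrable_cell hv k) h

lemma cellInt_const {n : ℕ} (c : ℝ) (k : Fin n) : cellInt n (fun _ => c) k = c / n := by
  rw [cellInt, intervalIntegral.integral_const, cell_length, smul_eq_mul]; ring

lemma abs_cellInt_le {n : ℕ} {u : ℝ → ℝ} {B : ℝ} (k : Fin n)
    (h : ∀ s ∈ Icc ((k : ℕ) / n : ℝ) (((k : ℕ) + 1) / n), |u s| ≤ B) : |cellInt n u k| ≤ B / n := by
  have := intervalIntegral.norm_integral_le_of_norm_le_const (f := u) (C := B)
    (a := ((k : ℕ) / n : ℝ)) (b := ((k : ℕ) + 1) / n) (fun s hs => by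
      rw [uIoc_of_le (cell_le k)] at hs
      exact h s (Ioc_subset_Icc_self hs))
  rw [cell_length, abs_of_nonneg (by positivity), Real.norm_eq_abs] at this
  simpa [cellInt, div_eq_mul_inv] using this

/-- Replacing a factor by its cell averages changes an integral by at most its oscillation. -/
lemma abs_sum_cellInt_mul_sub_le {n : ℕ} (hn : 1 ≤ n) {f g : ℝ → ℝ} {e : ℝ}
    (hf : ContinuousOn f (Icc 0 1)) (hg : Continuous g) (hg0 : ∀ s, 0 ≤ g s)
    (hfe : ∀ x ∈ Icc (0 : ℝ) 1, ∀ y ∈ Icc (0 : ℝ) 1, |x - y| ≤ 1 / n → |f x - f y| ≤ e) :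
    |∑ k : Fin n, cellInt n g k * (n * cellInt n f k) - ∫ s in (0 : ℝ)..1, g s * f s| ≤
      e * ∫ s in (0 : ℝ)..1, g s := by
  have hn0 : (n : ℝ) ≠ 0 := by positivity
  have hfi : IntervalIntegrable f volume 0 1 :=
    ContinuousOn.intervalIntegrable (by rwa [uIcc_of_le zero_le_one])
  have hgi : IntervalIntegrable g volume 0 1 := hg.intervalIntegrable _ _
  have hgfi : IntervalIntegrable (fun s => g s * f s) volume 0 1 := hfi.continuousOn_mul hg.continuousOn
  rw [← sum_cellInt hn hgfi, ← sum_cellInt hn hgi, ← Finset.sum_sub_distrib, Finset.mul_sum]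
  refine (Finset.abs_sum_le_sum_abs _ _).trans (Finset.sum_le_sum fun k _ => ?_)
  have havg : ∀ s ∈ Icc ((k : ℕ) / n : ℝ) (((k : ℕ) + 1) / n), |n * cellInt n f k - f s| ≤ e := by
    intro s hs
    have h1 : n * cellInt n f k - f s = n * cellInt n (fun r => f r - f s) k := by
      have : cellInt n (fun r => f r - f s) k = cellInt n f k - f s / n := by
        rw [← cellInt_const (f s) k, cellInt, cellInt, cellInt,
          intervalIntegral.integral_sub (intervalIntegrable_cell hfi k) (by simp)]
      rw [this]; field_simp
    rw [h1, abs_mul, Nat.abs_cast]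
    have := abs_cellInt_le (u := fun r => f r - f s) (B := e) k fun r hr =>
      hfe r (cell_subset k hr) s (cell_subset k hs) (by
        rw [← cell_length k, abs_le]; constructor <;> linarith [hr.1, hr.2, hs.1, hs.2])
    calc (n : ℝ) * |cellInt n (fun r => f r - f s) k| ≤ n * (e / n) := by gcongr
      _ = e := by field_simp
  have h2 : cellInt n g k * (n * cellInt n f k) - cellInt n (fun s => g s * f s) k =
      cellInt n (fun s => g s * (n * cellInt n f k - f s)) k := by
    simp only [mul_sub]
    conv_rhs => rw [cellInt]
    rw [intervalIntegral.integral_sub (by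
      exact (intervalIntegrable_cell hgi k).mul_const _) (intervalIntegrable_cell hgfi k),
      intervalIntegral.integral_mul_const]
    rfl
  have h3 : IntervalIntegrable (fun s => g s * (n * cellInt n f k - f s)) volume 0 1 := by
    simp only [mul_sub]
    exact (hgi.mul_const _).sub hgfi
  have h4 : ∀ c : ℝ, cellInt n (fun s => c * g s) k = c * cellInt n g k := fun c =>
    intervalIntegral.integral_const_mul _ _
  rw [h2, abs_le, ← neg_mul, ← h4, ← h4]
  refine ⟨cellInt_mono (hgi.const_mul _) h3 k fun s hs => ?_,
    cellInt_mono h3 (hgi.const_mul _) k fun s hs => ?_⟩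
  · nlinarith [abs_le.1 (havg s hs), hg0 s]
  · nlinarith [abs_le.1 (havg s hs), hg0 s]

/-- Nonnegativity of the variance of `u` over the cell, with m the cell mean. -/
lemma sq_cellInt_le {n : ℕ} {u : ℝ → ℝ} (hu : Continuous u) (k : Fin n) :
    n * cellInt n u k ^ 2 ≤ cellInt n (fun s => u s ^ 2) k := by
  have hn0 : (n : ℝ) ≠ 0 := by have := k.pos; positivity
  set m := n * cellInt n u k with hm
  have h0 : 0 ≤ cellInt n (fun s => (u s - m) ^ 2) k :=
    intervalIntegral.integral_nonneg (cell_le k) fun _ _ => sq_nonneg _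
  have h1 : cellInt n (fun s => (u s - m) ^ 2) k =
      cellInt n (fun s => u s ^ 2) k - 2 * m * cellInt n u k + m ^ 2 / n := by
    have : ∀ s, (u s - m) ^ 2 = u s ^ 2 - 2 * m * u s + m ^ 2 := fun s => by ring
    rw [← cellInt_const (m ^ 2) k]
    simp only [cellInt, this]
    rw [intervalIntegral.integral_add, intervalIntegral.integral_sub,
      intervalIntegral.integral_const_mul]
    all_goals exact Continuous.intervalIntegrable (by fun_prop) _ _
  have h2 : m ^ 2 / n = n * cellInt n u k ^ 2 := by rw [hm]; field_simp
  have h3 : m * cellInt n u k = n * cellInt n u k ^ 2 := by rw [hm]; ring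
  nlinarith

/-- Passing to cell averages contracts L². Both the bound on Λ_n and the bound on increments of the
weights come from this. -/
lemma sum_sq_cellInt_le {n : ℕ} (hn : 1 ≤ n) {u : ℝ → ℝ} (hu : Continuous u) :
    ∑ k : Fin n, (√n * cellInt n u k) ^ 2 ≤ ∫ s in (0 : ℝ)..1, u s ^ 2 := by
  rw [← sum_cellInt hn (Continuous.intervalIntegrable (by fun_prop) _ _)]
  refine Finset.sum_le_sum fun k _ => ?_
  rw [mul_pow, Real.sq_sqrt (by positivity)]
  exact sq_cellInt_le hu k

lemma integral_sq_le_of_support {u : ℝ → ℝ} (hu : Continuous u) {B c d : ℝ} (hcd : c ≤ d)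
    (hB : ∀ s, |u s| ≤ B) (hs : ∀ s, s ∉ Icc c d → u s = 0) :
    ∫ s in (0 : ℝ)..1, u s ^ 2 ≤ B ^ 2 * (d - c) := by
  rw [intervalIntegral.integral_of_le zero_le_one]
  have hi : Integrable ((Icc c d).indicator fun _ => B ^ 2) :=
    (integrable_indicator_iff measurableSet_Icc).2 (integrableOn_const (by simp))
  have hle : ∀ s, u s ^ 2 ≤ (Icc c d).indicator (fun _ => B ^ 2) s := fun s => by
    by_cases h : s ∈ Icc c d
    · rw [indicator_of_mem h]; exact sq_le_sq' (abs_le.1 (hB s)).1 (abs_le.1 (hB s)).2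
    · rw [indicator_of_notMem h, hs s h]; simp
  calc _ ≤ ∫ s in Ioc (0 : ℝ) 1, (Icc c d).indicator (fun _ => B ^ 2) s :=
        setIntegral_mono (by
          have := (hu.pow 2).intervalIntegrable (μ := volume) 0 1
          exact (intervalIntegrable_iff_integrableOn_Ioc_of_le zero_le_one).1 this)
          hi.integrableOn hle
    _ ≤ ∫ s, (Icc c d).indicator (fun _ => B ^ 2) s :=
        setIntegral_le_integral hi (ae_of_all _ fun s => indicator_nonneg (fun _ _ => sq_nonneg _) s)
    _ = B ^ 2 * (d - c) := by
        rw [integral_indicator measurableSet_Icc]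
        simp [hcd, mul_comm]

/-! ### Kernels: weights, the norm Λ_n, and continuity in location and bandwidth. -/

variable {ψ : ℝ → ℝ}

lemma IsKernel.continuous (hψ : IsKernel ψ) : Continuous ψ := by
  obtain ⟨γ, h0, -, h⟩ := hψ.holder
  exact h.continuous h0

lemma IsKernel.eq_zero (hψ : IsKernel ψ) {x : ℝ} (hx : 1 < |x|) : ψ x = 0 := by
  by_contra h
  have := hψ.support h
  exact absurd (abs_le.2 this) (not_le.2 hx)

lemma IsKernel.abs_le_one (hψ : IsKernel ψ) (x : ℝ) : |ψ x| ≤ 1 := by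
  rw [abs_of_nonneg (hψ.nonneg x)]; exact hψ.le_one x

lemma _root_.HolderWith.abs_sub_le {γ : ℝ≥0} (h : HolderWith 1 γ ψ) (x y : ℝ) :
    |ψ x - ψ y| ≤ |x - y| ^ (γ : ℝ) := by
  have := h.dist_le x y
  simpa [Real.dist_eq] using this

lemma IsKernel.continuous_rescale (hψ : IsKernel ψ) (t h : ℝ) : Continuous (rescale ψ t h) :=
  hψ.continuous.comp (by fun_prop)

lemma IsKernel.rescale_nonneg (hψ : IsKernel ψ) (t h s : ℝ) : 0 ≤ rescale ψ t h s := hψ.nonneg _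

lemma IsKernel.rescale_eq_zero (hψ : IsKernel ψ) {t h s : ℝ} (hh : 0 < h) (hs : h < |s - t|) :
    rescale ψ t h s = 0 := by
  refine hψ.eq_zero ?_
  rwa [abs_div, abs_of_pos hh, one_lt_div hh]

lemma IsKernel.weight_nonneg (hψ : IsKernel ψ) (n : ℕ) (t h : ℝ) (k : Fin n) :
    0 ≤ weight ψ n t h k :=
  mul_nonneg (by positivity) (intervalIntegral.integral_nonneg (cell_le k) fun _ _ => hψ.nonneg _)

lemma sqrt_mul_div_self (n : ℕ) (B : ℝ) : √n * (B / n) = B / √n := by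
  rcases Nat.eq_zero_or_pos n with rfl | hn
  · simp
  · have h : (√n : ℝ) * √n = n := Real.mul_self_sqrt (by positivity)
    rw [mul_div_assoc', div_eq_div_iff (by positivity) (by positivity)]; linear_combination B * h

lemma IsKernel.weight_le (hψ : IsKernel ψ) (n : ℕ) (t h : ℝ) (k : Fin n) :
    weight ψ n t h k ≤ 1 / √n := by
  rw [weight_eq, ← sqrt_mul_div_self]
  gcongr
  exact (le_abs_self _).trans (abs_cellInt_le k fun s _ => hψ.abs_le_one _)

lemma Lam_nonneg (ψ : ℝ → ℝ) (n : ℕ) (t h : ℝ) : 0 ≤ Lam ψ n t h := Real.sqrt_nonneg _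

lemma Lam_sq (ψ : ℝ → ℝ) (n : ℕ) (t h : ℝ) : Lam ψ n t h ^ 2 = ∑ k, weight ψ n t h k ^ 2 :=
  Real.sq_sqrt (Finset.sum_nonneg fun _ _ => sq_nonneg _)

lemma IsKernel.Lam_sq_le_integral (hψ : IsKernel ψ) {n : ℕ} (hn : 1 ≤ n) (t h : ℝ) :
    Lam ψ n t h ^ 2 ≤ ∫ s in (0 : ℝ)..1, rescale ψ t h s ^ 2 := by
  rw [Lam_sq]
  exact sum_sq_cellInt_le hn (hψ.continuous_rescale t h)

lemma IsKernel.Lam_sq_le (hψ : IsKernel ψ) {n : ℕ} (hn : 1 ≤ n) (t : ℝ) {h : ℝ} (hh : 0 < h) :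
    Lam ψ n t h ^ 2 ≤ 2 * h := by
  refine (hψ.Lam_sq_le_integral hn t h).trans ?_
  have := integral_sq_le_of_support (hψ.continuous_rescale t h) (B := 1) (c := t - h) (d := t + h)
    (by linarith) (fun s => hψ.abs_le_one _) (fun s hs => hψ.rescale_eq_zero hh (by
      by_contra! h'
      exact hs ⟨by linarith [(abs_le.1 h').1], by linarith [(abs_le.1 h').2]⟩))
  linarith

lemma IsKernel.sum_weight (hψ : IsKernel ψ) {n : ℕ} (hn : 1 ≤ n) (t h : ℝ) :
    ∑ k, weight ψ n t h k = √n * ∫ s in (0 : ℝ)..1, rescale ψ t h s := by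
  simp only [weight_eq]
  rw [← Finset.mul_sum, sum_cellInt hn ((hψ.continuous_rescale t h).intervalIntegrable _ _)]

/-- Integrals of functions of the rescaled kernel over `[0,1]`. -/
lemma IsKernel.integral_rescale (hψ : IsKernel ψ) {t h : ℝ} (hh : 0 < h) (h0 : 0 ≤ t - h)
    (h1 : t + h ≤ 1) (F : ℝ → ℝ) (hF : F 0 = 0) :
    ∫ s in (0 : ℝ)..1, F (rescale ψ t h s) = h * ∫ x, F (ψ x) := by
  have e : ∀ s, s ∉ Icc (0 : ℝ) 1 → F (rescale ψ t h s) = 0 := fun s hs => by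
    rw [hψ.rescale_eq_zero hh, hF]
    by_contra! h'
    exact hs ⟨by linarith [(abs_le.1 h').1], by linarith [(abs_le.1 h').2]⟩
  rw [intervalIntegral.integral_of_le zero_le_one, ← integral_Icc_eq_integral_Ioc,
    setIntegral_eq_integral_of_forall_compl_eq_zero e]
  have := integral_sub_right_eq_self (μ := volume) (fun s => F (ψ (s / h))) t
  simp only [rescale]
  rw [this, Measure.integral_comp_div (fun x => F (ψ x)) h, abs_of_pos hh, smul_eq_mul]

lemma IsKernel.integrable_sq (hψ : IsKernel ψ) : Integrable fun x => ψ x ^ 2 := by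
  refine Continuous.integrable_of_hasCompactSupport (hψ.continuous.pow 2) ?_
  refine HasCompactSupport.of_support_subset_isCompact (isCompact_Icc (a := (-1 : ℝ)) (b := 1)) ?_
  intro x hx
  exact hψ.support fun h => hx (by simp [h])

lemma IsKernel.integral_sq_pos (hψ : IsKernel ψ) : 0 < ∫ x, ψ x ^ 2 := by
  refine (hψ.continuous.pow 2).integral_pos_of_hasCompactSupport_nonneg_nonzero ?_
    (fun x => sq_nonneg _) (x := 0) (by simp [hψ.zero])
  refine HasCompactSupport.of_support_subset_isCompact (isCompact_Icc (a := (-1 : ℝ)) (b := 1)) ?_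
  intro x hx
  exact hψ.support fun h => hx (by simp [h])

lemma IsKernel.integral_le_two (hψ : IsKernel ψ) : ∫ x, ψ x ≤ 2 := by
  rw [← setIntegral_eq_integral_of_forall_compl_eq_zero (s := Icc (-1) 1)
    (fun x hx => by by_contra h; exact hx (hψ.support h))]
  calc ∫ x in Icc (-1 : ℝ) 1, ψ x ≤ ∫ x in Icc (-1 : ℝ) 1, (1 : ℝ) :=
        setIntegral_mono (hψ.continuous.integrableOn_Icc) (integrableOn_const (by simp)) hψ.le_one
    _ = 2 := by simp; norm_num

lemma IsKernel.integral_rescale_le (hψ : IsKernel ψ) {t h : ℝ} (hh : 0 < h) (h0 : 0 ≤ t - h)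
    (h1 : t + h ≤ 1) : ∫ s in (0 : ℝ)..1, rescale ψ t h s ≤ 2 * h := by
  have := hψ.integral_rescale hh h0 h1 (fun x => x) rfl
  rw [this]
  nlinarith [hψ.integral_le_two]

/-- At bandwidths well above `1/n`, `Λ_n(t,h)²` is of the order of `h`. -/
lemma IsKernel.exists_le_Lam_sq (hψ : IsKernel ψ) :
    ∃ c > 0, ∃ C > 0, ∀ n : ℕ, 1 ≤ n → ∀ t h : ℝ, C / n ≤ h → 0 ≤ t - h → t + h ≤ 1 →
      c * h ≤ Lam ψ n t h ^ 2 := by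
  obtain ⟨γ, hγ0, -, hγ⟩ := hψ.holder
  set I := ∫ x, ψ x ^ 2 with hI
  have hI0 : 0 < I := hψ.integral_sq_pos
  -- For h ≥ C/n the rescaled kernel oscillates by at most I/4 on a cell. Since its integral is at
  -- most 2h, replacing ψ by cell averages changes hI by at most hI/2.
  refine ⟨I / 2, by positivity, (4 / I) ^ (1 / (γ : ℝ)), by positivity, fun n hn t h hh h0 h1 => ?_⟩
  have hn0 : (0 : ℝ) < n := by positivity
  have hC : 0 < (4 / I) ^ (1 / (γ : ℝ)) := by positivity
  have hh0 : 0 < h := lt_of_lt_of_le (by positivity) hh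
  have hγ0' : (0 : ℝ) < γ := by exact_mod_cast hγ0
  have hosc : (1 / n / h) ^ (γ : ℝ) ≤ I / 4 := by
    have : 1 / n / h ≤ ((4 / I) ^ (1 / (γ : ℝ)))⁻¹ := by
      rw [div_le_iff₀ hn0] at hh
      rw [div_div, one_div]
      gcongr
      linarith
    calc (1 / n / h) ^ (γ : ℝ) ≤ (((4 / I) ^ (1 / (γ : ℝ)))⁻¹) ^ (γ : ℝ) := by gcongr
      _ = I / 4 := by
        rw [Real.inv_rpow hC.le, ← Real.rpow_mul (by positivity), one_div_mul_cancel hγ0'.ne',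
          Real.rpow_one, inv_div]
  have key := abs_sum_cellInt_mul_sub_le hn (e := I / 4) (hψ.continuous_rescale t h).continuousOn
    (hψ.continuous_rescale t h) (hψ.rescale_nonneg t h) (fun x _ y _ hxy => by
      refine (hγ.abs_sub_le _ _).trans (le_trans ?_ hosc)
      rw [show (x - t) / h - (y - t) / h = (x - y) / h by ring, abs_div, abs_of_pos hh0]
      gcongr)
  have e1 : ∑ k : Fin n, cellInt n (rescale ψ t h) k * (n * cellInt n (rescale ψ t h) k) =
      Lam ψ n t h ^ 2 := by
    rw [Lam_sq]
    refine Finset.sum_congr rfl fun k _ => ?_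
    rw [weight_eq, mul_pow, Real.sq_sqrt hn0.le]; ring
  have e2 : ∫ s in (0 : ℝ)..1, rescale ψ t h s * rescale ψ t h s = h * I := by
    have := hψ.integral_rescale hh0 h0 h1 (fun x => x ^ 2) (by simp)
    simp only [pow_two] at this
    rw [this, hI]
    simp only [pow_two]
  rw [e1, e2] at key
  have h2 := hψ.integral_rescale_le hh0 h0 h1
  nlinarith [(abs_le.1 key).1]

lemma IsKernel.exists_isScaleConstant (hψ : IsKernel ψ) : ∃ K, IsScaleConstant ψ K := by
  obtain ⟨c, hc, C, hC, H⟩ := hψ.exists_le_Lam_sq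
  -- The summand C makes the lower bound ch ≤ Λ² available, and 1/c makes ch at least 1/n.
  refine ⟨C + 1 / c, by positivity, fun n hn p hp => ?_⟩
  obtain ⟨⟨h1, -⟩, h2, h3⟩ := hp
  have hn0 : (0 : ℝ) < n := by positivity
  have h4 : C / n ≤ p.2 := le_trans (by gcongr; simp [hc.le]) h1
  have h5 : 1 / c / n ≤ p.2 := le_trans (by gcongr; simp [hC.le]) h1
  refine le_trans ?_ (H n hn p.1 p.2 h4 (by linarith) (by linarith))
  calc 1 / (n : ℝ) = c * (1 / c / n) := by field_simp
    _ ≤ c * p.2 := by gcongr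

/-- Λ² is of order h down to the smallest bandwidths for any admissible K: when h ≤ C/n, the
defining property Λ² ≥ 1/n already gives Λ² ≥ h/C. -/
lemma IsScaleConstant.exists_le_Lam_sq {K : ℝ} (hψ : IsKernel ψ) (hK : IsScaleConstant ψ K) :
    ∃ c > 0, ∀ n : ℕ, 1 ≤ n → ∀ p ∈ scales n K, c * p.2 ≤ Lam ψ n p.1 p.2 ^ 2 := by
  obtain ⟨c, hc, C, hC, H⟩ := hψ.exists_le_Lam_sq
  refine ⟨min c (1 / C), by positivity, fun n hn p hp => ?_⟩
  have hn0 : (0 : ℝ) < n := by positivity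
  have hp2 : 0 < p.2 := lt_of_lt_of_le (div_pos hK.1 hn0) hp.1.1
  rcases le_total (C / n) p.2 with h | h
  · refine le_trans ?_ (H n hn p.1 p.2 h (by linarith [hp.2.1]) (by linarith [hp.2.2]))
    gcongr; exact min_le_left _ _
  · refine le_trans ?_ (hK.2 n hn p hp)
    calc min c (1 / C) * p.2 ≤ 1 / C * (C / n) := by gcongr; exact min_le_right _ _
      _ = 1 / n := by field_simp

/-- If s lies in neither support, both values vanish. Otherwise, by symmetry, |s - t'| ≤ h', and the
arguments differ by (t'-t)/h + ((s-t')/h')·(h'-h)/h, whose two terms are at most 2ε each. -/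
lemma IsKernel.abs_rescale_sub_le {γ : ℝ≥0} (hψ : IsKernel ψ) (hγ : HolderWith 1 γ ψ)
    {t t' h h' H ε : ℝ} (hH : 0 < H) (h1 : H / 2 ≤ h) (h1' : H / 2 ≤ h')
    (ht : |t - t'| ≤ ε * H) (hh : |h - h'| ≤ ε * H) (s : ℝ) :
    |rescale ψ t h s - rescale ψ t' h' s| ≤ (4 * ε) ^ (γ : ℝ) := by
  have hε : 0 ≤ ε := by
    by_contra! h; nlinarith [abs_nonneg (t - t')]
  have key : ∀ t t' h h' : ℝ, H / 2 ≤ h → H / 2 ≤ h' → |t - t'| ≤ ε * H → |h - h'| ≤ ε * H →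
      |s - t'| ≤ h' → |rescale ψ t h s - rescale ψ t' h' s| ≤ (4 * ε) ^ (γ : ℝ) := by
    intro t t' h h' h1 h1' ht hh hs
    have hp : 0 < h := by linarith
    have hp' : 0 < h' := by linarith
    refine (hγ.abs_sub_le _ _).trans (Real.rpow_le_rpow (abs_nonneg _) ?_ γ.2)
    have e : (s - t) / h - (s - t') / h' = (t' - t) / h + (s - t') / h' * ((h' - h) / h) := by
      field_simp; ring
    have a1 : |(t' - t) / h| ≤ 2 * ε := by
      rw [abs_div, abs_of_pos hp, div_le_iff₀ hp, abs_sub_comm]; nlinarith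
    have a2 : |(h' - h) / h| ≤ 2 * ε := by
      rw [abs_div, abs_of_pos hp, div_le_iff₀ hp, abs_sub_comm]; nlinarith
    have a3 : |(s - t') / h'| ≤ 1 := by
      rw [abs_div, abs_of_pos hp']; exact div_le_one_of_le₀ hs hp'.le
    rw [e]
    refine (abs_add_le _ _).trans ?_
    rw [abs_mul]
    nlinarith [abs_nonneg ((h' - h) / h), abs_nonneg ((s - t') / h')]
  rcases le_or_gt |s - t'| h' with c | c
  · exact key t t' h h' h1 h1' ht hh c
  rcases le_or_gt |s - t| h with d | d
  · rw [abs_sub_comm]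
    exact key t' t h' h h1' h1 (by rwa [abs_sub_comm]) (by rwa [abs_sub_comm]) d
  · rw [hψ.rescale_eq_zero (by linarith) c, hψ.rescale_eq_zero (by linarith) d]
    simp; positivity

lemma IsKernel.weight_sub (hψ : IsKernel ψ) (n : ℕ) (t h t' h' : ℝ) (k : Fin n) :
    weight ψ n t h k - weight ψ n t' h' k =
      √n * cellInt n (fun s => rescale ψ t h s - rescale ψ t' h' s) k := by
  rw [weight_eq, weight_eq, ← mul_sub, cellInt, cellInt, cellInt, intervalIntegral.integral_sub]
  all_goals exact (hψ.continuous_rescale _ _).intervalIntegrable _ _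

lemma IsKernel.abs_weight_sub_le {γ : ℝ≥0} (hψ : IsKernel ψ) (hγ : HolderWith 1 γ ψ)
    {t t' h h' H ε : ℝ} (hH : 0 < H) (h1 : H / 2 ≤ h) (h1' : H / 2 ≤ h')
    (ht : |t - t'| ≤ ε * H) (hh : |h - h'| ≤ ε * H) {n : ℕ} (k : Fin n) :
    |weight ψ n t h k - weight ψ n t' h' k| ≤ (4 * ε) ^ (γ : ℝ) / √n := by
  rw [hψ.weight_sub, abs_mul, abs_of_nonneg (Real.sqrt_nonneg _), ← sqrt_mul_div_self]
  gcongr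
  exact abs_cellInt_le k fun s _ => hψ.abs_rescale_sub_le hγ hH h1 h1' ht hh s

/-- The difference of the two rescaled kernels vanishes outside an interval of length 4H around t,
so the uniform Hölder bound turns into an L² bound with the factor √H. -/
lemma IsKernel.sum_sq_weight_sub_le {γ : ℝ≥0} (hψ : IsKernel ψ) (hγ : HolderWith 1 γ ψ)
    {t t' h h' H ε : ℝ} (hH : 0 < H) (h1 : H / 2 ≤ h) (h1' : H / 2 ≤ h') (h2 : h ≤ H) (h2' : h' ≤ H)
    (hε : ε ≤ 1) (ht : |t - t'| ≤ ε * H) (hh : |h - h'| ≤ ε * H) {n : ℕ} (hn : 1 ≤ n) :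
    ∑ k : Fin n, (weight ψ n t h k - weight ψ n t' h' k) ^ 2 ≤ ((4 * ε) ^ (γ : ℝ)) ^ 2 * (4 * H) := by
  simp only [hψ.weight_sub]
  refine (sum_sq_cellInt_le hn
    ((hψ.continuous_rescale t h).sub (hψ.continuous_rescale t' h'))).trans ?_
  have := integral_sq_le_of_support
    ((hψ.continuous_rescale t h).sub (hψ.continuous_rescale t' h')) (c := t - 2 * H) (d := t + 2 * H)
    (by linarith) (hψ.abs_rescale_sub_le hγ hH h1 h1' ht hh) (fun s hs => by
      have hs' : 2 * H < |s - t| := by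
        by_contra! h'
        exact hs ⟨by linarith [(abs_le.1 h').1], by linarith [(abs_le.1 h').2]⟩
      have : |s - t| ≤ |s - t'| + |t - t'| := by
        rw [abs_sub_comm t t']; exact abs_sub_le _ _ _
      rw [Pi.sub_apply, hψ.rescale_eq_zero (by linarith) (by linarith),
        hψ.rescale_eq_zero (by linarith) (by nlinarith), sub_zero])
  refine this.trans (le_of_eq (by ring))

end

end VolTest

namespace VolTest

noncomputable section

/-! ### Chaining over dyadic grids of locations and bandwidths -/

variable {ψ : ℝ → ℝ}

/-- The unnormalized local statistic for standard Gaussian noise. -/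
def kernelChi (ψ : ℝ → ℝ) (n : ℕ) (p : ℝ × ℝ) (ξ : Fin n → ℝ) : ℝ :=
  chiSum (weight ψ n p.1 p.2) ξ

/-- A point of the grid of mesh `2^{-(i+m)}`. -/
def gridPt (i m j l : ℕ) : ℝ × ℝ := (j / 2 ^ (i + m), l / 2 ^ (i + m))

/-- The grid point next to `p`, with the location rounded down and the bandwidth rounded up. -/
def gridRound (i m : ℕ) (p : ℝ × ℝ) : ℝ × ℝ :=
  gridPt i m ⌊p.1 * 2 ^ (i + m)⌋₊ ⌈p.2 * 2 ^ (i + m)⌉₊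

lemma chiSum_sub {n : ℕ} (a b ξ : Fin n → ℝ) :
    chiSum a ξ - chiSum b ξ = chiSum (fun k => a k - b k) ξ := by
  simp only [chiSum, ← Finset.sum_sub_distrib, sub_mul]

lemma natCeil_two_mul_add_one_div_two (x : ℝ) : (⌈2 * x⌉₊ + 1) / 2 = ⌈x⌉₊ := by
  have h1 : ⌈2 * x⌉₊ ≤ 2 * ⌈x⌉₊ := Nat.ceil_le.2 (by push_cast; linarith [Nat.le_ceil x])
  rcases Nat.eq_zero_or_pos ⌈x⌉₊ with h | h
  · omega
  have h2 : 2 * (⌈x⌉₊ - 1) < ⌈2 * x⌉₊ := by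
    by_contra! h2
    have h3 : x ≤ (⌈x⌉₊ - 1 : ℕ) := by
      have : (⌈2 * x⌉₊ : ℝ) ≤ (2 * (⌈x⌉₊ - 1) : ℕ) := by exact_mod_cast h2
      push_cast at this
      linarith [Nat.le_ceil (2 * x)]
    have := Nat.ceil_le.2 h3
    omega
  omega

/-- The rounding at level m is a function of the grid indices at level m + 1. Hence a chaining step
involves one increment for each point of the finer grid, and not all pairs of points. -/
lemma gridRound_parent (i m : ℕ) (p : ℝ × ℝ) :
    gridRound i m p = gridPt i m (⌊p.1 * 2 ^ (i + (m + 1))⌋₊ / 2)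
      ((⌈p.2 * 2 ^ (i + (m + 1))⌉₊ + 1) / 2) := by
  have e1 : p.1 * 2 ^ (i + m) = p.1 * 2 ^ (i + (m + 1)) / (2 : ℕ) := by
    push_cast; rw [← add_assoc, pow_succ]; ring
  have e2 : p.2 * 2 ^ (i + (m + 1)) = 2 * (p.2 * 2 ^ (i + m)) := by
    rw [← add_assoc, pow_succ]; ring
  rw [gridRound, e2, natCeil_two_mul_add_one_div_two, e1, Nat.floor_div_natCast]

section Rounding

variable {i : ℕ} {p : ℝ × ℝ}

lemma gridRound_fst_le (m : ℕ) (h : 0 ≤ p.1) : (gridRound i m p).1 ≤ p.1 := by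
  simp only [gridRound, gridPt]
  rw [div_le_iff₀ (by positivity)]
  exact Nat.floor_le (by positivity)

lemma le_gridRound_fst (m : ℕ) : p.1 - 1 / 2 ^ (i + m) ≤ (gridRound i m p).1 := by
  simp only [gridRound, gridPt]
  rw [le_div_iff₀ (by positivity), sub_mul, one_div_mul_cancel (by positivity)]
  linarith [Nat.lt_floor_add_one (p.1 * 2 ^ (i + m))]

lemma le_gridRound_snd (m : ℕ) : p.2 ≤ (gridRound i m p).2 := by
  simp only [gridRound, gridPt]
  rw [le_div_iff₀ (by positivity)]
  exact Nat.le_ceil _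

lemma gridRound_snd_le (m : ℕ) (h : 0 ≤ p.2) :
    (gridRound i m p).2 ≤ p.2 + 1 / 2 ^ (i + m) := by
  simp only [gridRound, gridPt]
  rw [div_le_iff₀ (by positivity), add_mul, one_div_mul_cancel (by positivity)]
  exact (Nat.ceil_lt_add_one (by positivity)).le

lemma natCeil_le_of_le (m : ℕ) (h : p.2 ≤ 1 / 2 ^ i) : ⌈p.2 * 2 ^ (i + m)⌉₊ ≤ 2 ^ m := by
  rw [Nat.ceil_le]
  push_cast
  calc p.2 * 2 ^ (i + m) ≤ 1 / 2 ^ i * 2 ^ (i + m) := by gcongr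
    _ = 2 ^ m := by rw [pow_add]; field_simp

lemma gridRound_snd_le_of_le (m : ℕ) (h : p.2 ≤ 1 / 2 ^ i) : (gridRound i m p).2 ≤ 1 / 2 ^ i := by
  have : (⌈p.2 * 2 ^ (i + m)⌉₊ : ℝ) ≤ 2 ^ m := by exact_mod_cast natCeil_le_of_le m h
  simp only [gridRound, gridPt]
  generalize ⌈p.2 * 2 ^ (i + m)⌉₊ = N at this ⊢
  rw [div_le_div_iff₀ (by positivity) (by positivity), pow_add]
  nlinarith [pow_pos (two_pos (α := ℝ)) i]

lemma le_natCeil_of_lt (m : ℕ) (h : 1 / 2 ^ (i + 1) < p.2) :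
    2 ^ m ≤ ⌈p.2 * 2 ^ (i + (m + 1))⌉₊ := by
  refine (Nat.lt_ceil.2 ?_).le
  push_cast
  calc (2 : ℝ) ^ m = 1 / 2 ^ (i + 1) * 2 ^ (i + (m + 1)) := by
        rw [show i + (m + 1) = i + 1 + m by ring, pow_add _ (i + 1)]; field_simp
    _ < _ := by gcongr

lemma natFloor_le (m : ℕ) (h : p.1 ≤ 1) : ⌊p.1 * 2 ^ (i + m)⌋₊ ≤ 2 ^ (i + m) := by
  refine Nat.floor_le_of_le ?_
  push_cast
  nlinarith [pow_pos (two_pos (α := ℝ)) (i + m)]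

end Rounding

lemma rpow_four_mul_le (γ : ℝ≥0) (hγ : γ ≤ 1) (m : ℕ) :
    (4 * (1 / 2 ^ m : ℝ)) ^ (γ : ℝ) ≤ 4 * ((1 / 2 : ℝ) ^ (γ : ℝ)) ^ m := by
  rw [Real.mul_rpow (by norm_num) (by positivity), ← Real.rpow_natCast ((1 / 2 : ℝ) ^ (γ : ℝ)) m,
    ← Real.rpow_mul (by norm_num), mul_comm (γ : ℝ), Real.rpow_mul (by norm_num),
    Real.rpow_natCast, one_div_pow]
  gcongr
  calc (4 : ℝ) ^ (γ : ℝ) ≤ 4 ^ (1 : ℝ) :=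
        Real.rpow_le_rpow_of_exponent_le (by norm_num) (by exact_mod_cast hγ)
    _ = 4 := Real.rpow_one _

/-- The increments of the weights between two points at relative distance `2^{-m}`. -/
lemma IsKernel.sum_sq_weight_sub_grid_le {γ : ℝ≥0} (hψ : IsKernel ψ) (hγ1 : γ ≤ 1)
    (hγ : HolderWith 1 γ ψ) {n : ℕ} (hn : 1 ≤ n) {i m : ℕ} {p p' : ℝ × ℝ}
    (h1 : 1 / 2 ^ (i + 1) ≤ p.2) (h1' : 1 / 2 ^ (i + 1) ≤ p'.2) (h2 : p.2 ≤ 1 / 2 ^ i)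
    (h2' : p'.2 ≤ 1 / 2 ^ i)
    (ht : |p.1 - p'.1| ≤ 1 / 2 ^ (i + m)) (hh : |p.2 - p'.2| ≤ 1 / 2 ^ (i + m)) :
    (∑ k : Fin n, (weight ψ n p.1 p.2 k - weight ψ n p'.1 p'.2 k) ^ 2 ≤
      (8 * ((1 / 2 : ℝ) ^ (γ : ℝ)) ^ m * √(1 / 2 ^ i)) ^ 2) ∧
    ∀ k : Fin n, |weight ψ n p.1 p.2 k - weight ψ n p'.1 p'.2 k| ≤
      4 * ((1 / 2 : ℝ) ^ (γ : ℝ)) ^ m / √n := by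
  have e : (1 : ℝ) / 2 ^ (i + m) = 1 / 2 ^ m * (1 / 2 ^ i) := by rw [pow_add]; field_simp
  have e' : (1 : ℝ) / 2 ^ (i + 1) = 1 / 2 ^ i / 2 := by rw [pow_add]; field_simp
  rw [e] at ht hh
  rw [e'] at h1 h1'
  have hH : (0 : ℝ) < 1 / 2 ^ i := by positivity
  have hb := rpow_four_mul_le γ hγ1 m
  have hm1 : (1 : ℝ) / 2 ^ m ≤ 1 := by
    rw [div_le_one (by positivity)]; exact one_le_pow₀ (by norm_num)
  constructor
  · refine (hψ.sum_sq_weight_sub_le hγ hH h1 h1' h2 h2' hm1 ht hh hn).trans ?_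
    rw [mul_pow, Real.sq_sqrt hH.le]
    calc ((4 * (1 / 2 ^ m : ℝ)) ^ (γ : ℝ)) ^ 2 * (4 * (1 / 2 ^ i))
        ≤ (4 * ((1 / 2 : ℝ) ^ (γ : ℝ)) ^ m) ^ 2 * (4 * (1 / 2 ^ i)) := by gcongr
      _ = _ := by ring
  · intro k
    refine (hψ.abs_weight_sub_le hγ hH h1 h1' ht hh k).trans ?_
    gcongr

/-! ### Exceptional events and the union bound. -/

/-- The event that an increment of the process along the grids is exceptionally large. -/
def badIncrement (ψ : ℝ → ℝ) (n : ℕ) (q A r : ℝ) (i m j l : ℕ) : Set (Fin n → ℝ) :=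
  {ξ | q ^ m * √(1 / 2 ^ i) * A * (i + 2 * m + r) <
    |kernelChi ψ n (gridPt i (m + 1) j l) ξ - kernelChi ψ n (gridPt i m (j / 2) ((l + 1) / 2)) ξ|}

/-- The chi-square tail bound at x = i + 2m + r, with v = 8q^m√H, b = 4q^m/√n and H = 2^{-i}. Here
√x ≤ x because x ≥ 1, and 1/√n ≤ √(H/K) because K/n ≤ H, so both terms of the threshold fit into q^m
√H A x. -/
lemma IsKernel.badIncrement_le {γ : ℝ≥0} (hψ : IsKernel ψ) (hγ1 : γ ≤ 1)
    (hγ : HolderWith 1 γ ψ) {K r : ℝ} (hK : 0 < K) (hr : 0 ≤ r) {n : ℕ} (hn : 1 ≤ n)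
    {i m j l : ℕ} (hi : 1 ≤ i) (hKi : K / n ≤ 1 / 2 ^ i) (hl1 : 2 ^ m ≤ l) (hl2 : l ≤ 2 ^ (m + 1)) :
    (stdGauss n).real (badIncrement ψ n ((1 / 2 : ℝ) ^ (γ : ℝ)) (16 + 8 / √K) r i m j l) ≤
      2 * Real.exp (-(i + 2 * m + r)) := by
  set q := (1 / 2 : ℝ) ^ (γ : ℝ) with hq
  have hq0 : 0 < q := by positivity
  have hn0 : (0 : ℝ) < n := by positivity
  have hl1' : (2 : ℝ) ^ m ≤ l := by exact_mod_cast hl1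
  have hl2' : (l : ℝ) ≤ 2 ^ (m + 1) := by exact_mod_cast hl2
  have hp1 : (l : ℝ) ≤ 2 * ((l + 1) / 2 : ℕ) := by
    have : l ≤ 2 * ((l + 1) / 2) := by omega
    exact_mod_cast this
  have hp2 : 2 * ((l + 1) / 2 : ℕ) ≤ (l : ℝ) + 1 := by
    have : 2 * ((l + 1) / 2) ≤ l + 1 := by omega
    exact_mod_cast this
  have hp3 : ((l + 1) / 2 : ℕ) ≤ (2 : ℝ) ^ m := by
    have : (l + 1) / 2 ≤ 2 ^ m := by rw [pow_succ] at hl2; omega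
    exact_mod_cast this
  have hj1 : 2 * (j / 2 : ℕ) ≤ (j : ℝ) := by
    have : 2 * (j / 2) ≤ j := by omega
    exact_mod_cast this
  have hj2 : (j : ℝ) ≤ 2 * (j / 2 : ℕ) + 1 := by
    have : j ≤ 2 * (j / 2) + 1 := by omega
    exact_mod_cast this
  have e0 : (2 : ℝ) ^ (i + (m + 1)) = 2 ^ i * 2 ^ m * 2 := by rw [pow_add, pow_succ]; ring
  have e1 : (2 : ℝ) ^ (i + m) = 2 ^ i * 2 ^ m := pow_add _ _ _
  have e2 : (2 : ℝ) ^ (i + 1) = 2 ^ i * 2 := pow_succ _ _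
  have pi : (0 : ℝ) < 2 ^ i := by positivity
  have pm : (0 : ℝ) < 2 ^ m := by positivity
  have d1 : ∀ x y : ℝ, x / (2 ^ i * 2 ^ m * 2) - y / (2 ^ i * 2 ^ m) =
      (x - 2 * y) / (2 ^ i * 2 ^ m * 2) := fun x y => by field_simp
  rw [pow_succ] at hl2'
  obtain ⟨hv, hb⟩ := hψ.sum_sq_weight_sub_grid_le hγ1 hγ hn (i := i) (m := m)
    (p := gridPt i (m + 1) j l) (p' := gridPt i m (j / 2) ((l + 1) / 2))
    (by simp only [gridPt, e0, e2]
        rw [div_le_div_iff₀ (by positivity) (by positivity)]; nlinarith)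
    (by simp only [gridPt, e1, e2]
        rw [div_le_div_iff₀ (by positivity) (by positivity)]; nlinarith)
    (by simp only [gridPt, e0]
        rw [div_le_div_iff₀ (by positivity) (by positivity)]; nlinarith)
    (by simp only [gridPt, e1]
        rw [div_le_div_iff₀ (by positivity) (by positivity)]; nlinarith)
    (by simp only [gridPt, e0, e1]
        rw [d1, abs_div, abs_of_pos (by positivity : (0 : ℝ) < 2 ^ i * 2 ^ m * 2),
          div_le_div_iff₀ (by positivity) (by positivity)]
        have : |(j : ℝ) - 2 * (j / 2 : ℕ)| ≤ 1 := by rw [abs_le]; constructor <;> linarith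
        nlinarith [mul_pos pi pm])
    (by simp only [gridPt, e0, e1]
        rw [d1, abs_div, abs_of_pos (by positivity : (0 : ℝ) < 2 ^ i * 2 ^ m * 2),
          div_le_div_iff₀ (by positivity) (by positivity)]
        have : |(l : ℝ) - 2 * ((l + 1) / 2 : ℕ)| ≤ 1 := by rw [abs_le]; constructor <;> linarith
        nlinarith [mul_pos pi pm])
  set x : ℝ := i + 2 * m + r with hx
  have hx1 : 1 ≤ x := by
    have : (1 : ℝ) ≤ i := by exact_mod_cast hi
    have : (0 : ℝ) ≤ m := by positivity
    rw [hx]; linarith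
  have ht := chiSum_tail _ (by positivity) (by positivity) (zero_le_one.trans hx1) hv hb
  refine le_trans (measureReal_mono (ofPred_subset_ofPred.2 fun ξ h => ?_)) ht
  rw [← chiSum_sub]
  refine lt_of_le_of_lt ?_ h
  have hsx : √x ≤ x := by
    rw [Real.sqrt_le_left (by linarith)]; nlinarith
  have hsn : 1 / √n ≤ √(1 / 2 ^ i) / √K := by
    rw [div_le_div_iff₀ (by positivity) (by positivity), one_mul, ← Real.sqrt_mul (by positivity)]
    refine Real.sqrt_le_sqrt ?_
    rwa [div_le_iff₀ hn0] at hKi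
  calc 2 * (8 * q ^ m * √(1 / 2 ^ i)) * √x + 2 * (4 * q ^ m / √n) * x
      = 16 * q ^ m * √(1 / 2 ^ i) * √x + 8 * q ^ m * (1 / √n) * x := by ring
    _ ≤ 16 * q ^ m * √(1 / 2 ^ i) * x + 8 * q ^ m * (√(1 / 2 ^ i) / √K) * x := by gcongr
    _ = q ^ m * √(1 / 2 ^ i) * (16 + 8 / √K) * x := by ring

/-- The exponent used at the starting level of the chain. -/
def startExp (r : ℝ) (i : ℕ) : ℝ :=
  (i - 1) * Real.log 2 + (Nat.sqrt i * Real.log 4 + 2 * Real.log (i + 1)) + r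

/-- The event that the process is exceptionally large at a starting point of a chain. -/
def badStart (ψ : ℝ → ℝ) (n : ℕ) (r : ℝ) (i j l : ℕ) : Set (Fin n → ℝ) :=
  {ξ | 2 * Lam ψ n (gridPt i (Nat.sqrt i) j l).1 (gridPt i (Nat.sqrt i) j l).2 * √(startExp r i) +
    2 * (1 / √n) * startExp r i < |kernelChi ψ n (gridPt i (Nat.sqrt i) j l) ξ|}

lemma startExp_nonneg {r : ℝ} (hr : 1 ≤ r) (i : ℕ) : 0 ≤ startExp r i := by
  have h1 : Real.log 2 ≤ 1 := by linarith [Real.log_two_lt_d9]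
  have h2 : 0 ≤ Real.log 2 := Real.log_nonneg (by norm_num)
  have h3 : 0 ≤ Real.log 4 := Real.log_nonneg (by norm_num)
  have h4 : 0 ≤ Real.log ((i : ℝ) + 1) := Real.log_nonneg (by simp)
  have h5 : 0 ≤ (Nat.sqrt i : ℝ) * Real.log 4 := by positivity
  have h6 : 0 ≤ (i : ℝ) * Real.log 2 := by positivity
  rw [startExp]; linarith

/-- There are of the order of 2^i 4^{√i} starting points at level i. The first factors cancel this
count, and (i+1)^{-2} makes the sum over i converge. -/
lemma exp_neg_startExp (r : ℝ) (i : ℕ) :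
    Real.exp (-startExp r i) =
      2 * (1 / 2 ^ i) * (1 / 4 ^ Nat.sqrt i) * (1 / ((i : ℝ) + 1) ^ 2) * Real.exp (-r) := by
  have e : -startExp r i = Real.log 2 + -(i * Real.log 2) + -(Nat.sqrt i * Real.log 4) +
      -((2 : ℕ) * Real.log (i + 1)) + -r := by rw [startExp]; push_cast; ring
  rw [e, Real.exp_add, Real.exp_add, Real.exp_add, Real.exp_add, ← Real.log_pow, ← Real.log_pow,
    ← Real.log_pow, Real.exp_neg (Real.log _), Real.exp_neg (Real.log _), Real.exp_neg (Real.log _),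
    Real.exp_log (by norm_num), Real.exp_log (by positivity), Real.exp_log (by positivity),
    Real.exp_log (by positivity)]
  simp only [one_div]

lemma IsKernel.badStart_le (hψ : IsKernel ψ) {n : ℕ} {r : ℝ} (hr : 1 ≤ r) (i j l : ℕ) :
    (stdGauss n).real (badStart ψ n r i j l) ≤ 2 * Real.exp (-startExp r i) :=
  chiSum_tail _ (Lam_nonneg _ _ _ _) (by positivity) (startExp_nonneg hr i)
    (Lam_sq _ _ _ _).ge fun k => by
      rw [abs_of_nonneg (hψ.weight_nonneg _ _ _ _)]; exact hψ.weight_le _ _ _ _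

/-- The union of all exceptional events. -/
def badSet (ψ : ℝ → ℝ) (K : ℝ) (n : ℕ) (q A r : ℝ) : Set (Fin n → ℝ) :=
  (⋃ i : ℕ, ⋃ m : ℕ, ⋃ j ∈ Finset.range (2 ^ (i + (m + 1)) + 1), ⋃ l ∈ Finset.range (2 ^ (m + 1) + 1),
    {ξ | 1 ≤ i ∧ K / n ≤ 1 / 2 ^ i ∧ 2 ^ m ≤ l ∧ ξ ∈ badIncrement ψ n q A r i m j l}) ∪
  ⋃ i : ℕ, ⋃ j ∈ Finset.range (2 ^ (i + Nat.sqrt i) + 1), ⋃ l ∈ Finset.range (2 ^ Nat.sqrt i + 1),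
    badStart ψ n r i j l

lemma tsum_ofReal_mul_le {a : ℕ → ℝ} (ha : ∀ i, 0 ≤ a i) (hs : Summable a) {c : ℝ} (hc : 0 ≤ c) :
    ∑' i, ENNReal.ofReal (c * a i) = ENNReal.ofReal (c * ∑' i, a i) := by
  rw [← tsum_mul_left, ENNReal.ofReal_tsum_of_nonneg (fun i => mul_nonneg hc (ha i))
    (hs.mul_left c)]

lemma measure_biUnion_range_le {Ω : Type*} [MeasurableSpace Ω] (μ : Measure Ω) (N M : ℕ)
    (s : ℕ → ℕ → Set Ω) {b : ℝ}
    (h : ∀ j ∈ Finset.range N, ∀ l ∈ Finset.range M, μ (s j l) ≤ ENNReal.ofReal b) :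
    μ (⋃ j ∈ Finset.range N, ⋃ l ∈ Finset.range M, s j l) ≤ ENNReal.ofReal (N * M * b) := by
  calc _ ≤ ∑ j ∈ Finset.range N, ∑ l ∈ Finset.range M, ENNReal.ofReal b :=
        (measure_biUnion_finset_le _ _).trans (Finset.sum_le_sum fun j hj =>
          (measure_biUnion_finset_le _ _).trans (Finset.sum_le_sum fun l hl => h j hj l hl))
    _ = _ := by
        simp only [Finset.sum_const, Finset.card_range, nsmul_eq_mul]
        rw [ENNReal.ofReal_mul (by positivity), ENNReal.ofReal_mul (by positivity),
          ENNReal.ofReal_natCast, ENNReal.ofReal_natCast, mul_assoc]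

/-- At levels (i,m) there are at most 16·2^i·4^m increments, each exceptional with probability at
most 2e^{-i-2m-r}. The double series is geometric with ratios 2/e and 4/e², both below one. -/
lemma exists_badSet_le {γ : ℝ≥0} (hψ : IsKernel ψ) (hγ1 : γ ≤ 1)
    (hγ : HolderWith 1 γ ψ) {K : ℝ} (hK : 0 < K) :
    ∃ C : ℝ, 0 ≤ C ∧ ∀ r : ℝ, 1 ≤ r → ∀ n : ℕ, 1 ≤ n →
      stdGauss n (badSet ψ K n ((1 / 2 : ℝ) ^ (γ : ℝ)) (16 + 8 / √K) r) ≤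
        ENNReal.ofReal (C * Real.exp (-r)) := by
  set ρ := 2 * Real.exp (-1) with hρ
  set τ := 4 * Real.exp (-2) with hτ
  have he : Real.exp (-1) < 0.4 := by have := Real.exp_neg_one_lt_d9; linarith
  have hρ0 : 0 ≤ ρ := by positivity
  have hτ0 : 0 ≤ τ := by positivity
  have hρ1 : ρ < 1 := by linarith
  have hτ1 : τ < 1 := by
    have : Real.exp (-2) = Real.exp (-1) * Real.exp (-1) := by rw [← Real.exp_add]; norm_num
    rw [hτ, this]; nlinarith [Real.exp_pos (-1)]
  have hs1 : Summable fun i : ℕ => ρ ^ i := summable_geometric_of_lt_one hρ0 hρ1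
  have hs2 : Summable fun i : ℕ => τ ^ i := summable_geometric_of_lt_one hτ0 hτ1
  have hs3 : Summable fun i : ℕ => 1 / ((i : ℝ) + 1) ^ 2 := by
    have := (summable_nat_add_iff 1).2 (Real.summable_one_div_nat_pow.2 one_lt_two)
    simpa using this
  refine ⟨32 * (∑' i, τ ^ i) * (∑' i, ρ ^ i) + 16 * ∑' i : ℕ, 1 / ((i : ℝ) + 1) ^ 2,
    by positivity, fun r hr n hn => ?_⟩
  have er := Real.exp_pos (-r)
  refine (measure_union_le _ _).trans ?_
  rw [add_mul, ENNReal.ofReal_add (by positivity) (by positivity)]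
  refine add_le_add ?_ ?_
  · refine (measure_iUnion_le _).trans ?_
    have hi : ∀ i : ℕ, ∀ m : ℕ, stdGauss n (⋃ j ∈ Finset.range (2 ^ (i + (m + 1)) + 1),
        ⋃ l ∈ Finset.range (2 ^ (m + 1) + 1), {ξ | 1 ≤ i ∧ K / n ≤ 1 / 2 ^ i ∧ 2 ^ m ≤ l ∧
          ξ ∈ badIncrement ψ n ((1 / 2 : ℝ) ^ (γ : ℝ)) (16 + 8 / √K) r i m j l}) ≤
        ENNReal.ofReal ((32 * Real.exp (-r) * ρ ^ i) * τ ^ m) := by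
      intro i m
      refine (measure_biUnion_range_le _ _ _ _ (b := 2 * Real.exp (-(i + 2 * m + r)))
        fun j hj l hl => ?_).trans (ENNReal.ofReal_le_ofReal ?_)
      · by_cases hc : 1 ≤ i ∧ K / n ≤ 1 / 2 ^ i ∧ 2 ^ m ≤ l
        · rw [← ofReal_measureReal]
          refine ENNReal.ofReal_le_ofReal (le_trans (measureReal_mono ?_)
            (hψ.badIncrement_le hγ1 hγ hK (zero_le_one.trans hr) hn (j := j) hc.1 hc.2.1 hc.2.2
              (Nat.lt_succ_iff.1 (Finset.mem_range.1 hl))))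
          exact ofPred_subset.2 fun ξ h => h.2.2.2
        · convert (zero_le : (0 : ℝ≥0∞) ≤ _)
          convert measure_empty (μ := stdGauss n)
          ext ξ
          simp only [mem_ofPred_eq, mem_empty_iff_false, iff_false]
          tauto
      · have e1 : Real.exp (-(i + 2 * m + r)) = Real.exp (-r) * Real.exp (-1) ^ i * Real.exp (-2) ^ m := by
          rw [← Real.exp_nat_mul, ← Real.exp_nat_mul, ← Real.exp_add, ← Real.exp_add]
          congr 1; ring
        have e2 : ((2 ^ (i + (m + 1)) + 1 : ℕ) : ℝ) ≤ 4 * (2 ^ i * 2 ^ m) := by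
          push_cast
          rw [pow_add, pow_succ]
          nlinarith [one_le_pow₀ (n := i) (one_le_two (α := ℝ)), one_le_pow₀ (n := m) (one_le_two (α := ℝ))]
        have e3 : ((2 ^ (m + 1) + 1 : ℕ) : ℝ) ≤ 4 * 2 ^ m := by
          push_cast
          rw [pow_succ]
          nlinarith [one_le_pow₀ (n := m) (one_le_two (α := ℝ))]
        have e4 : (4 : ℝ) ^ m = 2 ^ m * 2 ^ m := by rw [← mul_pow]; norm_num
        calc _ ≤ 4 * (2 ^ i * 2 ^ m) * (4 * 2 ^ m) * (2 * Real.exp (-(i + 2 * m + r))) := by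
              gcongr
          _ = _ := by rw [e1, hρ, hτ, mul_pow, mul_pow, e4]; ring
    calc _ ≤ ∑' i : ℕ, ∑' m : ℕ, ENNReal.ofReal ((32 * Real.exp (-r) * ρ ^ i) * τ ^ m) :=
          ENNReal.tsum_le_tsum fun i => (measure_iUnion_le _).trans (ENNReal.tsum_le_tsum (hi i))
      _ = ∑' i : ℕ, ENNReal.ofReal ((32 * Real.exp (-r) * ∑' m, τ ^ m) * ρ ^ i) := by
          refine tsum_congr fun i => ?_
          rw [tsum_ofReal_mul_le (fun m => by positivity) hs2 (by positivity)]
          congr 1; ring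
      _ = ENNReal.ofReal (32 * (∑' i, τ ^ i) * (∑' i, ρ ^ i) * Real.exp (-r)) := by
          rw [tsum_ofReal_mul_le (fun m => by positivity) hs1 (by positivity)]
          congr 1; ring
      _ ≤ _ := le_rfl
  · refine (measure_iUnion_le _).trans ?_
    calc _ ≤ ∑' i : ℕ, ENNReal.ofReal ((16 * Real.exp (-r)) * (1 / ((i : ℝ) + 1) ^ 2)) := by
          refine ENNReal.tsum_le_tsum fun i => ?_
          refine (measure_biUnion_range_le _ _ _ _ (b := 2 * Real.exp (-startExp r i))
            fun j hj l hl => ?_).trans (ENNReal.ofReal_le_ofReal ?_)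
          · rw [← ofReal_measureReal]
            exact ENNReal.ofReal_le_ofReal (hψ.badStart_le hr i j l)
          · have e2 : ((2 ^ (i + Nat.sqrt i) + 1 : ℕ) : ℝ) ≤ 2 * (2 ^ i * 2 ^ Nat.sqrt i) := by
              push_cast
              rw [pow_add]
              nlinarith [one_le_pow₀ (n := i) (one_le_two (α := ℝ)),
                one_le_pow₀ (n := Nat.sqrt i) (one_le_two (α := ℝ))]
            have e3 : ((2 ^ Nat.sqrt i + 1 : ℕ) : ℝ) ≤ 2 * 2 ^ Nat.sqrt i := by
              push_cast
              nlinarith [one_le_pow₀ (n := Nat.sqrt i) (one_le_two (α := ℝ))]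
            have e4 : (4 : ℝ) ^ Nat.sqrt i = 2 ^ Nat.sqrt i * 2 ^ Nat.sqrt i := by
              rw [← mul_pow]; norm_num
            calc _ ≤ 2 * (2 ^ i * 2 ^ Nat.sqrt i) * (2 * 2 ^ Nat.sqrt i) *
                  (2 * Real.exp (-startExp r i)) := by gcongr
              _ = _ := by rw [exp_neg_startExp, e4]; field_simp; norm_num
      _ = _ := by
          rw [tsum_ofReal_mul_le (fun m => by positivity) hs3 (by positivity)]
          congr 1; ring

end

end VolTest

namespace VolTest

noncomputable section

/-! ### The multiscale bound under the null hypothesis -/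

variable {ψ : ℝ → ℝ}

lemma sqrt_sum_sq_le {n : ℕ} (a b : Fin n → ℝ) :
    √(∑ k, a k ^ 2) ≤ √(∑ k, b k ^ 2) + √(∑ k, (b k - a k) ^ 2) := by
  have key : ∀ c : Fin n → ℝ, √(∑ k, c k ^ 2) = ‖WithLp.toLp 2 c‖ := fun c => by
    rw [EuclideanSpace.norm_eq]; simp
  have : (fun k => b k - a k) = b - a := rfl
  rw [key, key, key (fun k => b k - a k), this, WithLp.toLp_sub]
  exact norm_le_norm_add_norm_sub (WithLp.toLp 2 b) (WithLp.toLp 2 a)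

lemma sqrt_sq_le_and (i : ℕ) : (Nat.sqrt i : ℝ) ^ 2 ≤ i ∧ (i : ℝ) + 1 ≤ ((Nat.sqrt i : ℝ) + 1) ^ 2 := by
  refine ⟨by exact_mod_cast Nat.sqrt_le' i, ?_⟩
  exact_mod_cast Nat.lt_succ_sqrt' i

lemma log_two_bounds : 0.69 < Real.log 2 ∧ Real.log 2 < 0.7 :=
  ⟨by linarith [Real.log_two_gt_d9], by linarith [Real.log_two_lt_d9]⟩

lemma startExp_excess_le (i : ℕ) :
    0 ≤ Nat.sqrt i * Real.log 4 + 2 * Real.log (i + 1) ∧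
      Nat.sqrt i * Real.log 4 + 2 * Real.log ((i : ℝ) + 1) ≤ 6 * Nat.sqrt i := by
  obtain ⟨-, h2⟩ := sqrt_sq_le_and i
  have h4 : Real.log 4 = 2 * Real.log 2 := by
    rw [show (4 : ℝ) = 2 ^ 2 by norm_num, Real.log_pow]; norm_num
  have hl := log_two_bounds
  have h5 : Real.log ((i : ℝ) + 1) ≤ 2 * Nat.sqrt i := by
    calc Real.log ((i : ℝ) + 1) ≤ Real.log (((Nat.sqrt i : ℝ) + 1) ^ 2) :=
          Real.log_le_log (by positivity) h2
      _ = 2 * Real.log ((Nat.sqrt i : ℝ) + 1) := by rw [Real.log_pow]; norm_num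
      _ ≤ 2 * Nat.sqrt i := by
          have := Real.log_le_sub_one_of_pos (x := (Nat.sqrt i : ℝ) + 1) (by positivity)
          linarith
  have h6 : 0 ≤ Real.log ((i : ℝ) + 1) := Real.log_nonneg (by simp)
  have h7 : (0 : ℝ) ≤ Nat.sqrt i := by positivity
  rw [h4]
  constructor
  · have : 0 ≤ (Nat.sqrt i : ℝ) * (2 * Real.log 2) := by positivity
    linarith
  · nlinarith

/-- The exponent exceeds η = (i-1) log 2 by at most 6√i + r, while √η itself grows like √i. Hence
(√η + 6)² already absorbs the excess 6√i, which costs only a constant under the root. -/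
lemma sqrt_startExp_le {i : ℕ} (hi : 1 ≤ i) {r : ℝ} (hr : 0 ≤ r) :
    √(startExp r i) ≤ √((i - 1) * Real.log 2) + 6 + √r := by
  obtain ⟨h0, h6⟩ := startExp_excess_le i
  obtain ⟨h1, -⟩ := sqrt_sq_le_and i
  have hl := log_two_bounds
  have hi' : (1 : ℝ) ≤ i := by exact_mod_cast hi
  set η := ((i : ℝ) - 1) * Real.log 2 with hη
  have hη0 : 0 ≤ η := by have : (0 : ℝ) ≤ i - 1 := by linarith
                         have := hl.1; positivity
  set m : ℝ := (Nat.sqrt i : ℝ) with hm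
  have hm1 : 1 ≤ m := by
    rw [hm]; exact_mod_cast Nat.sqrt_pos.2 hi
  have hs : 0.8 * (m - 1) ≤ √η := by
    refine Real.le_sqrt_of_sq_le ?_
    nlinarith
  have hηs := Real.sq_sqrt hη0
  have hrs := Real.sq_sqrt hr
  have p1 := Real.sqrt_nonneg η
  have p2 := Real.sqrt_nonneg r
  rw [Real.sqrt_le_left (by positivity), startExp]
  nlinarith [mul_nonneg p1 p2]

/-- In the linear term of the tail bound the factor is √2, whereas the correction offers 2. The
slack, a positive multiple of i, absorbs the excess of order √i up to a constant. -/
lemma sqrt_two_mul_startExp_le {i : ℕ} (hi : 1 ≤ i) {r : ℝ} (hr : 0 ≤ r) :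
    √2 * startExp r i ≤ 2 * ((i - 1) * Real.log 2) + 50 + 2 * r := by
  obtain ⟨h0, h6⟩ := startExp_excess_le i
  obtain ⟨h1, -⟩ := sqrt_sq_le_and i
  have hl := log_two_bounds
  have hi' : (1 : ℝ) ≤ i := by exact_mod_cast hi
  have hs2 : √2 ≤ 1.415 := by
    rw [Real.sqrt_le_left (by norm_num)]; norm_num
  have hs0 : 0 ≤ √2 := by positivity
  set m : ℝ := (Nat.sqrt i : ℝ) with hm
  have hη : 0.69 * (i - 1) ≤ ((i : ℝ) - 1) * Real.log 2 := by nlinarith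
  set η := ((i : ℝ) - 1) * Real.log 2
  have hx : startExp r i ≤ η + 6 * m + r := by rw [startExp]; linarith
  have hx0 : 0 ≤ η + 6 * m + r := by
    have : 0 ≤ m := by positivity
    nlinarith
  calc √2 * startExp r i ≤ 1.415 * (η + 6 * m + r) := by
        refine (mul_le_mul_of_nonneg_left hx hs0).trans ?_
        gcongr
    _ ≤ _ := by nlinarith [sq_nonneg (m - 10)]

lemma one_add_startExp_le {i : ℕ} {r : ℝ} (hr : 0 ≤ r) :
    1 + startExp r i ≤ ((Nat.sqrt i : ℝ) + 10) ^ 2 * (1 + r) := by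
  obtain ⟨h0, h6⟩ := startExp_excess_le i
  obtain ⟨-, h2⟩ := sqrt_sq_le_and i
  have hl := log_two_bounds
  have hi : (0 : ℝ) ≤ i := by positivity
  have hm : (0 : ℝ) ≤ Nat.sqrt i := by positivity
  have : 1 + startExp r i ≤ ((Nat.sqrt i : ℝ) + 10) ^ 2 + r := by
    rw [startExp]; nlinarith
  nlinarith [sq_nonneg ((Nat.sqrt i : ℝ) + 10)]

lemma Lam_pos_of_scales {K : ℝ} (hK : IsScaleConstant ψ K) {n : ℕ} (hn : 1 ≤ n) {p : ℝ × ℝ}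
    (hp : p ∈ scales n K) : 0 < Lam ψ n p.1 p.2 := by
  have h1 := hK.2 n hn p hp
  have : 0 < Lam ψ n p.1 p.2 ^ 2 := lt_of_lt_of_le (by positivity) h1
  exact pos_of_sq_pos_of_nonneg this (Lam_nonneg _ _ _ _)
where pos_of_sq_pos_of_nonneg {x : ℝ} (h : 0 < x ^ 2) (h0 : 0 ≤ x) : 0 < x :=
  lt_of_le_of_ne h0 fun e => by simp [← e] at h

lemma one_le_sqrt_mul_Lam {K : ℝ} (hK : IsScaleConstant ψ K) {n : ℕ} (hn : 1 ≤ n) {p : ℝ × ℝ}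
    (hp : p ∈ scales n K) : 1 ≤ √n * Lam ψ n p.1 p.2 := by
  have h1 := hK.2 n hn p hp
  have hn0 : (0 : ℝ) < n := by positivity
  rw [div_le_iff₀ hn0] at h1
  have h2 : (√n * Lam ψ n p.1 p.2) ^ 2 = Lam ψ n p.1 p.2 ^ 2 * n := by
    rw [mul_pow, Real.sq_sqrt hn0.le, mul_comm]
  have := mul_nonneg (Real.sqrt_nonneg n) (Lam_nonneg ψ n p.1 p.2)
  nlinarith

lemma two_log_inv_eq (x : ℝ) : 2 * Real.log (1 / x) = Real.log (1 / x ^ 2) := by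
  rw [one_div, one_div, ← inv_pow, Real.log_pow]; norm_num

/-- Since Λ² ≤ 2h ≤ 2^{1-i}, the exponent log(1/Λ²) in the correction is at least (i-1) log 2, the
leading part of the exponent at the start of the chain. -/
lemma corr_ge {K : ℝ} (hψ : IsKernel ψ) (hK : IsScaleConstant ψ K) {n : ℕ} (hn : 1 ≤ n)
    {p : ℝ × ℝ} (hp : p ∈ scales n K) {i : ℕ} (hpi : p.2 ≤ 1 / 2 ^ i) :
    √(2 * ((i - 1) * Real.log 2)) + 2 * ((i - 1) * Real.log 2) / (√n * Lam ψ n p.1 p.2) ≤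
      corr n (2 * Real.log (1 / Lam ψ n p.1 p.2)) (Lam ψ n p.1 p.2) := by
  have hu := one_le_sqrt_mul_Lam hK hn hp
  have hL := Lam_pos_of_scales hK hn hp
  have hp2 : 0 < p.2 := lt_of_lt_of_le (div_pos hK.1 (by positivity)) hp.1.1
  have h2 := hψ.Lam_sq_le hn p.1 hp2
  have hη : ((i : ℝ) - 1) * Real.log 2 ≤ 2 * Real.log (1 / Lam ψ n p.1 p.2) := by
    rw [two_log_inv_eq]
    have : ((i : ℝ) - 1) * Real.log 2 = Real.log (2 ^ i / 2) := by
      rw [Real.log_div (by positivity) (by norm_num), Real.log_pow]; ring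
    rw [this]
    refine Real.log_le_log (by positivity) ?_
    rw [le_div_iff₀ (by positivity)]
    calc 2 ^ i / 2 * Lam ψ n p.1 p.2 ^ 2 ≤ 2 ^ i / 2 * (2 * (1 / 2 ^ i)) := by
          gcongr; linarith
      _ = 1 := by field_simp
  rw [corr, max_eq_right hu]
  gcongr

lemma sqrt_le_one_add {x : ℝ} (hx : 0 ≤ x) : √x ≤ 1 + x := by
  rw [Real.sqrt_le_left (by positivity)]; nlinarith

/-- Dividing by √2 L turns 2L√x into √2·√x and 2x/N into √2 x/(NL). These match the two terms of the
correction up to constants, and all other contributions are O(1 + r). -/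
lemma normalized_chain_le {Y L N x η s S A r : ℝ} (hL : 0 < L) (hu : 1 ≤ N * L) (hr : 1 ≤ r)
    (hN : 0 < N) (hs0 : 0 ≤ s) (hS0 : 0 ≤ S) (hA0 : 0 ≤ A)
    (a1 : √x ≤ √η + 6 + √r) (a2 : √2 * x ≤ 2 * η + 50 + 2 * r)
    (main : Y ≤ 2 * L * √x + 16 * (s * L) * (S * (1 + r)) + 2 * (1 / N) * x +
      s * L * A * (1 + r) * S) :
    Y / (√2 * L) ≤ √(2 * η) + 2 * η / (N * L) + (65 + 16 * s * S + s * A * S) * (1 + r) := by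
  have hr0 : 0 ≤ r := zero_le_one.trans hr
  have a5 : √r ≤ r := by rw [Real.sqrt_le_left hr0]; nlinarith
  have hs2 : √2 * √2 = 2 := Real.mul_self_sqrt (by norm_num)
  have hs2' : √2 ≤ 1.5 := by rw [Real.sqrt_le_left (by norm_num)]; norm_num
  have hs21 : 1 ≤ √2 := by rw [Real.le_sqrt' (by norm_num)]; norm_num
  have hdiv : Y / (√2 * L) ≤ √2 * √x + 16 * s * (S * (1 + r)) +
      √2 * x / (N * L) + s * A * (1 + r) * S := by
    rw [div_le_iff₀ (by positivity)]
    refine main.trans ?_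
    have c1 : (√2 * √x + 16 * s * (S * (1 + r)) + √2 * x / (N * L) + s * A * (1 + r) * S) *
        (√2 * L) = (√2 * √2) * L * √x + √2 * (16 * (s * L) * (S * (1 + r))) +
          (√2 * √2) * (1 / N) * x + √2 * (s * L * A * (1 + r) * S) := by
      field_simp
    rw [c1, hs2]
    have c2 : 0 ≤ 16 * (s * L) * (S * (1 + r)) := by positivity
    have c3 : 0 ≤ s * L * A * (1 + r) * S := by positivity
    nlinarith
  have d1 : √2 * √x ≤ √(2 * η) + 9 + 2 * r := by
    rw [Real.sqrt_mul (by norm_num)]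
    nlinarith [Real.sqrt_nonneg η, Real.sqrt_nonneg r]
  have d2 : √2 * x / (N * L) ≤ 2 * η / (N * L) + (50 + 2 * r) := by
    have : √2 * x / (N * L) ≤ (2 * η + (50 + 2 * r)) / (N * L) := by gcongr; linarith
    rw [add_div] at this
    refine this.trans (add_le_add le_rfl (div_le_self (by linarith) hu))
  have e1 : 16 * s * (S * (1 + r)) + s * A * (1 + r) * S + (59 + 4 * r) ≤
      (65 + 16 * s * S + s * A * S) * (1 + r) := by nlinarith
  linarith

set_option maxHeartbeats 1000000 in
/-- Off a small set, the normalized process exceeds the correction by at most a constant. -/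
lemma exists_kernelChi_le {K : ℝ} (hψ : IsKernel ψ) (hK : IsScaleConstant ψ K) :
    ∃ C : ℝ, 0 ≤ C ∧ ∀ r : ℝ, 1 ≤ r → ∀ n : ℕ, 1 ≤ n → ∃ B : Set (Fin n → ℝ),
      stdGauss n B ≤ ENNReal.ofReal (C * Real.exp (-r)) ∧ ∀ ξ, ξ ∉ B → ∀ p ∈ scales n K,
        |kernelChi ψ n p ξ| / (√2 * Lam ψ n p.1 p.2) ≤
          corr n (2 * Real.log (1 / Lam ψ n p.1 p.2)) (Lam ψ n p.1 p.2) + C * (1 + r) := by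
  obtain ⟨γ, hγ0, hγ1, hγ⟩ := hψ.holder
  obtain ⟨c, hc, hcL⟩ := hK.exists_le_Lam_sq hψ
  obtain ⟨C, hC, hbad⟩ := exists_badSet_le hψ hγ1 hγ hK.1
  set q : ℝ := (1 / 2 : ℝ) ^ (γ : ℝ) with hq
  set A : ℝ := 16 + 8 / √K with hA
  have hA0 : 0 ≤ A := by positivity
  have hq0 : 0 < q := by positivity
  have hq1 : q < 1 := Real.rpow_lt_one (by norm_num) (by norm_num) (by exact_mod_cast hγ0)
  have hsum : Summable fun m : ℕ => q ^ m * ((m : ℝ) + 10) ^ 2 := by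
    have h0 := summable_pow_mul_geometric_of_norm_lt_one 0 (r := q) (by rwa [Real.norm_of_nonneg hq0.le])
    have h1 := summable_pow_mul_geometric_of_norm_lt_one 1 (r := q) (by rwa [Real.norm_of_nonneg hq0.le])
    have h2 := summable_pow_mul_geometric_of_norm_lt_one 2 (r := q) (by rwa [Real.norm_of_nonneg hq0.le])
    refine ((h2.add (h1.mul_left 20)).add (h0.mul_left 100)).congr fun m => by ring
  set S := ∑' m : ℕ, q ^ m * ((m : ℝ) + 10) ^ 2 with hS
  have hSm : ∀ m : ℕ, q ^ m * ((m : ℝ) + 10) ^ 2 ≤ S := fun m =>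
    hsum.le_tsum m fun _ _ => by positivity
  have hS0 : 0 ≤ S := le_trans (by positivity) (hSm 0)
  set s := √(2 / c) with hs
  have hs0 : 0 ≤ s := by positivity
  refine ⟨C + (65 + 16 * s * S + s * A * S), by positivity, fun r hr n hn =>
    ⟨badSet ψ K n q A r, (hbad r hr n hn).trans (ENNReal.ofReal_le_ofReal ?_), fun ξ hξ p hp => ?_⟩⟩
  · have : 0 ≤ 65 + 16 * s * S + s * A * S := by positivity
    nlinarith [Real.exp_pos (-r)]
  have hn0 : (0 : ℝ) < n := by positivity
  have hr0 : 0 ≤ r := zero_le_one.trans hr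
  have hp2 : 0 < p.2 := lt_of_lt_of_le (div_pos hK.1 hn0) hp.1.1
  -- The dyadic block of the bandwidth: 2^{-(i+1)} < h ≤ 2^{-i}.
  obtain ⟨i, hi1, hi2⟩ := exists_nat_pow_near_of_lt_one (y := (1 / 2 : ℝ)) hp2
    (by linarith [hp.1.2]) (by norm_num) (by norm_num)
  rw [one_div_pow] at hi1 hi2
  have hi : 1 ≤ i := by
    by_contra! h
    have : i = 0 := by omega
    subst this
    norm_num at hi1
    linarith [hp.1.2]
  have ht0 : 0 ≤ p.1 := by linarith [hp.2.1]
  have ht1 : p.1 ≤ 1 := by linarith [hp.2.2]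
  have hKi : K / n ≤ 1 / 2 ^ i := hp.1.1.trans hi2
  set H : ℝ := 1 / 2 ^ i with hH
  have hH0 : 0 < H := by positivity
  -- Start of the chain. The error q^{√i}√H in Λ at the starting point outweighs the growth of √x,
  -- while the 4^{√i} additional grid points enter the exponent only through √i.
  set m₀ := Nat.sqrt i with hm₀
  set L := Lam ψ n p.1 p.2 with hL
  have hLpos : 0 < L := Lam_pos_of_scales hK hn hp
  have hHL : √H ≤ s * L := by
    rw [hs, Real.sqrt_le_left (by positivity), mul_pow, Real.sq_sqrt (by positivity)]
    have h1 := hcL n hn p hp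
    have h2 : H ≤ 2 * p.2 := by
      rw [pow_succ] at hi1
      have : 1 / ((2 : ℝ) ^ i * 2) = H / 2 := by rw [hH]; field_simp
      linarith
    rw [div_mul_eq_mul_div, le_div_iff₀ hc]
    nlinarith
  have hstep : ∀ m : ℕ, |kernelChi ψ n (gridRound i (m + 1) p) ξ - kernelChi ψ n (gridRound i m p) ξ| ≤
      q ^ m * √H * A * (i + 2 * m + r) := by
    intro m
    by_contra! hlt
    refine hξ (Or.inl ?_)
    simp only [mem_iUnion]
    refine ⟨i, m, _, Finset.mem_range_succ_iff.2 (natFloor_le (m + 1) ht1), _,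
      Finset.mem_range_succ_iff.2 (natCeil_le_of_le (m + 1) hi2), hi, hKi, le_natCeil_of_lt m hi1, ?_⟩
    rw [gridRound_parent i m p] at hlt
    exact hlt
  have hclose : ∀ m : ℕ, (∑ k : Fin n, (weight ψ n p.1 p.2 k -
      weight ψ n (gridRound i m p).1 (gridRound i m p).2 k) ^ 2 ≤ (8 * q ^ m * √H) ^ 2) ∧
      ∀ k : Fin n, |weight ψ n p.1 p.2 k -
        weight ψ n (gridRound i m p).1 (gridRound i m p).2 k| ≤ 4 * q ^ m / √n := by
    intro m
    refine hψ.sum_sq_weight_sub_grid_le hγ1 hγ hn (i := i) (m := m) hi1.le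
      (hi1.le.trans (le_gridRound_snd m)) hi2 (gridRound_snd_le_of_le m hi2) ?_ ?_
    · rw [abs_le]
      have := gridRound_fst_le (i := i) m ht0
      have := le_gridRound_fst (i := i) (p := p) m
      have : (0 : ℝ) ≤ 1 / 2 ^ (i + m) := by positivity
      constructor <;> linarith
    · rw [abs_le]
      have := le_gridRound_snd (i := i) (p := p) m
      have := gridRound_snd_le (i := i) m hp2.le
      have : (0 : ℝ) ≤ 1 / 2 ^ (i + m) := by positivity
      constructor <;> linarith
  -- For fixed n and ξ the process is continuous along the roundings, so bounds on finite chains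
  -- pass to an arbitrary (t,h).
  have hlim : Tendsto (fun m => kernelChi ψ n (gridRound i m p) ξ) atTop (𝓝 (kernelChi ψ n p ξ)) := by
    simp only [kernelChi, chiSum]
    refine tendsto_finsetSum _ fun k _ => Tendsto.mul_const _ ?_
    rw [tendsto_iff_norm_sub_tendsto_zero]
    refine squeeze_zero (fun _ => norm_nonneg _) (fun m => ?_)
      (g := fun m : ℕ => 4 / √n * q ^ m) ?_
    · rw [Real.norm_eq_abs, abs_sub_comm]
      exact ((hclose m).2 k).trans (le_of_eq (by ring))
    · simpa using (tendsto_pow_atTop_nhds_zero_of_lt_one hq0.le hq1).const_mul (4 / √n)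
  have hbound : ∀ N, m₀ ≤ N → |kernelChi ψ n (gridRound i N p) ξ| ≤
      |kernelChi ψ n (gridRound i m₀ p) ξ| + √H * A * (1 + r) * S := by
    intro N hN
    have h1 := dist_le_Ico_sum_of_dist_le (f := fun m => kernelChi ψ n (gridRound i m p) ξ) hN
      (d := fun m => √H * A * (1 + r) * (q ^ m * ((m : ℝ) + 10) ^ 2)) (fun {m} hm _ => by
        rw [dist_comm, Real.dist_eq]
        refine (hstep m).trans ?_
        have h2 := (sqrt_sq_le_and i).2
        have h3 : (m₀ : ℝ) ≤ m := by exact_mod_cast hm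
        have h4 : (0 : ℝ) ≤ m₀ := by positivity
        -- As the chain runs over m ≥ √i, the level i is below (m+1)² and disappears from the bound;
        -- the resulting series S does not depend on i.
        have h5 : (i : ℝ) + 2 * m + r ≤ ((m : ℝ) + 10) ^ 2 * (1 + r) := by
          have : (i : ℝ) + 2 * m ≤ ((m : ℝ) + 10) ^ 2 := by
            rw [← hm₀] at h2
            nlinarith
          have h6 : 1 ≤ ((m : ℝ) + 10) ^ 2 := by nlinarith
          nlinarith [mul_le_mul_of_nonneg_right h6 hr0]
        calc q ^ m * √H * A * (i + 2 * m + r) ≤ q ^ m * √H * A * (((m : ℝ) + 10) ^ 2 * (1 + r)) := by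
              gcongr
          _ = _ := by ring)
    rw [← Finset.mul_sum] at h1
    have h2 : ∑ m ∈ Finset.Ico m₀ N, q ^ m * ((m : ℝ) + 10) ^ 2 ≤ S :=
      hsum.sum_le_tsum _ fun _ _ => by positivity
    have h3 : √H * A * (1 + r) * ∑ m ∈ Finset.Ico m₀ N, q ^ m * ((m : ℝ) + 10) ^ 2 ≤
        √H * A * (1 + r) * S := by gcongr
    rw [dist_comm, Real.dist_eq] at h1
    linarith [abs_sub_abs_le_abs_sub (kernelChi ψ n (gridRound i N p) ξ)
      (kernelChi ψ n (gridRound i m₀ p) ξ)]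
  have hchain : |kernelChi ψ n p ξ| ≤
      |kernelChi ψ n (gridRound i m₀ p) ξ| + √H * A * (1 + r) * S :=
    le_of_tendsto hlim.abs (eventually_atTop.2 ⟨m₀, hbound⟩)
  have hstart : |kernelChi ψ n (gridRound i m₀ p) ξ| ≤
      2 * Lam ψ n (gridRound i m₀ p).1 (gridRound i m₀ p).2 * √(startExp r i) +
        2 * (1 / √n) * startExp r i := by
    by_contra! hlt
    refine hξ (Or.inr ?_)
    simp only [mem_iUnion]
    exact ⟨i, _, Finset.mem_range_succ_iff.2 (natFloor_le m₀ ht1), _,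
      Finset.mem_range_succ_iff.2 (natCeil_le_of_le m₀ hi2), hlt⟩
  have hLam : Lam ψ n (gridRound i m₀ p).1 (gridRound i m₀ p).2 ≤ L + 8 * q ^ m₀ * √H := by
    refine (sqrt_sum_sq_le _ (weight ψ n p.1 p.2)).trans ?_
    refine add_le_add le_rfl ?_
    rw [Real.sqrt_le_left (by positivity)]
    exact (hclose m₀).1
  have hcorr := corr_ge hψ hK hn hp hi2
  set x := startExp r i with hx
  have hx0 : 0 ≤ x := startExp_nonneg hr i
  set η := ((i : ℝ) - 1) * Real.log 2 with hη
  have hu := one_le_sqrt_mul_Lam hK hn hp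
  rw [← hL] at hcorr hu
  have a1 : √x ≤ √η + 6 + √r := sqrt_startExp_le hi hr0
  have a2 : √2 * x ≤ 2 * η + 50 + 2 * r := sqrt_two_mul_startExp_le hi hr0
  have a3 : 1 + x ≤ ((m₀ : ℝ) + 10) ^ 2 * (1 + r) := one_add_startExp_le hr0
  have a4 : √x ≤ 1 + x := sqrt_le_one_add hx0
  -- The effect of replacing Λ by its value at the starting point is bounded uniformly in i, because
  -- the geometric factor q^{√i} beats the polynomial in √i.
  have a6 : q ^ m₀ * √x ≤ S * (1 + r) := by
    calc q ^ m₀ * √x ≤ q ^ m₀ * (((m₀ : ℝ) + 10) ^ 2 * (1 + r)) := by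
          gcongr; exact a4.trans a3
      _ = q ^ m₀ * ((m₀ : ℝ) + 10) ^ 2 * (1 + r) := by ring
      _ ≤ S * (1 + r) := by gcongr; exact hSm m₀
  have main : |kernelChi ψ n p ξ| ≤ 2 * L * √x + 16 * (s * L) * (S * (1 + r)) +
      2 * (1 / √n) * x + s * L * A * (1 + r) * S := by
    have b1 : 2 * Lam ψ n (gridRound i m₀ p).1 (gridRound i m₀ p).2 * √x ≤
        2 * L * √x + 16 * (s * L) * (S * (1 + r)) := by
      calc _ ≤ 2 * (L + 8 * q ^ m₀ * √H) * √x := by gcongr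
        _ = 2 * L * √x + 16 * √H * (q ^ m₀ * √x) := by ring
        _ ≤ _ := by gcongr
    have b2 : √H * A * (1 + r) * S ≤ s * L * A * (1 + r) * S := by gcongr
    linarith
  have hfin := normalized_chain_le hLpos hu hr (by positivity) hs0 hS0 hA0 a1 a2 main
  have e2 : 0 ≤ C * (1 + r) := by positivity
  rw [add_mul]
  linarith

end

end VolTest

namespace VolTest

noncomputable section

/-! ### The critical value, and the local statistics under an alternative -/

variable {ψ : ℝ → ℝ}

lemma cHatSq_eq {n : ℕ} (hn : 1 ≤ n) {z : Fin (n + 1) → ℝ} {U : Fin n → ℝ} {S : ℝ}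
    (hz : ∀ k : Fin n, n * (z k.succ - z k.castSucc) ^ 2 = S * U k) :
    cHatSq z = S * ((∑ k, U k) / n) := by
  have hn0 : (n : ℝ) ≠ 0 := by positivity
  rw [cHatSq, Finset.sum_div, Finset.mul_sum]
  refine Finset.sum_congr rfl fun k _ => ?_
  have := hz k
  field_simp
  linarith

/-- Scale invariance: the unknown level S cancels. The same formula serves for the null law (U_k =
ξ_k²) and for alternatives (U_k = θ_k ξ_k²). -/
lemma localStat_eq {n : ℕ} (hn : 1 ≤ n) {z : Fin (n + 1) → ℝ} {U : Fin n → ℝ} {S : ℝ} (hS : 0 < S)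
    (hz : ∀ k : Fin n, n * (z k.succ - z k.castSucc) ^ 2 = S * U k) (t h : ℝ) :
    localStat ψ t h z = (1 / √2 * ∑ k, weight ψ n t h k * (U k - (∑ k, U k) / n)) /
      ((∑ k, U k) / n * Lam ψ n t h) := by
  rw [localStat, cHatSq_eq hn hz]
  have : ∀ k, weight ψ n t h k * (n * (z k.succ - z k.castSucc) ^ 2 - S * ((∑ k, U k) / n)) =
      S * (weight ψ n t h k * (U k - (∑ k, U k) / n)) := fun k => by rw [hz k]; ring
  simp only [this]
  rw [← Finset.mul_sum, mul_left_comm, mul_assoc S, mul_div_mul_left _ _ hS.ne']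

lemma log_inv_Lam_bounds {K : ℝ} (hψ : IsKernel ψ) (hK : IsScaleConstant ψ K) {n : ℕ} (hn : 1 ≤ n)
    {p : ℝ × ℝ} (hp : p ∈ scales n K) :
    0 ≤ 2 * Real.log (1 / Lam ψ n p.1 p.2) ∧ 2 * Real.log (1 / Lam ψ n p.1 p.2) ≤ Real.log n := by
  have hn0 : (0 : ℝ) < n := by positivity
  have hp2 : 0 < p.2 := lt_of_lt_of_le (div_pos hK.1 hn0) hp.1.1
  have h1 := hψ.Lam_sq_le hn p.1 hp2
  have h2 := hK.2 n hn p hp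
  have h3 := Lam_pos_of_scales hK hn hp
  rw [two_log_inv_eq]
  constructor
  · refine Real.log_nonneg ?_
    rw [le_div_iff₀ (by positivity)]
    linarith [hp.1.2]
  · refine Real.log_le_log (by positivity) ?_
    rw [div_le_iff₀ (by positivity)]
    rwa [div_le_iff₀ hn0, mul_comm] at h2

lemma corr_nonneg {K : ℝ} (hψ : IsKernel ψ) (hK : IsScaleConstant ψ K) {n : ℕ} (hn : 1 ≤ n)
    {p : ℝ × ℝ} (hp : p ∈ scales n K) :
    0 ≤ corr n (2 * Real.log (1 / Lam ψ n p.1 p.2)) (Lam ψ n p.1 p.2) := by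
  have := (log_inv_Lam_bounds hψ hK hn hp).1
  rw [corr]; positivity

lemma corr_le {K : ℝ} (hψ : IsKernel ψ) (hK : IsScaleConstant ψ K) {n : ℕ} (hn : 1 ≤ n)
    {p : ℝ × ℝ} (hp : p ∈ scales n K) :
    corr n (2 * Real.log (1 / Lam ψ n p.1 p.2)) (Lam ψ n p.1 p.2) ≤ 1 + 4 * Real.log n := by
  obtain ⟨h0, h1⟩ := log_inv_Lam_bounds hψ hK hn hp
  set η := 2 * Real.log (1 / Lam ψ n p.1 p.2)
  have h2 := sqrt_le_one_add (x := 2 * η) (by positivity)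
  have h3 : 2 * η / max 1 (√n * Lam ψ n p.1 p.2) ≤ 2 * η :=
    div_le_self (by positivity) (le_max_left _ _)
  rw [corr]
  linarith

/-- The sum of the weights is at most 2h√n, and h is at most a multiple of Λ because h² ≤ h and ch ≤
Λ². Multiplied by an error of order n^{-1/2} in the level, it therefore contributes only O(Λ) to the
numerator. -/
lemma exists_sum_weight_le {K : ℝ} (hψ : IsKernel ψ) (hK : IsScaleConstant ψ K) :
    ∃ D : ℝ, 0 < D ∧ ∀ n : ℕ, 1 ≤ n → ∀ p ∈ scales n K,
      ∑ k, weight ψ n p.1 p.2 k ≤ D * √n * Lam ψ n p.1 p.2 := by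
  obtain ⟨c, hc, hcL⟩ := hK.exists_le_Lam_sq hψ
  refine ⟨2 / √c, by positivity, fun n hn p hp => ?_⟩
  have hp2 : 0 < p.2 := lt_of_lt_of_le (div_pos hK.1 (by positivity)) hp.1.1
  have h1 := hcL n hn p hp
  have h2 : √c * p.2 ≤ Lam ψ n p.1 p.2 := by
    refine abs_le_of_sq_le_sq' ?_ (Lam_nonneg _ _ _ _) |>.2
    rw [mul_pow, Real.sq_sqrt hc.le]
    refine le_trans ?_ h1
    have := hp.1.2
    gcongr
    nlinarith
  rw [hψ.sum_weight hn]
  calc √n * ∫ s in (0 : ℝ)..1, rescale ψ p.1 p.2 s ≤ √n * (2 * p.2) := by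
        gcongr
        exact hψ.integral_rescale_le hp2 (by linarith [hp.2.1]) (by linarith [hp.2.2])
    _ = 2 / √c * √n * (√c * p.2) := by field_simp
    _ ≤ _ := by gcongr

lemma eventually_div_sqrt_mul_log_le (a b : ℝ) :
    ∀ᶠ n : ℕ in atTop, a / √n * (b + 4 * Real.log n) ≤ 1 := by
  have h1 : Tendsto (fun n : ℕ => Real.log n / √n) atTop (𝓝 0) := by
    have := (isLittleO_log_rpow_atTop (r := 1 / 2) (by norm_num)).tendsto_div_nhds_zero
    refine (this.comp tendsto_natCast_atTop_atTop).congr fun n => ?_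
    simp [Real.sqrt_eq_rpow]
  have h2 : Tendsto (fun n : ℕ => 1 / √(n : ℝ)) atTop (𝓝 0) := by
    simp only [one_div]
    exact (Real.tendsto_sqrt_atTop.comp tendsto_natCast_atTop_atTop).inv_tendsto_atTop
  have h3 : Tendsto (fun n : ℕ => a / √n * (b + 4 * Real.log n)) atTop (𝓝 0) := by
    have := (h2.const_mul (a * b)).add (h1.const_mul (4 * a))
    simp only [mul_zero, add_zero] at this
    refine this.congr fun n => by ring
  exact (h3.eventually (gt_mem_nhds one_pos)).mono fun n h => h.le

/-- A supremum in ℝ of an unbounded family has a default value. Boundedness, from λ_k ≤ n^{-1/2} ≤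
Λ, is what lets a single (t,h) bound the statistic from below. -/
lemma bddAbove_multiStat {K : ℝ} (hψ : IsKernel ψ) (hK : IsScaleConstant ψ K) {n : ℕ} (hn : 1 ≤ n)
    (z : Fin (n + 1) → ℝ) :
    BddAbove (range fun p : scales n K => |localStat ψ p.1.1 p.1.2 z| -
      corr n (2 * Real.log (1 / Lam ψ n p.1.1 p.1.2)) (Lam ψ n p.1.1 p.1.2)) := by
  refine ⟨(∑ k : Fin n, |n * (z k.succ - z k.castSucc) ^ 2 - cHatSq z|) / cHatSq z, ?_⟩
  rintro _ ⟨⟨p, hp⟩, rfl⟩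
  have h1 := corr_nonneg hψ hK hn hp
  have h2 := Lam_pos_of_scales hK hn hp
  have h3 := one_le_sqrt_mul_Lam hK hn hp
  have hc : 0 ≤ cHatSq z := Finset.sum_nonneg fun _ _ => sq_nonneg _
  have hnp : (0 : ℝ) < √n := by positivity
  set L := Lam ψ n p.1 p.2
  set T := ∑ k : Fin n, |n * (z k.succ - z k.castSucc) ^ 2 - cHatSq z| with hT
  have h4 : |1 / √2 * ∑ k : Fin n, weight ψ n p.1 p.2 k *
      (n * (z k.succ - z k.castSucc) ^ 2 - cHatSq z)| ≤ T * L := by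
    rw [abs_mul, abs_of_nonneg (by positivity : 0 ≤ 1 / √2), hT, Finset.sum_mul]
    have h5 : 1 / √2 ≤ 1 := by
      rw [div_le_one (by positivity), Real.le_sqrt' (by norm_num)]; norm_num
    refine (mul_le_of_le_one_left (abs_nonneg _) h5).trans ((Finset.abs_sum_le_sum_abs _ _).trans
      (Finset.sum_le_sum fun k _ => ?_))
    rw [abs_mul, abs_of_nonneg (hψ.weight_nonneg _ _ _ _), mul_comm]
    gcongr
    refine (hψ.weight_le _ _ _ _).trans ?_
    rwa [div_le_iff₀ hnp, mul_comm]
  have h6 : |localStat ψ p.1 p.2 z| ≤ T / cHatSq z := by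
    rw [localStat, abs_div, abs_of_nonneg (by positivity : 0 ≤ cHatSq z * L)]
    calc _ ≤ T * L / (cHatSq z * L) := by gcongr
      _ = T / cHatSq z := mul_div_mul_right _ _ h2.ne'
  simp only
  linarith

lemma measurable_chiSum {n : ℕ} (a : Fin n → ℝ) : Measurable (chiSum a) := by
  unfold chiSum; fun_prop

/-- The mean of `θ_k ξ_k²` is close to one, for bounded `θ_k` of mean one. -/
lemma chiSum_div_tail {n : ℕ} (hn : 1 ≤ n) {θ : Fin n → ℝ} {M r : ℝ} (hM : 0 ≤ M) (hr : 1 ≤ r)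
    (hθ : ∀ k, |θ k| ≤ M) :
    (stdGauss n).real {ξ | 4 * M * r / √n < |chiSum (fun k => θ k / n) ξ|} ≤
      2 * Real.exp (-r) := by
  have hn0 : (0 : ℝ) < n := by positivity
  have hn1 : (1 : ℝ) ≤ n := by exact_mod_cast hn
  have hr0 : 0 ≤ r := zero_le_one.trans hr
  have hsr : √r ≤ r := by rw [Real.sqrt_le_left hr0]; nlinarith
  have hsn : √n * √n = n := Real.mul_self_sqrt hn0.le
  refine le_trans (measureReal_mono (ofPred_subset_ofPred.2 fun ξ h => lt_of_le_of_lt ?_ h))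
    (chiSum_tail (fun k => θ k / n) (v := M / √n) (b := M / n) (by positivity) (by positivity)
      hr0 ?_ ?_)
  · have h1 : M / n ≤ M / √n := by
      gcongr
      rw [Real.sqrt_le_left hn0.le]; nlinarith
    calc 2 * (M / √n) * √r + 2 * (M / n) * r ≤ 2 * (M / √n) * r + 2 * (M / √n) * r := by gcongr
      _ = _ := by ring
  · calc ∑ k, (θ k / n) ^ 2 ≤ ∑ k : Fin n, (M / n) ^ 2 := by
          refine Finset.sum_le_sum fun k _ => ?_
          rw [div_pow, div_pow]
          exact div_le_div_of_nonneg_right (sq_le_sq' (abs_le.1 (hθ k)).1 (abs_le.1 (hθ k)).2)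
            (by positivity)
      _ = (M / √n) ^ 2 := by
          rw [Finset.sum_const, Finset.card_univ, Fintype.card_fin, nsmul_eq_mul, div_pow, div_pow,
            Real.sq_sqrt hn0.le]
          field_simp
  · intro k
    rw [abs_div, Nat.abs_cast]
    gcongr
    exact hθ k

lemma sum_div_sub_one {n : ℕ} (hn : 1 ≤ n) {θ ξ : Fin n → ℝ} (h1 : ∑ k, θ k = n) :
    (∑ k, θ k * ξ k ^ 2) / n - 1 = chiSum (fun k => θ k / n) ξ := by
  have hn0 : (n : ℝ) ≠ 0 := by positivity
  have : chiSum (fun k => θ k / n) ξ = (∑ k, θ k * ξ k ^ 2 - ∑ k, θ k) / n := by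
    rw [chiSum, ← Finset.sum_sub_distrib, Finset.sum_div]
    exact Finset.sum_congr rfl fun k _ => by ring
  rw [this, h1, sub_div, div_self hn0]

/-- Noise, signal, and the error from estimating the level. -/
lemma sum_weight_mul_sub {n : ℕ} (w θ ξ : Fin n → ℝ) (c : ℝ) :
    ∑ k, w k * (θ k * ξ k ^ 2 - c) =
      chiSum (fun k => w k * θ k) ξ + ∑ k, w k * (θ k - 1) - (c - 1) * ∑ k, w k := by
  rw [chiSum, Finset.mul_sum, ← Finset.sum_add_distrib, ← Finset.sum_sub_distrib]
  exact Finset.sum_congr rfl fun k _ => by ring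

/-- The signal vanishes, so the numerator is at most Λ(G_n + const). Dividing by the mean c of the
ξ_k² costs a factor 1 + 2e with e of order n^{-1/2}, which is harmless because G_n is at most 1 + 4
log n. -/
lemma multiStat_null_le {K : ℝ} (hψ : IsKernel ψ) (hK : IsScaleConstant ψ K) {C D r : ℝ}
    (hC : 0 ≤ C) (hD : 0 < D) (hr : 1 ≤ r)
    {n : ℕ} (hn : 1 ≤ n)
    (hDw : ∀ p ∈ scales n K, ∑ k, weight ψ n p.1 p.2 k ≤ D * √n * Lam ψ n p.1 p.2)
    (hsmall : 8 * r / √n * ((1 + C * (1 + r) + 4 * r * D) + 4 * Real.log n) ≤ 1)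
    {ξ : Fin n → ℝ} {z : Fin (n + 1) → ℝ}
    (hz : ∀ k : Fin n, n * (z k.succ - z k.castSucc) ^ 2 = 1 * (1 * ξ k ^ 2))
    (h1 : ∀ p ∈ scales n K, |kernelChi ψ n p ξ| / (√2 * Lam ψ n p.1 p.2) ≤
          corr n (2 * Real.log (1 / Lam ψ n p.1 p.2)) (Lam ψ n p.1 p.2) + C * (1 + r))
    (h2 : |chiSum (fun _ => 1 / (n : ℝ)) ξ| ≤ 4 * r / √n) :
    multiStat ψ K z ≤ C * (1 + r) + 4 * r * D + 1 := by
  -- The nonnegativity of the bound covers an empty index set, where the supremum is zero by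
  -- convention.
  refine Real.iSup_le ?_ (by positivity)
  rintro ⟨p, hp⟩
  have hn1 : (1 : ℝ) ≤ n := by exact_mod_cast hn
  have hlog : 0 ≤ Real.log n := Real.log_nonneg hn1
  have hsn : 0 < √(n : ℝ) := by positivity
  have hL := Lam_pos_of_scales hK hn hp
  have hc0 := corr_nonneg hψ hK hn hp
  have hc1 := corr_le hψ hK hn hp
  have h3 := h1 p hp
  have h4 := hDw p hp
  simp only
  rw [localStat_eq hn one_pos hz]
  have hm := sum_div_sub_one hn (θ := fun _ => 1) (ξ := ξ) (by simp)
  set c : ℝ := (∑ k, (1 : ℝ) * ξ k ^ 2) / n with hcdef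
  rw [sum_weight_mul_sub _ (fun _ => 1) ξ c]
  set G := corr n (2 * Real.log (1 / Lam ψ n p.1 p.2)) (Lam ψ n p.1 p.2)
  set L := Lam ψ n p.1 p.2
  set e := 4 * r / √n with he
  have he0 : 0 ≤ e := by positivity
  have hCr : 0 ≤ C * (1 + r) := by positivity
  have hrD : 0 ≤ 4 * r * D := by positivity
  have he2 : 2 * e * ((1 + C * (1 + r) + 4 * r * D) + 4 * Real.log n) ≤ 1 := by
    rw [he]; refine le_trans (le_of_eq (by ring)) hsmall
  have he1 : 2 * e ≤ 1 := by
    refine le_trans ?_ he2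
    refine le_mul_of_one_le_right (by positivity) (by linarith)
  rw [← hm] at h2
  have hcl : 1 - e ≤ c := by linarith [(abs_le.1 h2).1]
  have hc : 0 < c := by linarith
  have hY : |kernelChi ψ n p ξ| ≤ √2 * L * (G + C * (1 + r)) := by
    rwa [div_le_iff₀ (by positivity), mul_comm] at h3
  have hs2 : 1 ≤ √2 := by rw [Real.le_sqrt' (by norm_num)]; norm_num
  have hW : |(c - 1) * ∑ k, weight ψ n p.1 p.2 k| ≤ 4 * r * D * L := by
    rw [abs_mul, abs_of_nonneg (Finset.sum_nonneg fun k _ => hψ.weight_nonneg n p.1 p.2 k)]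
    calc _ ≤ e * (D * √n * L) :=
          mul_le_mul h2 h4 (Finset.sum_nonneg fun k _ => hψ.weight_nonneg n p.1 p.2 k) he0
      _ = _ := by rw [he]; field_simp
  have hnum : |1 / √2 * (chiSum (fun k => weight ψ n p.1 p.2 k * 1) ξ +
      ∑ k, weight ψ n p.1 p.2 k * (1 - 1) - (c - 1) * ∑ k, weight ψ n p.1 p.2 k)| ≤
      L * (G + C * (1 + r) + 4 * r * D) := by
    simp only [mul_one, sub_self, mul_zero, Finset.sum_const_zero, add_zero]
    rw [abs_mul, abs_of_nonneg (by positivity : 0 ≤ 1 / √2), one_div_mul_eq_div,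
      div_le_iff₀ (by positivity)]
    refine (abs_sub _ _).trans ?_
    have : 4 * r * D * L ≤ √2 * (4 * r * D * L) := le_mul_of_one_le_left (by positivity) hs2
    rw [kernelChi] at hY
    nlinarith
  rw [abs_div, abs_of_pos (mul_pos hc hL)]
  have hq : |1 / √2 * (chiSum (fun k => weight ψ n p.1 p.2 k * 1) ξ +
      ∑ k, weight ψ n p.1 p.2 k * (1 - 1) - (c - 1) * ∑ k, weight ψ n p.1 p.2 k)| / (c * L) ≤
      (G + C * (1 + r) + 4 * r * D) * (1 + 2 * e) := by
    rw [div_le_iff₀ (mul_pos hc hL)]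
    refine hnum.trans ?_
    have : 1 ≤ (1 + 2 * e) * c := by nlinarith
    have h0 : 0 ≤ L * (G + C * (1 + r) + 4 * r * D) := by positivity
    nlinarith
  have hlast : 2 * e * (G + C * (1 + r) + 4 * r * D) ≤ 1 := by
    exact le_trans (mul_le_mul_of_nonneg_left (by linarith) (by positivity)) he2
  linarith

/-! ### The null law and the critical value. -/

lemma increments_walk {n : ℕ} (z₀ : ℝ) (x : Fin n → ℝ) (k : Fin n) :
    (z₀ + ∑ i : Fin n with i.castSucc < k.succ, x i) -
      (z₀ + ∑ i : Fin n with i.castSucc < k.castSucc, x i) = x k := by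
  have : (Finset.univ.filter fun i : Fin n => i.castSucc < k.succ) =
      insert k (Finset.univ.filter fun i : Fin n => i.castSucc < k.castSucc) := by
    ext i
    simp only [Finset.mem_filter, Finset.mem_univ, true_and, Finset.mem_insert, Fin.lt_def,
      Fin.val_castSucc, Fin.val_succ, Fin.ext_iff]
    omega
  rw [this, Finset.sum_insert (by simp)]
  ring

lemma pi_gaussianReal_eq_map {n : ℕ} (v : Fin n → ℝ≥0) :
    (Measure.pi fun k => gaussianReal 0 (v k)) =
      (stdGauss n).map fun ξ k => √(v k) * ξ k := by
  have h : ∀ k, gaussianReal 0 (v k) = (gaussianReal 0 1).map (fun x => √(v k) * x) := fun k => by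
    rw [gaussianReal_map_const_mul]
    simp only [mul_zero, mul_one]
    congr 1
    ext
    simp
  have : ∀ k, IsProbabilityMeasure ((gaussianReal 0 1).map (fun x => √(v k : ℝ) * x)) := fun k => by
    rw [← h k]; infer_instance
  simp only [h]
  rw [Measure.pi_map_pi (fun k => by fun_prop)]

/-- The inequality μ(f⁻¹A) ≤ (f_*μ)(A) holds for every set A, so no measurability is needed for the
sublevel set of a supremum over uncountably many (t,h). -/
lemma le_nullLaw_real {n : ℕ} (hn : 1 ≤ n) (z₀ : ℝ) {A : Set (Fin (n + 1) → ℝ)}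
    {B : Set (Fin n → ℝ)} {α : ℝ} (hB : (stdGauss n).real B ≤ α)
    (h : ∀ ξ, ξ ∉ B → ∀ z : Fin (n + 1) → ℝ,
      (∀ k : Fin n, n * (z k.succ - z k.castSucc) ^ 2 = 1 * (1 * ξ k ^ 2)) → z ∈ A) :
    1 - α ≤ (nullLaw z₀ n).real A := by
  have hn0 : (0 : ℝ) < n := by positivity
  set f : (Fin n → ℝ) → Fin (n + 1) → ℝ := fun x k => z₀ + ∑ i : Fin n with i.castSucc < k, x i
  set g : (Fin n → ℝ) → Fin n → ℝ := fun ξ k => √(((n : ℝ≥0)⁻¹ : ℝ≥0) : ℝ) * ξ k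
  have hf : Measurable f := by fun_prop
  have hg : Measurable g := by fun_prop
  have e : nullLaw z₀ n = (stdGauss n).map (f ∘ g) := by
    rw [nullLaw, pi_gaussianReal_eq_map, Measure.map_map hf hg]
  have hsub : Bᶜ ⊆ (f ∘ g) ⁻¹' A := fun ξ hξ => by
    refine h ξ hξ _ fun k => ?_
    rw [Function.comp_apply, increments_walk]
    simp only [g]
    rw [mul_pow, Real.sq_sqrt (by positivity)]
    push_cast
    field_simp
  have h1 : (stdGauss n).real Bᶜ ≤ (nullLaw z₀ n).real A := by
    rw [e]
    have : IsFiniteMeasure ((stdGauss n).map (f ∘ g)) := inferInstance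
    refine (measureReal_mono hsub).trans ?_
    exact ENNReal.toReal_mono (measure_ne_top _ _) (Measure.le_map_apply (hf.comp hg).aemeasurable _)
  have h2 : 1 ≤ (stdGauss n).real B + (stdGauss n).real Bᶜ := by
    have := measureReal_union_le (μ := stdGauss n) B Bᶜ
    rwa [union_compl_self, probReal_univ] at this
  linarith

/-- The critical values are bounded. -/
lemma exists_critValue_le {K : ℝ} (hψ : IsKernel ψ) (hK : IsScaleConstant ψ K) {α : ℝ}
    (hα : 0 < α) (z₀ : ℝ) :
    ∃ κ : ℝ, 0 ≤ κ ∧ ∀ᶠ n : ℕ in atTop, critValue ψ K α z₀ n ≤ κ := by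
  obtain ⟨C, hC, hchi⟩ := exists_kernelChi_le hψ hK
  obtain ⟨D, hD, hDw⟩ := exists_sum_weight_le hψ hK
  obtain ⟨r, hr, hrα⟩ : ∃ r : ℝ, 1 ≤ r ∧ (C + 2) * Real.exp (-r) ≤ α := by
    have h : Tendsto (fun r : ℝ => (C + 2) * Real.exp (-r)) atTop (𝓝 0) := by
      simpa using (Real.tendsto_exp_neg_atTop_nhds_zero).const_mul (C + 2)
    obtain ⟨r, h1, h2⟩ := ((eventually_ge_atTop 1).and (h.eventually (gt_mem_nhds hα))).exists
    exact ⟨r, h1, h2.le⟩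
  refine ⟨C * (1 + r) + 4 * r * D + 1, by positivity, ?_⟩
  filter_upwards [eventually_ge_atTop 1,
    eventually_div_sqrt_mul_log_le (8 * r) (1 + C * (1 + r) + 4 * r * D)] with n hn hsmall
  obtain ⟨B, hB, hBξ⟩ := hchi r hr n hn
  set B' := {ξ : Fin n → ℝ | 4 * 1 * r / √n < |chiSum (fun _ => 1 / (n : ℝ)) ξ|} with hB'
  have h1 : (stdGauss n).real (B ∪ B') ≤ α := by
    refine (measureReal_union_le _ _).trans (le_trans ?_ hrα)
    have h2 : (stdGauss n).real B ≤ C * Real.exp (-r) :=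
      ENNReal.toReal_le_of_le_ofReal (by positivity) hB
    have h3 := chiSum_div_tail hn (θ := fun _ => 1) (M := 1) zero_le_one hr (by simp)
    rw [add_mul]
    exact add_le_add h2 h3
  have h2 := le_nullLaw_real hn z₀ (A := {z | multiStat ψ K z ≤ C * (1 + r) + 4 * r * D + 1}) h1
    (fun ξ hξ z hz => by
      have hξ1 : ξ ∉ B := fun h => hξ (Or.inl h)
      have hξ2 : ¬ (4 * 1 * r / √n < |chiSum (fun _ => 1 / (n : ℝ)) ξ|) := fun h => hξ (Or.inr h)
      rw [mul_one, not_lt] at hξ2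
      exact multiStat_null_le hψ hK hC hD hr hn (hDw n hn) hsmall hz (hBξ ξ hξ1) hξ2)
  rw [critValue]
  -- If the set of admissible levels is not bounded below, its infimum is zero by convention, and
  -- the bound is nonnegative.
  by_cases hbdd : BddBelow {r : ℝ | 1 - α ≤ (nullLaw z₀ n).real {z | multiStat ψ K z ≤ r}}
  · exact csInf_le hbdd h2
  · rw [Real.sInf_of_not_bddBelow hbdd]; positivity

/-- Off a small set, a large signal at one point makes the test reject. -/
lemma critValue_lt_multiStat {K : ℝ} (hψ : IsKernel ψ) (hK : IsScaleConstant ψ K) {α z₀ κ D M r : ℝ}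
    (hκ0 : 0 ≤ κ) (hD : 0 < D) (hM : 0 ≤ M) (hr : 1 ≤ r) {n : ℕ} (hn : 1 ≤ n)
    (hκ : critValue ψ K α z₀ n ≤ κ)
    (hDw : ∀ p ∈ scales n K, ∑ k, weight ψ n p.1 p.2 k ≤ D * √n * Lam ψ n p.1 p.2)
    (hsmall : 8 * M * r / √n * ((1 + κ) + 4 * Real.log n) ≤ 1)
    {p : ℝ × ℝ} (hp : p ∈ scales n K) {θ ξ : Fin n → ℝ} (hθ : ∑ k, θ k = n)
    {z : Fin (n + 1) → ℝ} {S : ℝ} (hS : 0 < S)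
    (hz : ∀ k : Fin n, n * (z k.succ - z k.castSucc) ^ 2 = S * (θ k * ξ k ^ 2))
    (h1 : |chiSum (fun k => weight ψ n p.1 p.2 k * θ k) ξ| ≤ 4 * M * r * Lam ψ n p.1 p.2)
    (h2 : |chiSum (fun k => θ k / n) ξ| ≤ 4 * M * r / √n)
    (hsig : corr n (2 * Real.log (1 / Lam ψ n p.1 p.2)) (Lam ψ n p.1 p.2) +
      (4 * M * r * (1 + D) + κ + 2) ≤
      |∑ k, weight ψ n p.1 p.2 k * (θ k - 1)| / (√2 * Lam ψ n p.1 p.2)) :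
    critValue ψ K α z₀ n < multiStat ψ K z := by
  -- Only one (t,h) is used from here on, so no chaining is required under the alternative.
  refine hκ.trans_lt (lt_of_lt_of_le ?_ (le_ciSup (bddAbove_multiStat hψ hK hn z) ⟨p, hp⟩))
  have hn1 : (1 : ℝ) ≤ n := by exact_mod_cast hn
  have hlog : 0 ≤ Real.log n := Real.log_nonneg hn1
  have hsn : 0 < √(n : ℝ) := by positivity
  have hL := Lam_pos_of_scales hK hn hp
  have hc0 := corr_nonneg hψ hK hn hp
  have hc1 := corr_le hψ hK hn hp
  have h4 := hDw p hp
  simp only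
  rw [localStat_eq hn hS hz]
  have hm := sum_div_sub_one hn (θ := θ) (ξ := ξ) hθ
  set c := (∑ k, θ k * ξ k ^ 2) / n with hcdef
  rw [sum_weight_mul_sub _ θ ξ c]
  set G := corr n (2 * Real.log (1 / Lam ψ n p.1 p.2)) (Lam ψ n p.1 p.2)
  set L := Lam ψ n p.1 p.2
  set e := 4 * M * r / √n with he
  set s := ∑ k, weight ψ n p.1 p.2 k * (θ k - 1) with hs
  have he0 : 0 ≤ e := by positivity
  have he2 : 2 * e * ((1 + κ) + 4 * Real.log n) ≤ 1 := by
    rw [he]; refine le_trans (le_of_eq (by ring)) hsmall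
  have he1 : 2 * e ≤ 1 := by
    refine le_trans ?_ he2
    refine le_mul_of_one_le_right (by positivity) (by linarith)
  rw [← hm] at h2
  have hcl : 1 - e ≤ c := by linarith [(abs_le.1 h2).1]
  have hcu : c ≤ 1 + e := by linarith [(abs_le.1 h2).2]
  have hc : 0 < c := by linarith
  have hs2 : 1 ≤ √2 := by rw [Real.le_sqrt' (by norm_num)]; norm_num
  have hW : |(c - 1) * ∑ k, weight ψ n p.1 p.2 k| ≤ 4 * M * r * D * L := by
    rw [abs_mul, abs_of_nonneg (Finset.sum_nonneg fun k _ => hψ.weight_nonneg n p.1 p.2 k)]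
    calc _ ≤ e * (D * √n * L) :=
          mul_le_mul h2 h4 (Finset.sum_nonneg fun k _ => hψ.weight_nonneg n p.1 p.2 k) he0
      _ = _ := by rw [he]; field_simp
  rw [le_div_iff₀ (by positivity)] at hsig
  have hnum : L * (G + κ + 2) ≤ |1 / √2 * (chiSum (fun k => weight ψ n p.1 p.2 k * θ k) ξ +
      s - (c - 1) * ∑ k, weight ψ n p.1 p.2 k)| := by
    rw [abs_mul, abs_of_nonneg (by positivity : 0 ≤ 1 / √2), one_div_mul_eq_div,
      le_div_iff₀ (by positivity)]
    have t1 : |s| ≤ |chiSum (fun k => weight ψ n p.1 p.2 k * θ k) ξ + s -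
        (c - 1) * ∑ k, weight ψ n p.1 p.2 k| + |chiSum (fun k => weight ψ n p.1 p.2 k * θ k) ξ| +
        |(c - 1) * ∑ k, weight ψ n p.1 p.2 k| := by
      have e1 : s = (chiSum (fun k => weight ψ n p.1 p.2 k * θ k) ξ + s -
        (c - 1) * ∑ k, weight ψ n p.1 p.2 k) - chiSum (fun k => weight ψ n p.1 p.2 k * θ k) ξ +
        (c - 1) * ∑ k, weight ψ n p.1 p.2 k := by ring
      conv_lhs => rw [e1]
      exact (abs_add_le _ _).trans (add_le_add (abs_sub _ _) le_rfl)
    have t2 : 4 * M * r * (1 + D) * L ≤ √2 * (4 * M * r * (1 + D) * L) :=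
      le_mul_of_one_le_left (by positivity) hs2
    nlinarith
  rw [abs_div, abs_of_pos (mul_pos hc hL), lt_sub_iff_add_lt, lt_div_iff₀ (mul_pos hc hL)]
  refine lt_of_lt_of_le ?_ hnum
  have h5 : e * (κ + G) ≤ 1 := by
    have : 2 * e * (κ + G) ≤ 1 := by
      exact le_trans (mul_le_mul_of_nonneg_left (by linarith) (by positivity)) he2
    have : 0 ≤ e * (κ + G) := by positivity
    linarith
  have h6 : (κ + G) * c < G + κ + 2 := by
    have : (κ + G) * c ≤ (κ + G) * (1 + e) := by gcongr
    nlinarith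
  nlinarith

end

end VolTest

namespace VolTest

noncomputable section

/-! ### The law of the increments of a solution -/

variable {Ω : Type*} [MeasurableSpace Ω] {P : Measure Ω} {W : ℝ≥0 → Ω → ℝ}

/-- Lebesgue measure on `[0,1]`. -/
abbrev unitVol : Measure ℝ := volume.restrict (Icc 0 1)

/-- The function `∑ c_i 1_{(0,τ_i]}`. -/
def combFun {ι : Type*} [Fintype ι] (c : ι → ℝ) (τ : ι → ℝ≥0) (u : ℝ) : ℝ :=
  ∑ i, c i * (Ioc (0 : ℝ) (τ i)).indicator 1 u

/-- The random variable `∑ c_i W_{τ_i}`. -/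
def combInt {ι : Type*} [Fintype ι] (c : ι → ℝ) (τ : ι → ℝ≥0) (W : ℝ≥0 → Ω → ℝ) (ω : Ω) : ℝ :=
  ∑ i, c i * W (τ i) ω

lemma memLp_combFun {ι : Type*} [Fintype ι] (c : ι → ℝ) (τ : ι → ℝ≥0) :
    MemLp (combFun c τ) 2 unitVol := by
  refine memLp_finsetSum _ fun i _ => MemLp.const_mul ?_ _
  exact (memLp_const (1 : ℝ)).indicator measurableSet_Ioc

lemma integral_indicator_mul_indicator {s t : ℝ≥0} (hs : s ≤ 1) :
    ∫ u, (Ioc (0 : ℝ) s).indicator (1 : ℝ → ℝ) u * (Ioc (0 : ℝ) t).indicator (1 : ℝ → ℝ) u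
      ∂unitVol = min s t := by
  have hs' : (s : ℝ) ≤ 1 := by exact_mod_cast hs
  have h1 : ∀ u, (Ioc (0 : ℝ) s).indicator (1 : ℝ → ℝ) u * (Ioc (0 : ℝ) t).indicator (1 : ℝ → ℝ) u =
      (Ioc (0 : ℝ) (min s t)).indicator (fun _ => (1 : ℝ)) u := fun u => by
    rw [← inter_indicator_mul, Ioc_inter_Ioc]
    simp
  simp only [h1]
  rw [integral_indicator measurableSet_Ioc, Measure.restrict_restrict measurableSet_Ioc,
    inter_eq_left.2 (Ioc_subset_Icc_self.trans
      (Icc_subset_Icc le_rfl ((min_le_left _ _).trans hs')))]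
  simp

lemma integral_combFun_sq {ι : Type*} [Fintype ι] (c : ι → ℝ) {τ : ι → ℝ≥0} (hτ : ∀ i, τ i ≤ 1) :
    ∫ u, combFun c τ u ^ 2 ∂unitVol = ∑ i, ∑ j, c i * c j * min (τ i) (τ j) := by
  have hm : ∀ t : ℝ≥0, MemLp ((Ioc (0 : ℝ) t).indicator (1 : ℝ → ℝ)) 2 unitVol := fun t =>
    (memLp_const (1 : ℝ)).indicator measurableSet_Ioc
  have h1 : ∀ u, combFun c τ u ^ 2 = ∑ i, ∑ j, c i * c j *
      ((Ioc (0 : ℝ) (τ i)).indicator (1 : ℝ → ℝ) u * (Ioc (0 : ℝ) (τ j)).indicator (1 : ℝ → ℝ) u) :=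
    fun u => by
      rw [combFun, pow_two, Finset.sum_mul_sum]
      exact Finset.sum_congr rfl fun i _ => Finset.sum_congr rfl fun j _ => by ring
  simp only [h1]
  have hint : ∀ i j, Integrable (fun u => c i * c j *
      ((Ioc (0 : ℝ) (τ i)).indicator (1 : ℝ → ℝ) u * (Ioc (0 : ℝ) (τ j)).indicator (1 : ℝ → ℝ) u))
      unitVol := fun i j => ((hm (τ i)).integrable_mul (hm (τ j))).const_mul _
  rw [integral_finsetSum _ fun i _ => integrable_finsetSum _ fun j _ => hint i j]
  refine Finset.sum_congr rfl fun i _ => ?_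
  rw [integral_finsetSum _ fun j _ => hint i j]
  refine Finset.sum_congr rfl fun j _ => ?_
  rw [integral_const_mul, integral_indicator_mul_indicator (hτ i)]

/-- Wiener isometry for elementary integrals: the covariance min(s,t) of Brownian motion is the L²
inner product of 1_{(0,s]} and 1_{(0,t]}. -/
lemma map_combInt [IsProbabilityMeasure P] (hW : IsPreBrownianReal W P) {ι : Type*} [Fintype ι] (c : ι → ℝ)
    {τ : ι → ℝ≥0} (hτ : ∀ i, τ i ≤ 1) :
    HasGaussianLaw (combInt c τ W) P ∧
      P.map (combInt c τ W) = gaussianReal 0 (∫ u, combFun c τ u ^ 2 ∂unitVol).toNNReal := by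
  have hG : HasGaussianLaw (combInt c τ W) P := by
    have := ((hW.isGaussianProcess.comp_right τ).smul c).hasGaussianLaw_fun_sum (I := Finset.univ)
    exact this
  have hmem : ∀ t, MemLp (W t) 2 P := fun t => (hW.isGaussianProcess.hasGaussianLaw_eval t).memLp_two
  refine ⟨hG, ?_⟩
  rw [hG.map_eq_gaussianReal]
  have h1 : P[combInt c τ W] = 0 := by
    simp only [combInt]
    rw [integral_finsetSum _ fun i _ => (hW.integrable_eval _).const_mul _]
    refine Finset.sum_eq_zero fun i _ => ?_
    rw [integral_const_mul, hW.integral_eval, mul_zero]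
  have h2 : Var[combInt c τ W; P] = ∫ u, combFun c τ u ^ 2 ∂unitVol := by
    rw [integral_combFun_sq c hτ, ← covariance_self hG.aemeasurable]
    have := covariance_fun_sum_fun_sum (μ := P) (X := fun i ω => c i * W (τ i) ω)
      (Y := fun i ω => c i * W (τ i) ω) (fun i => (hmem _).const_mul _) (fun i => (hmem _).const_mul _)
    refine (this : cov[combInt c τ W, combInt c τ W; P] = _).trans ?_
    refine Finset.sum_congr rfl fun i _ => Finset.sum_congr rfl fun j _ => ?_
    rw [covariance_const_mul_left, covariance_const_mul_right]
    have := hW.covariance_eval (τ i) (τ j)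
    rw [this]; push_cast; ring
  rw [h1, h2]

/-- An indicator of (s,t] is the difference of those of (0,t] and (0,s]. -/
lemma step_eq_comb {Ω : Type*} {W : ℝ≥0 → Ω → ℝ} (S : Step) :
    S.toFun = combFun (Sum.elim S.a fun i => - S.a i) (Sum.elim S.t S.s) ∧
      S.integral W = combInt (Sum.elim S.a fun i => - S.a i) (Sum.elim S.t S.s) W := by
  constructor
  · ext u
    simp only [Step.toFun, combFun, Fintype.sum_sum_type, Sum.elim_inl, Sum.elim_inr,
      ← Finset.sum_add_distrib]
    refine Finset.sum_congr rfl fun i _ => ?_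
    have h : (S.s i : ℝ) ≤ S.t i := by exact_mod_cast S.s_le i
    have h0 : (0 : ℝ) ≤ S.s i := (S.s i).2
    simp only [indicator_apply, mem_Ioc, Pi.one_apply]
    split_ifs <;> first | (exfalso; grind) | simp
  · ext ω
    simp only [Step.integral, combInt, Fintype.sum_sum_type, Sum.elim_inl, Sum.elim_inr,
      ← Finset.sum_add_distrib]
    exact Finset.sum_congr rfl fun i _ => by ring

/-- A finite combination of step functions is again a combination of the functions 1_{(0,τ]},
indexed by a disjoint union. Joint laws of Wiener integrals thus reduce to one-dimensional ones. -/
lemma map_sum_step [IsProbabilityMeasure P] (hW : IsPreBrownianReal W P) {J : Type*} [Fintype J]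
    (a : J → ℝ) (S : J → Step) :
    HasGaussianLaw (fun ω => ∑ j, a j * (S j).integral W ω) P ∧
      P.map (fun ω => ∑ j, a j * (S j).integral W ω) =
        gaussianReal 0 (∫ u, (∑ j, a j * (S j).toFun u) ^ 2 ∂unitVol).toNNReal := by
  have h := map_combInt hW (ι := Σ j : J, Fin (S j).m ⊕ Fin (S j).m)
    (fun x => a x.1 * Sum.elim (S x.1).a (fun i => - (S x.1).a i) x.2)
    (τ := fun x => Sum.elim (S x.1).t (S x.1).s x.2) (fun x => by
      rcases x with ⟨j, i | i⟩
      · exact (S j).t_le i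
      · exact ((S j).s_le i).trans ((S j).t_le i))
  have e1 : (fun ω => ∑ j, a j * (S j).integral W ω) = combInt
    (fun x : Σ j : J, Fin (S j).m ⊕ Fin (S j).m =>
      a x.1 * Sum.elim (S x.1).a (fun i => - (S x.1).a i) x.2)
    (fun x => Sum.elim (S x.1).t (S x.1).s x.2) W := by
    ext ω
    rw [combInt, Fintype.sum_sigma]
    refine Finset.sum_congr rfl fun j _ => ?_
    rw [(step_eq_comb (W := W) (S j)).2, combInt, Finset.mul_sum]
    exact Finset.sum_congr rfl fun i _ => by ring
  have e2 : (fun u => ∑ j, a j * (S j).toFun u) = combFun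
    (fun x : Σ j : J, Fin (S j).m ⊕ Fin (S j).m =>
      a x.1 * Sum.elim (S x.1).a (fun i => - (S x.1).a i) x.2)
    (fun x => Sum.elim (S x.1).t (S x.1).s x.2) := by
    ext u
    rw [combFun, Fintype.sum_sigma]
    refine Finset.sum_congr rfl fun j _ => ?_
    rw [(step_eq_comb (W := W) (S j)).1, combFun, Finset.mul_sum]
    exact Finset.sum_congr rfl fun i _ => by ring
  have e2' : ∀ u, ∑ j, a j * (S j).toFun u = combFun
    (fun x : Σ j : J, Fin (S j).m ⊕ Fin (S j).m =>
      a x.1 * Sum.elim (S x.1).a (fun i => - (S x.1).a i) x.2)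
    (fun x => Sum.elim (S x.1).t (S x.1).s x.2) u := fun u => congrFun e2 u
  rw [e1]
  simp only [e2']
  exact h

lemma eLpNorm_two_toReal_sq {α : Type*} [MeasurableSpace α] {μ : Measure α} {f : α → ℝ}
    (hf : MemLp f 2 μ) : (eLpNorm f 2 μ).toReal ^ 2 = ∫ x, f x ^ 2 ∂μ := by
  have h0 : 0 ≤ ∫ x, f x ^ 2 ∂μ := integral_nonneg fun _ => sq_nonneg _
  rw [hf.eLpNorm_eq_integral_rpow_norm (by norm_num) (by norm_num)]
  simp only [ENNReal.toReal_ofNat, Real.rpow_two, Real.norm_eq_abs, sq_abs]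
  rw [ENNReal.toReal_ofReal (by positivity), ← Real.rpow_natCast, ← Real.rpow_mul h0]
  norm_num

lemma tendsto_integral_sq {α : Type*} [MeasurableSpace α] {μ : Measure α} {f : α → ℝ}
    {F : ℕ → α → ℝ} (hf : MemLp f 2 μ) (hF : ∀ l, MemLp (F l) 2 μ)
    (h : Tendsto (fun l => eLpNorm (fun x => f x - F l x) 2 μ) atTop (𝓝 0)) :
    Tendsto (fun l => ∫ x, F l x ^ 2 ∂μ) atTop (𝓝 (∫ x, f x ^ 2 ∂μ)) := by
  have h1 : ∀ l, eLpNorm (F l) 2 μ ≤ eLpNorm f 2 μ + eLpNorm (fun x => f x - F l x) 2 μ := fun l => by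
    have := eLpNorm_sub_le hf.1 (hf.sub (hF l)).1 (p := 2) (by norm_num)
    rwa [sub_sub_cancel] at this
  have h2 : ∀ l, eLpNorm f 2 μ ≤ eLpNorm (F l) 2 μ + eLpNorm (fun x => f x - F l x) 2 μ := fun l => by
    have := eLpNorm_add_le (hF l).1 (hf.sub (hF l)).1 (p := 2) (by norm_num)
    rwa [add_sub_cancel] at this
  have h3 : Tendsto (fun l => eLpNorm (F l) 2 μ) atTop (𝓝 (eLpNorm f 2 μ)) := by
    refine tendsto_of_tendsto_of_tendsto_of_le_of_le
      (g := fun l => eLpNorm f 2 μ - eLpNorm (fun x => f x - F l x) 2 μ)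
      (h := fun l => eLpNorm f 2 μ + eLpNorm (fun x => f x - F l x) 2 μ) ?_ ?_
      (fun l => tsub_le_iff_right.2 (h2 l)) h1
    · simpa using ENNReal.Tendsto.sub (tendsto_const_nhds (x := eLpNorm f 2 μ)) h (Or.inl hf.2.ne)
    · simpa using (tendsto_const_nhds (x := eLpNorm f 2 μ)).add h
  have h4 := ((ENNReal.tendsto_toReal hf.2.ne).comp h3).pow 2
  rw [eLpNorm_two_toReal_sq hf] at h4
  exact h4.congr fun l => eLpNorm_two_toReal_sq (hF l)

lemma tendsto_eLpNorm_sum_sub {α J : Type*} [MeasurableSpace α] {μ : Measure α} [Fintype J]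
    (a : J → ℝ) {f : J → α → ℝ} {F : ℕ → J → α → ℝ} (hf : ∀ j, AEStronglyMeasurable (f j) μ)
    (hF : ∀ l j, AEStronglyMeasurable (F l j) μ)
    (h : ∀ j, Tendsto (fun l => eLpNorm (fun x => f j x - F l j x) 2 μ) atTop (𝓝 0)) :
    Tendsto (fun l => eLpNorm (fun x => ∑ j, a j * f j x - ∑ j, a j * F l j x) 2 μ) atTop (𝓝 0) := by
  have h1 : ∀ l, eLpNorm (fun x => ∑ j, a j * f j x - ∑ j, a j * F l j x) 2 μ ≤
      ∑ j, ‖a j‖ₑ * eLpNorm (fun x => f j x - F l j x) 2 μ := fun l => by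
    have e : (fun x => ∑ j, a j * f j x - ∑ j, a j * F l j x) =
        ∑ j, a j • fun x => f j x - F l j x := by
      ext x
      simp [Finset.sum_apply, ← Finset.sum_sub_distrib, mul_sub]
    rw [e]
    refine (eLpNorm_sum_le (fun j _ => ((hf j).sub (hF l j)).const_smul (a j)) (by norm_num)).trans ?_
    refine Finset.sum_le_sum fun j _ => ?_
    rw [eLpNorm_const_smul]
    rfl
  refine tendsto_of_tendsto_of_tendsto_of_le_of_le tendsto_const_nhds ?_ (fun _ => zero_le) h1
  have := tendsto_finsetSum (f := fun j l => ‖a j‖ₑ * eLpNorm (fun x => f j x - F l j x) 2 μ)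
    (x := atTop) (a := fun _ => 0) Finset.univ (fun j _ => by
      simpa using ENNReal.Tendsto.const_mul (h j) (Or.inr (by simp)))
  simpa using this

/-- Wiener integrals are jointly centred Gaussian, with the `L²([0,1])` inner product as
covariance. -/
lemma integral_exp_sum_wiener [IsProbabilityMeasure P] (hW : IsPreBrownianReal W P) {J : Type*}
    [Fintype J] (a : J → ℝ) {f : J → ℝ → ℝ} {X : J → Ω → ℝ} (hf : ∀ j, MemLp (f j) 2 unitVol)
    (hX : ∀ j, IsWienerIntegral P W (f j) (X j)) :
    ∫ ω, Complex.exp ((∑ j, a j * X j ω : ℝ) * Complex.I) ∂P =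
      Complex.exp (-((∫ u, (∑ j, a j * f j u) ^ 2 ∂unitVol : ℝ) : ℂ) / 2) := by
  choose hXm S hS hSX using hX
  have hstep : ∀ l j, MemLp (S j l).toFun 2 unitVol := fun l j => by
    rw [(step_eq_comb (W := W) (S j l)).1]; exact memLp_combFun _ _
  have hint : ∀ l j, AEStronglyMeasurable ((S j l).integral W) P := fun l j => by
    unfold Step.integral
    refine Finset.aestronglyMeasurable_fun_sum _ fun i _ => ?_
    exact (((hW.aemeasurable _).sub (hW.aemeasurable _)).const_mul _).aestronglyMeasurable
  have hlimF := tendsto_eLpNorm_sum_sub (μ := unitVol) a (F := fun l j => (S j l).toFun)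
    (fun j => (hf j).1) (fun l j => (hstep l j).1) hS
  have hlimX := tendsto_eLpNorm_sum_sub (μ := P) a (F := fun l j => (S j l).integral W)
    (fun j => (hXm j).aestronglyMeasurable) hint hSX
  have hvar := tendsto_integral_sq (memLp_finsetSum Finset.univ fun j _ => (hf j).const_mul (a j))
    (fun l => memLp_finsetSum Finset.univ fun j _ => (hstep l j).const_mul (a j)) hlimF
  have hYm : AEStronglyMeasurable (fun ω => ∑ j, a j * X j ω) P :=
    Finset.aestronglyMeasurable_fun_sum _ fun j _ => ((hXm j).const_mul _).aestronglyMeasurable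
  have hYlm : ∀ l, AEStronglyMeasurable (fun ω => ∑ j, a j * (S j l).integral W ω) P := fun l =>
    Finset.aestronglyMeasurable_fun_sum _ fun j _ => (hint l j).const_mul _
  -- L² convergence gives almost sure convergence along a subsequence; the characters are bounded by
  -- one, so dominated convergence carries the Gaussian characteristic function to the limit.
  have hmeas : TendstoInMeasure P (fun l ω => ∑ j, a j * (S j l).integral W ω) atTop
      (fun ω => ∑ j, a j * X j ω) := by
    refine tendstoInMeasure_of_tendsto_eLpNorm (p := 2) (by norm_num) hYlm hYm ?_
    refine hlimX.congr fun l => ?_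
    rw [← eLpNorm_neg]
    congr 1
    ext ω
    simp
  obtain ⟨ns, hns, hae⟩ := hmeas.exists_seq_tendsto_ae
  have hL : Tendsto (fun i => ∫ ω, Complex.exp
      ((∑ j, a j * (S j (ns i)).integral W ω : ℝ) * Complex.I) ∂P) atTop
      (𝓝 (∫ ω, Complex.exp ((∑ j, a j * X j ω : ℝ) * Complex.I) ∂P)) := by
    refine tendsto_integral_of_dominated_convergence (fun _ => 1) (fun i => ?_)
      (integrable_const 1) (fun i => ae_of_all _ fun ω => ?_) ?_
    · exact (by fun_prop : Continuous fun x : ℝ => Complex.exp (x * Complex.I)).comp_aestronglyMeasurable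
        (hYlm (ns i))
    · rw [Complex.norm_exp_ofReal_mul_I]
    · filter_upwards [hae] with ω hω
      exact ((by fun_prop : Continuous fun x : ℝ => Complex.exp (x * Complex.I)).tendsto _).comp hω
  have hval : ∀ l, ∫ ω, Complex.exp ((∑ j, a j * (S j l).integral W ω : ℝ) * Complex.I) ∂P =
      Complex.exp (-((∫ u, (∑ j, a j * (S j l).toFun u) ^ 2 ∂unitVol : ℝ) : ℂ) / 2) := fun l => by
    obtain ⟨hG, hmap⟩ := map_sum_step hW a (fun j => S j l)
    have hc := charFun_gaussianReal (μ := 0)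
      (v := (∫ u, (∑ j, a j * (S j l).toFun u) ^ 2 ∂unitVol).toNNReal) 1
    rw [← hmap, charFun_apply_real, integral_map hG.aemeasurable
      (Continuous.aestronglyMeasurable (by fun_prop))] at hc
    simp only [Complex.ofReal_one, one_mul, Complex.ofReal_zero, zero_mul, zero_sub, one_pow, mul_one]
      at hc
    rw [hc, Real.coe_toNNReal _ (integral_nonneg fun _ => sq_nonneg _), neg_div]
  simp only [hval] at hL
  have hR : Tendsto (fun i => Complex.exp (-((∫ u, (∑ j, a j * (S j (ns i)).toFun u) ^ 2 ∂unitVol : ℝ) : ℂ) / 2))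
      atTop (𝓝 (Complex.exp (-((∫ u, (∑ j, a j * f j u) ^ 2 ∂unitVol : ℝ) : ℂ) / 2))) :=
    ((by fun_prop : Continuous fun x : ℝ => Complex.exp (-(x : ℂ) / 2)).tendsto _).comp
      (hvar.comp hns.tendsto_atTop)
  exact tendsto_nhds_unique hL hR

end

end VolTest

/-! ### Grid increments as independent Gaussian variables, and detection of a strong local signal.
-/

namespace VolTest

noncomputable section

variable {Ω : Type*} [MeasurableSpace Ω] {P : Measure Ω} {W Z : ℝ≥0 → Ω → ℝ} {σ : ℝ → ℝ}

lemma IsVolatility.memLp (hσ : IsVolatility σ) : MemLp σ 2 unitVol := by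
  have hm : AEMeasurable σ unitVol :=
    aemeasurable_restrict_of_measurable_subtype measurableSet_Icc hσ.measurable
  exact (memLp_two_iff_integrable_sq hm.aestronglyMeasurable).2 hσ.sq_integrable

lemma IsVolatility.intervalIntegrable (hσ : IsVolatility σ) :
    IntervalIntegrable (fun t => σ t ^ 2) volume 0 1 :=
  (intervalIntegrable_iff_integrableOn_Icc_of_le zero_le_one).2 hσ.sq_integrable

lemma IsVolatility.cellInt_pos (hσ : IsVolatility σ) {n : ℕ} (hn : 1 ≤ n) (k : Fin n) :
    0 < cellInt n (fun t => σ t ^ 2) k := by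
  refine intervalIntegral.intervalIntegral_pos_of_pos_on
    (intervalIntegrable_cell hσ.intervalIntegrable k) (fun x hx => ?_) ?_
  · exact pow_pos (hσ.pos x (cell_subset k (Ioo_subset_Icc_self hx))) 2
  · have : (0 : ℝ) < n := by positivity
    gcongr
    linarith

lemma IsVolatility.normSq_pos (hσ : IsVolatility σ) : 0 < normSq σ :=
  intervalIntegral.intervalIntegral_pos_of_pos_on hσ.intervalIntegrable
    (fun x hx => pow_pos (hσ.pos x (Ioo_subset_Icc_self hx)) 2) one_pos

lemma cell_disjoint {n : ℕ} {k l : Fin n} (hkl : k ≠ l) (u : ℝ)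
    (hk : u ∈ Ioc ((k : ℕ) / n : ℝ) (((k : ℕ) + 1) / n)) :
    u ∉ Ioc ((l : ℕ) / n : ℝ) (((l : ℕ) + 1) / n) := by
  intro hl
  have hn : (0 : ℝ) < n := by have := k.pos; positivity
  rw [mem_Ioc, div_lt_iff₀ hn, le_div_iff₀ hn] at hk hl
  have h1 : (k : ℕ) < (l : ℕ) + 1 := by exact_mod_cast hk.1.trans_le hl.2
  have h2 : (l : ℕ) < (k : ℕ) + 1 := by exact_mod_cast hl.1.trans_le hk.2
  exact hkl (Fin.ext (by omega))

/-- Cross terms vanish because the cells are disjoint. This diagonal quadratic form is the source of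
the independence of the increments. -/
lemma integral_sq_sum_cells {n : ℕ} (hσ : MemLp σ 2 unitVol) (a : Fin n → ℝ) :
    ∫ u, (∑ k : Fin n, a k * (Ioc ((k : ℕ) / n : ℝ) (((k : ℕ) + 1) / n)).indicator σ u) ^ 2 ∂unitVol =
      ∑ k, a k ^ 2 * cellInt n (fun t => σ t ^ 2) k := by
  have h1 : ∀ u, (∑ k : Fin n, a k * (Ioc ((k : ℕ) / n : ℝ) (((k : ℕ) + 1) / n)).indicator σ u) ^ 2 =
      ∑ k : Fin n, a k ^ 2 *
        (Ioc ((k : ℕ) / n : ℝ) (((k : ℕ) + 1) / n)).indicator (fun t => σ t ^ 2) u := fun u => by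
    rw [pow_two, Finset.sum_mul_sum]
    refine Finset.sum_congr rfl fun k _ => ?_
    rw [Finset.sum_eq_single k]
    · by_cases h : u ∈ Ioc ((k : ℕ) / n : ℝ) (((k : ℕ) + 1) / n)
      · rw [indicator_of_mem h, indicator_of_mem h]; ring
      · rw [indicator_of_notMem h, indicator_of_notMem h]; ring
    · intro l _ hlk
      by_cases h : u ∈ Ioc ((k : ℕ) / n : ℝ) (((k : ℕ) + 1) / n)
      · rw [indicator_of_notMem (cell_disjoint hlk.symm u h)]; ring
      · rw [indicator_of_notMem h]; ring
    · simp
  simp only [h1]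
  have hi : Integrable (fun t => σ t ^ 2) unitVol := hσ.integrable_sq
  rw [integral_finsetSum _ fun k _ => (hi.indicator measurableSet_Ioc).const_mul _]
  refine Finset.sum_congr rfl fun k _ => ?_
  rw [integral_const_mul, integral_indicator measurableSet_Ioc,
    Measure.restrict_restrict measurableSet_Ioc,
    inter_eq_left.2 (Ioc_subset_Icc_self.trans (cell_subset k)), cellInt,
    intervalIntegral.integral_of_le (cell_le k)]

/-- The increments of a solution over the grid are independent centred Gaussian variables. -/
lemma exists_std_increments [IsProbabilityMeasure P] (hσ : IsVolatility σ)
    (hW : IsPreBrownianReal W P) {z₀ : ℝ} (hZ : IsSolution P W σ z₀ Z) {n : ℕ} (hn : 1 ≤ n) :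
    ∃ ξ : Ω → Fin n → ℝ, AEMeasurable ξ P ∧ P.map ξ = stdGauss n ∧ ∀ ω, ∀ k : Fin n,
      observe n Z ω k.succ - observe n Z ω k.castSucc =
        √(cellInt n (fun t => σ t ^ 2) k) * ξ ω k := by
  have hn0 : (0 : ℝ) < n := by positivity
  set v : Fin n → ℝ := fun k => cellInt n (fun t => σ t ^ 2) k
  have hv : ∀ k, 0 < v k := hσ.cellInt_pos hn
  set τ : ℕ → ℝ≥0 := fun k => (k : ℝ≥0) / n with hτ
  have hτ1 : ∀ k ≤ n, τ k ≤ 1 := fun k hk => by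
    refine div_le_one_of_le₀ ?_ zero_le
    exact_mod_cast hk
  have hw : ∀ k ≤ n, IsWienerIntegral P W ((Ioc (0 : ℝ) (τ k)).indicator σ)
    (fun ω => Z (τ k) ω - z₀) := fun k hk => hZ (τ k) (hτ1 k hk)
  set ξ : Ω → Fin n → ℝ := fun ω k => (√(v k))⁻¹ * (Z (τ (k + 1)) ω - Z (τ k) ω) with hξ
  have hξm : AEMeasurable ξ P := by
    refine aemeasurable_pi_lambda _ fun k => AEMeasurable.const_mul ?_ _
    have := (hw (k + 1) k.2).1.sub (hw k k.2.le).1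
    refine this.congr (ae_of_all _ fun ω => ?_)
    simp
  refine ⟨ξ, hξm, ?_, fun ω k => ?_⟩
  · have : IsProbabilityMeasure (P.map ξ) := Measure.isProbabilityMeasure_map hξm
    -- The product law is identified by its characteristic function, which checks normality and
    -- independence at once.
    refine charFun_eq_pi_iff.1 fun t => ?_
    have hmap : Measurable (WithLp.toLp 2 : (Fin n → ℝ) → PiLp 2 fun _ : Fin n => ℝ) :=
      WithLp.measurable_toLp 2 _
    rw [charFun_apply, integral_map hmap.aemeasurable
      (Continuous.aestronglyMeasurable (by fun_prop)), integral_map hξm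
      (by
        have : Continuous fun x : Fin n → ℝ => Complex.exp
            ((inner ℝ (WithLp.toLp 2 x : PiLp 2 fun _ : Fin n => ℝ) t : ℝ) * Complex.I) := by fun_prop
        exact this.aestronglyMeasurable)]
    -- The definition of a solution provides Wiener integrals over (0,τ] only. Each increment is a
    -- difference of two of them, whence the doubled index set.
    have key := integral_exp_sum_wiener hW (J := Fin n ⊕ Fin n)
      (Sum.elim (fun k => t k * (√(v k))⁻¹) fun k => -(t k * (√(v k))⁻¹))
      (f := Sum.elim (fun k => (Ioc (0 : ℝ) (τ (k + 1))).indicator σ)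
        fun k => (Ioc (0 : ℝ) (τ k)).indicator σ)
      (X := Sum.elim (fun k ω => Z (τ (k + 1)) ω - z₀) fun k ω => Z (τ k) ω - z₀)
      (by rintro (k | k) <;> exact hσ.memLp.indicator measurableSet_Ioc)
      (by rintro (k | k)
          · exact hw _ k.2
          · exact hw _ k.2.le)
    have e1 : ∀ ω, ((inner ℝ (WithLp.toLp 2 (ξ ω) : PiLp 2 fun _ : Fin n => ℝ) t : ℝ)) =
        ∑ j, Sum.elim (fun k => t k * (√(v k))⁻¹) (fun k => -(t k * (√(v k))⁻¹)) j *
          Sum.elim (fun (k : Fin n) ω => Z (τ (k + 1)) ω - z₀)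
            (fun (k : Fin n) ω => Z (τ k) ω - z₀) j ω := fun ω => by
      rw [PiLp.inner_apply, Fintype.sum_sum_type, ← Finset.sum_add_distrib]
      refine Finset.sum_congr rfl fun k _ => ?_
      simp only [hξ, Sum.elim_inl, Sum.elim_inr, RCLike.inner_apply, conj_trivial]
      ring
    have e2 : ∀ u, ∑ j, Sum.elim (fun k => t k * (√(v k))⁻¹) (fun k => -(t k * (√(v k))⁻¹)) j *
          Sum.elim (fun (k : Fin n) => (Ioc (0 : ℝ) (τ (k + 1))).indicator σ)
            (fun (k : Fin n) => (Ioc (0 : ℝ) (τ k)).indicator σ) j u =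
        ∑ k : Fin n, (t k * (√(v k))⁻¹) *
          (Ioc ((k : ℕ) / n : ℝ) (((k : ℕ) + 1) / n)).indicator σ u := fun u => by
      rw [Fintype.sum_sum_type, ← Finset.sum_add_distrib]
      refine Finset.sum_congr rfl fun k _ => ?_
      have c1 := cell_nonneg k
      have c2 := cell_le k
      simp only [Sum.elim_inl, Sum.elim_inr, hτ, indicator_apply, mem_Ioc]
      push_cast
      split_ifs <;> first | (exfalso; grind) | ring
    simp only [e1]
    rw [key]
    simp only [e2]
    rw [integral_sq_sum_cells hσ.memLp]
    simp only [charFun_gaussianReal]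
    rw [← Complex.exp_sum]
    congr 1
    have e3 : ∀ k, (t k * (√(v k))⁻¹) ^ 2 * cellInt n (fun t => σ t ^ 2) k = t k ^ 2 := fun k => by
      have : (√(v k))⁻¹ ^ 2 * v k = 1 := by
        rw [inv_pow, Real.sq_sqrt (hv k).le, inv_mul_cancel₀ (hv k).ne']
      calc _ = t k ^ 2 * ((√(v k))⁻¹ ^ 2 * v k) := by ring
        _ = t k ^ 2 := by rw [this, mul_one]
    simp only [e3]
    push_cast
    rw [neg_div, Finset.sum_div, ← Finset.sum_neg_distrib]
    refine Finset.sum_congr rfl fun k _ => ?_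
    ring
  · simp only [observe, hξ, hτ, Fin.val_succ, Fin.val_castSucc]
    rw [mul_inv_cancel_left₀ (by have := hv k; positivity)]

lemma IsVolatility.cellInt_ratio {n : ℕ} (σ : ℝ → ℝ) (k : Fin n) :
    cellInt n (ratio σ) k = cellInt n (fun t => σ t ^ 2) k / normSq σ := by
  simp only [cellInt, ratio]
  rw [intervalIntegral.integral_div]

lemma IsVolatility.sum_cellInt_ratio (hσ : IsVolatility σ) {n : ℕ} (hn : 1 ≤ n) :
    ∑ k : Fin n, n * cellInt n (ratio σ) k = n := by
  simp only [IsVolatility.cellInt_ratio]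
  rw [← Finset.mul_sum, ← Finset.sum_div, sum_cellInt hn hσ.intervalIntegrable]
  change (n : ℝ) * (normSq σ / normSq σ) = n
  rw [div_self hσ.normSq_pos.ne', mul_one]

lemma IsVolatility.intervalIntegrable_ratio (hσ : IsVolatility σ) :
    IntervalIntegrable (ratio σ) volume 0 1 := hσ.intervalIntegrable.div_const _

lemma IsVolatility.ratio_nonneg (hσ : IsVolatility σ) (t : ℝ) : 0 ≤ ratio σ t :=
  div_nonneg (sq_nonneg _) hσ.normSq_pos.le

lemma IsVolatility.abs_cellInt_ratio_le (hσ : IsVolatility σ) {n : ℕ} (hn : 1 ≤ n) {M : ℝ}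
    (hM : ∀ t ∈ Icc (0 : ℝ) 1, ratio σ t ≤ M) (k : Fin n) : |n * cellInt n (ratio σ) k| ≤ M := by
  have hn0 : (0 : ℝ) < n := by positivity
  have h := abs_cellInt_le (u := ratio σ) (B := M) k fun s hs => by
    rw [abs_of_nonneg (hσ.ratio_nonneg s)]
    exact hM s (cell_subset k hs)
  rw [abs_mul, Nat.abs_cast]
  calc n * |cellInt n (ratio σ) k| ≤ n * (M / n) := by gcongr
    _ = M := by field_simp

/-- A local signal that exceeds the correction by a constant is detected. -/
lemma exists_hasPower.{u} {ψ : ℝ → ℝ} {K : ℝ} (hψ : IsKernel ψ) (hK : IsScaleConstant ψ K) {α : ℝ}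
    (hα : 0 < α) (z₀ : ℝ) {M δ : ℝ} (hM : 0 ≤ M) (hδ : 0 < δ) :
    ∃ B : ℝ, ∀ᶠ n : ℕ in atTop, ∀ σ, IsVolatility σ → (∀ t ∈ Icc (0 : ℝ) 1, ratio σ t ≤ M) →
      ∀ p ∈ scales n K, corr n (2 * Real.log (1 / Lam ψ n p.1 p.2)) (Lam ψ n p.1 p.2) + B ≤
        |∑ k, weight ψ n p.1 p.2 k * (n * cellInt n (ratio σ) k - 1)| / (√2 * Lam ψ n p.1 p.2) →
      HasPower.{u} ψ K α z₀ n σ (1 - δ) := by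
  obtain ⟨κ, hκ0, hκ⟩ := exists_critValue_le hψ hK hα z₀
  obtain ⟨D, hD, hDw⟩ := exists_sum_weight_le hψ hK
  -- Two exceptional events are excluded, each of probability at most 2e^{-r}: a large local noise,
  -- and a poor estimate of the level.
  obtain ⟨r, hr, hrδ⟩ : ∃ r : ℝ, 1 ≤ r ∧ 4 * Real.exp (-r) ≤ δ := by
    have h : Tendsto (fun r : ℝ => 4 * Real.exp (-r)) atTop (𝓝 0) := by
      simpa using (Real.tendsto_exp_neg_atTop_nhds_zero).const_mul 4
    obtain ⟨r, h1, h2⟩ := ((eventually_ge_atTop 1).and (h.eventually (gt_mem_nhds hδ))).exists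
    exact ⟨r, h1, h2.le⟩
  refine ⟨4 * M * r * (1 + D) + κ + 2, ?_⟩
  filter_upwards [eventually_ge_atTop 1, hκ,
    eventually_div_sqrt_mul_log_le (8 * M * r) (1 + κ)] with n hn hκn hsmall
  intro σ hσ hσM p hp hsig Ω _ P _ W Z hW hZ
  obtain ⟨ξ, hξm, hξ, hξZ⟩ := exists_std_increments hσ hW.toIsPreBrownianReal hZ hn
  have hr0 : 0 ≤ r := zero_le_one.trans hr
  have hsn : 0 < √(n : ℝ) := by have : (0 : ℝ) < n := by positivity
                                positivity
  set θ : Fin n → ℝ := fun k => n * cellInt n (ratio σ) k with hθ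
  have hθM : ∀ k, |θ k| ≤ M := hσ.abs_cellInt_ratio_le hn hσM
  have hL := Lam_pos_of_scales hK hn hp
  have hu := one_le_sqrt_mul_Lam hK hn hp
  set B₁ := {x : Fin n → ℝ | 4 * M * r * Lam ψ n p.1 p.2 <
    |chiSum (fun k => weight ψ n p.1 p.2 k * θ k) x|} with hB₁
  set B₂ := {x : Fin n → ℝ | 4 * M * r / √n < |chiSum (fun k => θ k / n) x|} with hB₂
  have h1 : (stdGauss n).real B₁ ≤ 2 * Real.exp (-r) := by
    refine le_trans (measureReal_mono (ofPred_subset_ofPred.2 fun x h => lt_of_le_of_lt ?_ h))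
      (chiSum_tail _ (v := M * Lam ψ n p.1 p.2) (b := M * (1 / √n)) (by positivity) (by positivity)
        hr0 ?_ ?_)
    · have hsr : √r ≤ r := by rw [Real.sqrt_le_left hr0]; nlinarith
      have h2 : 1 / √n ≤ Lam ψ n p.1 p.2 := by rwa [div_le_iff₀ hsn, mul_comm]
      calc 2 * (M * Lam ψ n p.1 p.2) * √r + 2 * (M * (1 / √n)) * r
          ≤ 2 * (M * Lam ψ n p.1 p.2) * r + 2 * (M * Lam ψ n p.1 p.2) * r := by gcongr
        _ = _ := by ring
    · rw [mul_pow, Lam_sq, Finset.mul_sum]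
      refine Finset.sum_le_sum fun k _ => ?_
      rw [mul_pow, mul_comm]
      exact mul_le_mul_of_nonneg_right (sq_le_sq' (abs_le.1 (hθM k)).1 (abs_le.1 (hθM k)).2)
        (sq_nonneg _)
    · intro k
      rw [abs_mul, abs_of_nonneg (hψ.weight_nonneg _ _ _ _), mul_comm]
      exact mul_le_mul (hθM k) (hψ.weight_le _ _ _ _) (hψ.weight_nonneg _ _ _ _) hM
  have h2 : (stdGauss n).real B₂ ≤ 2 * Real.exp (-r) := chiSum_div_tail hn hM hr hθM
  have hBm : MeasurableSet (B₁ ∪ B₂) :=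
    (measurableSet_lt measurable_const (measurable_chiSum _).abs).union
      (measurableSet_lt measurable_const (measurable_chiSum _).abs)
  have h3 : 1 - δ ≤ (P.map ξ).real (B₁ ∪ B₂)ᶜ := by
    rw [hξ, probReal_compl_eq_one_sub hBm]
    linarith [measureReal_union_le (μ := stdGauss n) B₁ B₂]
  rw [measureReal_def, Measure.map_apply_of_aemeasurable hξm hBm.compl] at h3
  refine h3.trans (measureReal_mono fun ω hω => ?_)
  have hω1 : ξ ω ∉ B₁ := fun h => hω (Or.inl h)
  have hω2 : ξ ω ∉ B₂ := fun h => hω (Or.inr h)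
  have := critValue_lt_multiStat hψ hK (α := α) (z₀ := z₀) hκ0 hD hM hr hn hκn (hDw n hn) hsmall hp
    (hσ.sum_cellInt_ratio hn) (ξ := ξ ω) (z := observe n Z ω) hσ.normSq_pos (fun k => by
      have hv := hσ.cellInt_pos hn k
      have hN := hσ.normSq_pos
      rw [hξZ, mul_pow, Real.sq_sqrt hv.le, IsVolatility.cellInt_ratio]
      field_simp)
    (not_lt.1 hω1) (not_lt.1 hω2) hsig
  change test ψ K α z₀ n (observe n Z ω) = 1
  rw [test, indicator_of_mem (by exact this)]
  rfl

end

end VolTest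

namespace VolTest

noncomputable section

/-! ### Polynomial approximation in Hölder classes -/

/-- The polynomial `∑_{i ≤ d} c_i x^i`. -/
def polyFun (d : ℕ) (c : ℕ → ℝ) (x : ℝ) : ℝ := ∑ i ∈ Finset.range (d + 1), c i * x ^ i

lemma continuous_polyFun (d : ℕ) (c : ℕ → ℝ) : Continuous (polyFun d c) := by
  unfold polyFun; fun_prop

lemma polyFun_zero (d : ℕ) (c : ℕ → ℝ) : polyFun d c 0 = c 0 := by
  rw [polyFun, Finset.sum_range_succ']; simp

lemma hasDerivAt_polyFun (d : ℕ) (c : ℕ → ℝ) (x : ℝ) :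
    HasDerivAt (polyFun (d + 1) c) (polyFun d (fun i => (i + 1) * c (i + 1)) x) x := by
  have h : polyFun (d + 1) c =
      fun x => ∑ i ∈ Finset.range (d + 1), c (i + 1) * x ^ (i + 1) + c 0 := by
    ext x; rw [polyFun, Finset.sum_range_succ']; simp
  rw [h]
  refine HasDerivAt.add_const _ (HasDerivAt.fun_sum fun i _ => ?_)
  have := (hasDerivAt_pow (i + 1) x).const_mul (c (i + 1))
  exact this.congr_deriv (by push_cast; ring)

/-- Taylor approximation with Hölder remainder. -/
lemma exists_polyFun_approx {L e : ℝ} (hL : 0 ≤ L) (he : 0 < e) (t₀ : ℝ) (d : ℕ) : ∀ f : ℝ → ℝ,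
    ContDiff ℝ (d : ℕ∞) f →
    (∀ x y, |iteratedDeriv d f x - iteratedDeriv d f y| ≤ L * |x - y| ^ e) →
    ∃ c : ℕ → ℝ, c 0 = f t₀ ∧ ∀ s, |f s - polyFun d c (s - t₀)| ≤ L * |s - t₀| ^ (e + d) := by
  induction d with
  | zero =>
    intro f _ hf
    refine ⟨fun _ => f t₀, rfl, fun s => ?_⟩
    simpa [polyFun] using hf s t₀
  | succ d ih =>
    intro f hf hH
    have hd : ContDiff ℝ (d : ℕ∞) (deriv f) := by
      have : ContDiff ℝ ((d : WithTop ℕ∞) + 1) f := by exact_mod_cast hf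
      have := (contDiff_succ_iff_deriv.1 this).2.2
      exact_mod_cast this
    have hdiff : Differentiable ℝ f := by
      have : ContDiff ℝ ((d : WithTop ℕ∞) + 1) f := by exact_mod_cast hf
      exact (contDiff_succ_iff_deriv.1 this).1
    obtain ⟨c, -, hc⟩ := ih (deriv f) hd (fun x y => by
      simpa only [iteratedDeriv_succ'] using hH x y)
    -- Primitive of the polynomial approximating the derivative, with the value of f as constant
    -- term. The mean value inequality then raises the order of the remainder by one.
    set c' : ℕ → ℝ := fun i => if i = 0 then f t₀ else c (i - 1) / i with hc'
    refine ⟨c', by simp [hc'], fun s => ?_⟩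
    have hcc : polyFun d (fun i => ((i : ℝ) + 1) * c' (i + 1)) = polyFun d c := by
      ext x
      unfold polyFun
      refine Finset.sum_congr rfl fun i _ => ?_
      have : ((i : ℝ) + 1) ≠ 0 := by positivity
      simp only [hc', Nat.succ_ne_zero, if_false, Nat.add_sub_cancel]
      push_cast
      field_simp
    have hder : ∀ u, HasDerivAt (fun s => f s - polyFun (d + 1) c' (s - t₀))
        (deriv f u - polyFun d c (u - t₀)) u := fun u => by
      have h1 := hasDerivAt_polyFun d c' (u - t₀)
      rw [hcc] at h1
      exact (hdiff u).hasDerivAt.sub (h1.comp_sub_const u t₀)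
    have hmv := (convex_uIcc t₀ s).norm_image_sub_le_of_norm_hasDerivWithin_le
      (f := fun s => f s - polyFun (d + 1) c' (s - t₀))
      (C := L * |s - t₀| ^ (e + d)) (x := t₀) (y := s)
      (fun u _ => (hder u).hasDerivWithinAt) (fun u hu => by
        refine (hc u).trans ?_
        gcongr 1
        have : |u - t₀| ≤ |s - t₀| := abs_sub_left_of_mem_uIcc hu
        gcongr) left_mem_uIcc right_mem_uIcc
    simp only [sub_self, polyFun_zero, Real.norm_eq_abs] at hmv
    rw [show c' 0 = f t₀ by simp [hc'], sub_self, sub_zero] at hmv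
    refine hmv.trans (le_of_eq ?_)
    push_cast
    rcases eq_or_ne (|s - t₀|) 0 with h0 | h0
    · rw [h0, mul_zero, Real.zero_rpow (by positivity), mul_zero]
    · rw [← add_assoc, Real.rpow_add_one h0]; ring

/-- The coefficients of a polynomial are bounded by its supremum over `[0,1]`. -/
lemma exists_coeff_le (d : ℕ) : ∃ C : ℝ, 0 ≤ C ∧ ∀ (c : ℕ → ℝ) (A : ℝ),
    (∀ x ∈ Icc (0 : ℝ) 1, |polyFun d c x| ≤ A) → ∀ i ≤ d, |c i| ≤ C * A := by
  -- With d + 1 distinct nodes the Vandermonde matrix is invertible, so the coefficients are fixed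
  -- linear combinations of values on [0,1].
  set x : Fin (d + 1) → ℝ := fun j => (j : ℕ) / (d + 1) with hx
  have hinj : Function.Injective x := fun j k h => by
    have : ((d : ℝ) + 1) ≠ 0 := by positivity
    simp only [hx] at h
    rw [div_left_inj' this] at h
    exact Fin.ext (by exact_mod_cast h)
  have hxm : ∀ j, x j ∈ Icc (0 : ℝ) 1 := fun j => by
    refine ⟨by positivity, div_le_one_of_le₀ ?_ (by positivity)⟩
    exact_mod_cast j.2.le
  obtain ⟨U, hU⟩ : ∃ U : Matrix (Fin (d + 1)) (Fin (d + 1)) ℝ, U * Matrix.vandermonde x = 1 :=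
    ⟨_, Matrix.nonsing_inv_mul _
      (isUnit_iff_ne_zero.2 (Matrix.det_vandermonde_ne_zero_iff.2 hinj))⟩
  refine ⟨∑ i, ∑ j, |U i j|, by positivity, fun c A hA i hi => ?_⟩
  have hA0 : 0 ≤ A := (abs_nonneg _).trans (hA 0 (by simp))
  have hmul : (Matrix.vandermonde x).mulVec (fun i => c i) = fun j => polyFun d c (x j) := by
    ext j
    rw [polyFun, ← Fin.sum_univ_eq_sum_range (fun i => c i * x j ^ i)]
    simp only [Matrix.mulVec, dotProduct, Matrix.vandermonde_apply]
    exact Finset.sum_congr rfl fun i _ => mul_comm _ _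
  have hc : (fun i : Fin (d + 1) => c i) = U.mulVec fun j => polyFun d c (x j) := by
    rw [← hmul, Matrix.mulVec_mulVec, hU, Matrix.one_mulVec]
  obtain ⟨i', rfl⟩ : ∃ i' : Fin (d + 1), (i' : ℕ) = i := ⟨⟨i, Nat.lt_succ_of_le hi⟩, rfl⟩
  have hci : c i' = ∑ j, U i' j * polyFun d c (x j) := congrFun hc i'
  have h1 : |c i'| ≤ (∑ j, |U i' j|) * A := by
    rw [hci, Finset.sum_mul]
    refine (Finset.abs_sum_le_sum_abs _ _).trans (Finset.sum_le_sum fun j _ => ?_)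
    rw [abs_mul]
    exact mul_le_mul_of_nonneg_left (hA _ (hxm j)) (abs_nonneg _)
  exact h1.trans (mul_le_mul_of_nonneg_right
    (Finset.single_le_sum (f := fun i => ∑ j, |U i j|) (fun i _ => by positivity)
      (Finset.mem_univ i')) hA0)

/-- A Markov type inequality on `[0,1]`. -/
lemma exists_polyFun_lipschitz (d : ℕ) : ∃ C : ℝ, 1 ≤ C ∧ ∀ (c : ℕ → ℝ) (A : ℝ),
    (∀ x ∈ Icc (0 : ℝ) 1, |polyFun d c x| ≤ A) → ∀ x ∈ Icc (0 : ℝ) 1, ∀ y ∈ Icc (0 : ℝ) 1,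
      |polyFun d c x - polyFun d c y| ≤ C * A * |x - y| := by
  obtain ⟨C, hC, h⟩ := exists_coeff_le d
  refine ⟨1 + ∑ i ∈ Finset.range (d + 1), C * i, by
    have : 0 ≤ ∑ i ∈ Finset.range (d + 1), C * i := by positivity
    linarith, fun c A hA x hx y hy => ?_⟩
  have hA0 : 0 ≤ A := (abs_nonneg _).trans (hA 0 (by simp))
  have h1 : |polyFun d c x - polyFun d c y| ≤ ∑ i ∈ Finset.range (d + 1), C * i * A * |x - y| := by
    rw [polyFun, polyFun, ← Finset.sum_sub_distrib]
    refine (Finset.abs_sum_le_sum_abs _ _).trans (Finset.sum_le_sum fun i hi => ?_)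
    rw [← mul_sub, abs_mul]
    have h2 := abs_pow_sub_pow_le x y i
    have h3 : max |x| |y| ^ (i - 1) ≤ 1 := by
      refine pow_le_one₀ (by positivity) (max_le ?_ ?_)
      · rw [abs_of_nonneg hx.1]; exact hx.2
      · rw [abs_of_nonneg hy.1]; exact hy.2
    have h4 : |x ^ i - y ^ i| ≤ |x - y| * i :=
      h2.trans (mul_le_of_le_one_right (by positivity) h3)
    calc |c i| * |x ^ i - y ^ i| ≤ (C * A) * (|x - y| * i) := by
          gcongr
          exact h c A hA i (Nat.lt_succ_iff.1 (Finset.mem_range.1 hi))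
      _ = _ := by ring
  rw [← Finset.sum_mul, ← Finset.sum_mul] at h1
  refine h1.trans ?_
  gcongr
  linarith

/-- A polynomial is bounded on `[0,1]` by a multiple of the supremum of its primitive. -/
lemma exists_polyFun_le (d : ℕ) : ∃ C : ℝ, 0 ≤ C ∧ ∀ (c : ℕ → ℝ) (A : ℝ),
    (∀ x ∈ Icc (0 : ℝ) 1, |∫ s in (0 : ℝ)..x, polyFun d c s| ≤ A) →
      ∀ x ∈ Icc (0 : ℝ) 1, |polyFun d c x| ≤ C * A := by
  obtain ⟨C, hC, h⟩ := exists_coeff_le (d + 1)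
  refine ⟨∑ i ∈ Finset.range (d + 1), C * (i + 1), by positivity, fun c A hA x hx => ?_⟩
  -- Coefficients of the primitive vanishing at zero; bounding them bounds those of the polynomial.
  set c' : ℕ → ℝ := fun i => if i = 0 then 0 else c (i - 1) / i with hc'
  have hcc : polyFun d (fun i => ((i : ℝ) + 1) * c' (i + 1)) = polyFun d c := by
    ext x
    unfold polyFun
    refine Finset.sum_congr rfl fun i _ => ?_
    have : ((i : ℝ) + 1) ≠ 0 := by positivity
    simp only [hc', Nat.succ_ne_zero, if_false, Nat.add_sub_cancel]
    push_cast
    field_simp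
  have hint : ∀ x, ∫ s in (0 : ℝ)..x, polyFun d c s = polyFun (d + 1) c' x := fun x => by
    rw [intervalIntegral.integral_eq_sub_of_hasDerivAt (f := polyFun (d + 1) c')
      (fun u _ => by have := hasDerivAt_polyFun d c' u; rwa [hcc] at this)
      ((continuous_polyFun d c).intervalIntegrable _ _), polyFun_zero]
    simp [hc']
  simp only [hint] at hA
  have hA0 : 0 ≤ A := (abs_nonneg _).trans (hA 0 (by simp))
  rw [polyFun, Finset.sum_mul]
  refine (Finset.abs_sum_le_sum_abs _ _).trans (Finset.sum_le_sum fun i hi => ?_)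
  have h1 := h c' A hA (i + 1) (by have := Finset.mem_range.1 hi; omega)
  have hi0 : (0 : ℝ) < i + 1 := by positivity
  simp only [hc', Nat.succ_ne_zero, if_false, Nat.add_sub_cancel] at h1
  push_cast at h1
  rw [abs_div, abs_of_pos hi0, div_le_iff₀ hi0] at h1
  rw [abs_mul, abs_pow]
  have h2 : |x| ^ i ≤ 1 := pow_le_one₀ (abs_nonneg _) (by rw [abs_of_nonneg hx.1]; exact hx.2)
  calc |c i| * |x| ^ i ≤ |c i| := mul_le_of_le_one_right (abs_nonneg _) h2
    _ ≤ _ := h1.trans (le_of_eq (by ring))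

/-- The degree ⌈β⌉ - 1 is strictly smaller than β, so the Hölder exponent of the top derivative is
positive and adds up with the degree to β. -/
lemma exists_polyFun_approx_of_mem_holderClass {β L : ℝ} (hβ : 0 < β) (hL : 0 ≤ L) {g : ℝ → ℝ}
    (hg : g ∈ holderClass β L) (t₀ : ℝ) :
    ∃ c : ℕ → ℝ, c 0 = g t₀ ∧ ∀ s, |g s - polyFun (⌈β⌉₊ - 1) c (s - t₀)| ≤ L * |s - t₀| ^ β := by
  have hpos : 0 < ⌈β⌉₊ := Nat.ceil_pos.2 hβ
  have hlt : ((⌈β⌉₊ - 1 : ℕ) : ℝ) < β := Nat.lt_ceil.1 (by omega)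
  obtain ⟨h1, h2⟩ := hg
  obtain ⟨c, hc0, hc⟩ := exists_polyFun_approx hL (sub_pos.2 hlt) t₀ (⌈β⌉₊ - 1) g h1 h2
  refine ⟨c, hc0, fun s => ?_⟩
  have := hc s
  rwa [sub_add_cancel] at this

/-- Probability densities in a Hölder class are uniformly bounded. -/
lemma exists_density_le (β₂ L₂ : ℝ) (hL₂ : 0 ≤ L₂) : ∃ M : ℝ, 0 ≤ M ∧ ∀ β, 0 < β → β ≤ β₂ → ∀ L, 0 ≤ L → L ≤ L₂ →
    ∀ g ∈ holderClass β L, (∀ t ∈ Icc (0 : ℝ) 1, 0 ≤ g t) → ∫ t in (0 : ℝ)..1, g t = 1 →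
      ∀ t ∈ Icc (0 : ℝ) 1, g t ≤ M := by
  choose C hC hCb using exists_polyFun_le
  refine ⟨(∑ d ∈ Finset.range (⌈β₂⌉₊ + 1), C d) * (1 + L₂) + L₂, by
    have : 0 ≤ ∑ d ∈ Finset.range (⌈β₂⌉₊ + 1), C d := Finset.sum_nonneg fun d _ => hC d
    positivity, ?_⟩
  intro β hβ hβ₂ L hL hLL g hg hg0 hg1 t ht
  have hcont : Continuous g := hg.1.continuous
  obtain ⟨c, -, hc⟩ := exists_polyFun_approx_of_mem_holderClass hβ hL hg 0
  set d := ⌈β⌉₊ - 1 with hd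
  have happ : ∀ s ∈ Icc (0 : ℝ) 1, |g s - polyFun d c s| ≤ L := fun s hs => by
    have := hc s
    rw [sub_zero] at this
    refine this.trans (mul_le_of_le_one_right hL ?_)
    exact Real.rpow_le_one (abs_nonneg _) (by rw [abs_of_nonneg hs.1]; exact hs.2) hβ.le
  -- Being a density controls g only in L¹. This bounds the primitive of the Taylor polynomial, and
  -- finite dimensionality turns that into a uniform bound.
  have hpi : ∀ x ∈ Icc (0 : ℝ) 1, |∫ s in (0 : ℝ)..x, polyFun d c s| ≤ 1 + L := fun x hx => by
    calc |∫ s in (0 : ℝ)..x, polyFun d c s| ≤ ∫ s in (0 : ℝ)..x, |polyFun d c s| :=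
          intervalIntegral.abs_integral_le_integral_abs hx.1
      _ ≤ ∫ s in (0 : ℝ)..1, |polyFun d c s| :=
          intervalIntegral.integral_mono_interval le_rfl hx.1 hx.2
            (ae_of_all _ fun _ => abs_nonneg _)
            ((continuous_polyFun d c).abs.intervalIntegrable _ _)
      _ ≤ ∫ s in (0 : ℝ)..1, (g s + L) := by
          refine intervalIntegral.integral_mono_on zero_le_one
            ((continuous_polyFun d c).abs.intervalIntegrable _ _)
            ((hcont.add continuous_const).intervalIntegrable _ _) fun s hs => ?_
          have h1 := abs_le.1 (happ s hs)
          have h2 := hg0 s hs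
          rw [abs_le]
          constructor <;> linarith
      _ = 1 + L := by
          rw [intervalIntegral.integral_add (hcont.intervalIntegrable _ _) (by simp), hg1]
          simp
  have h1 := hCb d c (1 + L) hpi t ht
  have h2 := (abs_le.1 (happ t ht)).2
  have h3 : C d ≤ ∑ d ∈ Finset.range (⌈β₂⌉₊ + 1), C d :=
    Finset.single_le_sum (fun d _ => hC d) (Finset.mem_range.2 (by
      have := Nat.ceil_mono hβ₂
      omega))
  have h4 : C d * (1 + L) ≤ (∑ d ∈ Finset.range (⌈β₂⌉₊ + 1), C d) * (1 + L₂) := by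
    have := hC d
    gcongr
    exact this.trans h3
  linarith [le_abs_self (polyFun d c t)]

/-- A function that is close to a polynomial and large at a point is large, with constant sign, on a
subinterval of comparable length. -/
lemma exists_subinterval (d : ℕ) : ∃ C : ℝ, 1 ≤ C ∧ ∀ (f : ℝ → ℝ) (c : ℕ → ℝ) (t₀ h r : ℝ), 0 < h →
    0 < r → c 0 = f t₀ → r ≤ |f t₀| →
    (∀ s ∈ Icc t₀ (t₀ + h), |f s - polyFun d c (s - t₀)| ≤ r / 8) →
    ∃ t, t₀ ≤ t - 2 * (h / (8 * C)) ∧ t + 2 * (h / (8 * C)) ≤ t₀ + h ∧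
      ((∀ s ∈ Icc (t - 2 * (h / (8 * C))) (t + 2 * (h / (8 * C))), r / 4 ≤ f s) ∨
       (∀ s ∈ Icc (t - 2 * (h / (8 * C))) (t + 2 * (h / (8 * C))), f s ≤ -(r / 4))) := by
  obtain ⟨C, hC, hlip⟩ := exists_polyFun_lipschitz d
  refine ⟨C, hC, fun f c t₀ h r hh hr hc0 hrf happ => ?_⟩
  have hC0 : 0 < C := by linarith
  -- Rescaling to [0,1] makes the constant in the Markov inequality independent of h.
  set c' : ℕ → ℝ := fun i => c i * h ^ i with hc'
  have hscale : ∀ x, polyFun d c' x = polyFun d c (h * x) := fun x => by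
    unfold polyFun
    exact Finset.sum_congr rfl fun i _ => by rw [hc', mul_pow]; ring
  obtain ⟨x₀, hx₀, hmax⟩ := (isCompact_Icc (a := (0 : ℝ)) (b := 1)).exists_isMaxOn ⟨0, by simp⟩
    (continuous_polyFun d c').abs.continuousOn
  set A := |polyFun d c' x₀| with hA
  have hmax' : ∀ x ∈ Icc (0 : ℝ) 1, |polyFun d c' x| ≤ A := fun x hx => hmax hx
  have hrA : r ≤ A := by
    have := hmax' 0 (by simp)
    rw [polyFun_zero] at this
    simp only [hc', pow_zero, mul_one, hc0] at this
    linarith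
  have hA0 : 0 < A := by linarith
  have hclose : ∀ x ∈ Icc (0 : ℝ) 1, |x - x₀| ≤ 1 / (2 * C) →
      |polyFun d c' x - polyFun d c' x₀| ≤ A / 2 := fun x hx hxx => by
    refine (hlip c' A hmax' x hx x₀ hx₀).trans ?_
    calc C * A * |x - x₀| ≤ C * A * (1 / (2 * C)) := by gcongr
      _ = A / 2 := by field_simp
  have hCl : 1 / (2 * C) ≤ 1 / 2 := by
    rw [div_le_div_iff₀ (by positivity) (by norm_num)]; linarith
  have hCp : 0 < 1 / (2 * C) := by positivity
  -- The interval of length 1/(2C) is placed on the side of the maximizer x₀ that stays inside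
  -- [0,1]; the polynomial remains within A/2 of its extreme value there.
  obtain ⟨y, hy0, hy1, hyx⟩ : ∃ y, 0 ≤ y - 1 / (4 * C) ∧ y + 1 / (4 * C) ≤ 1 ∧
      ∀ x ∈ Icc (y - 1 / (4 * C)) (y + 1 / (4 * C)), |x - x₀| ≤ 1 / (2 * C) := by
    have e : 1 / (2 * C) = 1 / (4 * C) + 1 / (4 * C) := by field_simp; norm_num
    rcases le_total x₀ (1 / 2) with hx | hx
    · refine ⟨x₀ + 1 / (4 * C), by linarith [hx₀.1], by linarith, fun x hx => ?_⟩
      rw [abs_le]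
      constructor <;> linarith [hx.1, hx.2]
    · refine ⟨x₀ - 1 / (4 * C), by linarith, by linarith [hx₀.2], fun x hx => ?_⟩
      rw [abs_le]
      constructor <;> linarith [hx.1, hx.2]
  have e8 : 2 * (h / (8 * C)) = h * (1 / (4 * C)) := by field_simp; norm_num
  -- Since A ≥ r, a distance of at most A/2 + r/8 from a value of modulus A leaves at least 3r/8,
  -- with the sign of that value.
  have hval : ∀ s ∈ Icc (t₀ + h * y - h * (1 / (4 * C))) (t₀ + h * y + h * (1 / (4 * C))),
      |f s - polyFun d c' x₀| ≤ A / 2 + r / 8 := fun s hs => by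
    set x := (s - t₀) / h with hx
    have hsx : s - t₀ = h * x := by rw [hx]; field_simp
    have hx1 : x ∈ Icc (y - 1 / (4 * C)) (y + 1 / (4 * C)) := by
      constructor
      · rw [hx, le_div_iff₀ hh]; linarith [hs.1]
      · rw [hx, div_le_iff₀ hh]; linarith [hs.2]
    have hx2 : x ∈ Icc (0 : ℝ) 1 := ⟨by linarith [hx1.1], by linarith [hx1.2]⟩
    have h1 := hclose x hx2 (hyx x hx1)
    have h2 := happ s ⟨by nlinarith [hx2.1], by nlinarith [hx2.2]⟩
    rw [hsx, ← hscale] at h2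
    calc |f s - polyFun d c' x₀| ≤ |f s - polyFun d c' x| + |polyFun d c' x - polyFun d c' x₀| :=
          abs_sub_le _ _ _
      _ ≤ _ := by linarith
  refine ⟨t₀ + h * y, ?_, ?_, ?_⟩
  · rw [e8]; nlinarith
  · rw [e8]; nlinarith
  · rw [e8]
    rcases abs_cases (polyFun d c' x₀) with ⟨h1, h2⟩ | ⟨h1, h2⟩
    · refine Or.inl fun s hs => ?_
      linarith [(abs_le.1 (hval s hs)).1]
    · refine Or.inr fun s hs => ?_
      linarith [(abs_le.1 (hval s hs)).2]

end

end VolTest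

namespace VolTest

noncomputable section

/-! ### Rate adaptivity -/

variable {ψ σ : ℝ → ℝ}

/-- On [a,b] the density agrees with a continuous function, so the supremum in the distance is
attained. -/
lemma exists_le_abs_of_mem_alternatives {β L a b r : ℝ} (ha : 0 < a) (hab : a ≤ b) (hb : b < 1)
    (hσ : σ ∈ alternatives β L (Icc a b) r) : ∃ t ∈ Icc a b, r ≤ |ratio σ t - 1| := by
  obtain ⟨-, ⟨g, hg, hgσ⟩, hr⟩ := hσ
  have hsub : Icc a b ⊆ Icc 0 1 := Icc_subset_Icc ha.le hb.le
  have hcont : ContinuousOn (fun t => |ratio σ t - 1|) (Icc a b) :=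
    (((hg.1.continuous.continuousOn (s := Icc a b)).congr
      (hgσ.mono hsub)).sub continuousOn_const).abs
  obtain ⟨t, ht, hmax⟩ := isCompact_Icc.exists_isMaxOn (nonempty_Icc.2 hab) hcont
  have : Nonempty (Icc a b) := ⟨⟨t, ht⟩⟩
  exact ⟨t, ht, hr.trans (ciSup_le fun s => hmax s.2)⟩

/-- The volatility densities of a bounded range of Hölder classes are uniformly bounded. -/
lemma exists_ratio_le (β₂ L₂ : ℝ) (hL₂ : 0 ≤ L₂) : ∃ M : ℝ, 0 ≤ M ∧ ∀ β, 0 < β → β ≤ β₂ →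
    ∀ L, 0 ≤ L → L ≤ L₂ → ∀ J r, ∀ σ ∈ alternatives β L J r, ∀ t ∈ Icc (0 : ℝ) 1,
      ratio σ t ≤ M := by
  obtain ⟨M, hM, h⟩ := exists_density_le β₂ L₂ hL₂
  refine ⟨M, hM, fun β hβ hβ₂ L hL hLL J r σ hσ t ht => ?_⟩
  obtain ⟨hv, ⟨g, hg, hgσ⟩, -⟩ := hσ
  rw [hgσ ht]
  refine h β hβ hβ₂ L hL hLL g hg (fun s hs => hgσ hs ▸ hv.ratio_nonneg s) ?_ t ht
  have : ∫ t in (0 : ℝ)..1, g t = ∫ t in (0 : ℝ)..1, ratio σ t :=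
    intervalIntegral.integral_congr fun s hs => (hgσ (by rwa [uIcc_of_le zero_le_one] at hs)).symm
  rw [this]
  simp only [ratio]
  rw [intervalIntegral.integral_div]
  exact div_self hv.normSq_pos.ne'

lemma IsVolatility.cellInt_ratio_sub_one (hσ : IsVolatility σ) {n : ℕ} (k : Fin n) :
    n * cellInt n (fun s => ratio σ s - 1) k = n * cellInt n (ratio σ) k - 1 := by
  have hn : (n : ℝ) ≠ 0 := by have := k.pos; positivity
  have : cellInt n (fun s => ratio σ s - 1) k = cellInt n (ratio σ) k - 1 / n := by
    rw [← cellInt_const]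
    exact intervalIntegral.integral_sub (intervalIntegrable_cell hσ.intervalIntegrable_ratio k)
      (by simp)
  rw [this]; field_simp

/-- The signal of a deviation of constant sign. -/
lemma IsKernel.le_abs_sum_weight_mul (hψ : IsKernel ψ) (hσ : IsVolatility σ) {n : ℕ} (hn : 1 ≤ n)
    {t h r : ℝ} (hh : 0 < h) (hnh : 1 / n ≤ h) (hr : 0 ≤ r)
    (H : (∀ s ∈ Icc (t - 2 * h) (t + 2 * h), r ≤ ratio σ s - 1) ∨
      (∀ s ∈ Icc (t - 2 * h) (t + 2 * h), ratio σ s - 1 ≤ -r)) :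
    r * (√n * Lam ψ n t h ^ 2) ≤ |∑ k, weight ψ n t h k * (n * cellInt n (ratio σ) k - 1)| := by
  have hn0 : (0 : ℝ) < n := by positivity
  have hsn : 0 < √(n : ℝ) := by positivity
  have hint : IntervalIntegrable (fun s => ratio σ s - 1) volume 0 1 :=
    hσ.intervalIntegrable_ratio.sub (by simp)
  -- From 0 ≤ λ_k ≤ n^{-1/2} follows √n λ_k² ≤ λ_k. The signal is thereby compared directly with Λ².
  have hw : √n * Lam ψ n t h ^ 2 ≤ ∑ k, weight ψ n t h k := by
    rw [Lam_sq, Finset.mul_sum]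
    refine Finset.sum_le_sum fun k _ => ?_
    have h1 := hψ.weight_le n t h k
    rw [le_div_iff₀ hsn] at h1
    nlinarith [hψ.weight_nonneg n t h k]
  -- A cell with nonzero weight meets [t-h, t+h] and has length at most h. This is the reason for
  -- the doubled interval in the sign condition.
  have hcell : ∀ k : Fin n, weight ψ n t h k ≠ 0 →
      Icc ((k : ℕ) / n : ℝ) (((k : ℕ) + 1) / n) ⊆ Icc (t - 2 * h) (t + 2 * h) := fun k hk => by
    obtain ⟨s, hs, hst⟩ : ∃ s ∈ Icc ((k : ℕ) / n : ℝ) (((k : ℕ) + 1) / n), |s - t| ≤ h := by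
      by_contra! hcon
      refine hk ?_
      have := abs_cellInt_le (u := rescale ψ t h) (B := 0) k fun s hs => by
        rw [hψ.rescale_eq_zero hh (hcon s hs), abs_zero]
      rw [weight_eq, abs_nonpos_iff.1 (this.trans (by simp)), mul_zero]
    intro u hu
    have hl := cell_length k
    have := abs_le.1 hst
    constructor <;> linarith [hs.1, hs.2, hu.1, hu.2, this.1, this.2]
  have hsum : r * (√n * Lam ψ n t h ^ 2) ≤ r * ∑ k, weight ψ n t h k := by gcongr
  refine hsum.trans ?_
  rw [Finset.mul_sum]
  simp only [← hσ.cellInt_ratio_sub_one]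
  rcases H with H | H
  · refine le_trans (Finset.sum_le_sum fun k _ => ?_) (le_abs_self _)
    rcases eq_or_ne (weight ψ n t h k) 0 with h0 | h0
    · simp [h0]
    rw [mul_comm]
    refine mul_le_mul_of_nonneg_left ?_ (hψ.weight_nonneg n t h k)
    have := cellInt_mono (u := fun _ => r) (by simp) hint k fun s hs => H s (hcell k h0 hs)
    rw [cellInt_const, div_le_iff₀ hn0] at this
    linarith
  · refine le_trans ?_ (neg_le_abs _)
    rw [← Finset.sum_neg_distrib]
    refine Finset.sum_le_sum fun k _ => ?_
    rcases eq_or_ne (weight ψ n t h k) 0 with h0 | h0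
    · simp [h0]
    rw [mul_comm, ← mul_neg]
    refine mul_le_mul_of_nonneg_left ?_ (hψ.weight_nonneg n t h k)
    have := cellInt_mono (v := fun _ => -r) hint (by simp) k fun s hs => H s (hcell k h0 hs)
    rw [cellInt_const, le_div_iff₀ hn0] at this
    linarith

/-! ### Asymptotics of the rate and of the bandwidth. -/

lemma tendsto_log_div_self : Tendsto (fun n : ℕ => Real.log n / n) atTop (𝓝 0) := by
  have := (isLittleO_log_rpow_atTop (r := 1) one_pos).tendsto_div_nhds_zero
  simp only [Real.rpow_one] at this
  exact this.comp tendsto_natCast_atTop_atTop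

lemma tendsto_log_natCast : Tendsto (fun n : ℕ => Real.log n) atTop atTop :=
  Real.tendsto_log_atTop.comp tendsto_natCast_atTop_atTop

/-- Once log n ≥ 1 the right-hand side is at least n^{1-q}. With h of order at least (log n/n)^q it
makes nh exceed every multiple of 1 + log² n, so the linear part of the correction is bounded. -/
lemma eventually_log_sq_le {q : ℝ} (hq0 : 0 ≤ q) (hq1 : q < 1) (A : ℝ) :
    ∀ᶠ n : ℕ in atTop, A * (1 + Real.log n ^ 2) ≤ n * (Real.log n / n) ^ q := by
  have h1 := (isLittleO_log_rpow_atTop (r := (1 - q) / 2)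
    (by linarith)).tendsto_div_nhds_zero.comp tendsto_natCast_atTop_atTop
  have h2 : ∀ᶠ n : ℕ in atTop, Real.log n / (n : ℝ) ^ ((1 - q) / 2) < 1 / (1 + 2 * |A|) :=
    h1.eventually (gt_mem_nhds (by positivity))
  filter_upwards [h2, tendsto_log_natCast.eventually_ge_atTop 1, eventually_ge_atTop 1] with n h hl hn
  have hn0 : (0 : ℝ) < n := by positivity
  have hp : 0 < (n : ℝ) ^ ((1 - q) / 2) := by positivity
  rw [div_lt_div_iff₀ hp (by positivity), one_mul] at h
  have hsq : (n : ℝ) ^ (1 - q) = ((n : ℝ) ^ ((1 - q) / 2)) ^ 2 := by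
    rw [← Real.rpow_natCast, ← Real.rpow_mul hn0.le]; congr 1; push_cast; ring
  have h3 : (n : ℝ) ^ (1 - q) ≤ n * (Real.log n / n) ^ q := by
    rw [Real.rpow_sub hn0, Real.rpow_one, Real.div_rpow (by linarith) hn0.le, ← mul_div_assoc]
    gcongr
    exact le_mul_of_one_le_right hn0.le (Real.one_le_rpow hl hq0)
  refine le_trans ?_ h3
  rw [hsq]
  have h4 : (Real.log n * (1 + 2 * |A|)) ^ 2 ≤ ((n : ℝ) ^ ((1 - q) / 2)) ^ 2 := by
    gcongr
  have h5 : A ≤ |A| := le_abs_self A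
  have h6 : 0 ≤ |A| := abs_nonneg A
  have h7 : 1 ≤ Real.log n ^ 2 := by nlinarith
  calc A * (1 + Real.log n ^ 2) ≤ |A| * (1 + Real.log n ^ 2) := by gcongr
    _ ≤ |A| * (2 * Real.log n ^ 2) := by gcongr; linarith
    _ ≤ (Real.log n * (1 + 2 * |A|)) ^ 2 := by nlinarith [sq_nonneg (|A| * Real.log n)]
    _ ≤ _ := h4

lemma rate_pos {β : ℝ} {n : ℕ} (hl : 0 < Real.log n) : 0 < rate β n := by
  have : (n : ℝ) ≠ 0 := fun h => by simp [h] at hl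
  have : (0 : ℝ) < n := lt_of_le_of_ne (by positivity) this.symm
  unfold rate; positivity

lemma rate_rpow_inv {β : ℝ} (hβ : 0 < β) {n : ℕ} :
    rate β n ^ (1 / β) = (Real.log n / n) ^ (1 / (2 * β + 1)) := by
  rw [rate, ← Real.rpow_mul (by positivity)]
  congr 1
  field_simp

/-- The balance that defines the rate: n r² h with r = ρ_n and h = ρ_n^{1/β} is exactly log n. -/
lemma rate_sq_mul {β : ℝ} (hβ : 0 < β) {n : ℕ} (hn : 1 ≤ n) (hl : 0 < Real.log n) :
    n * (rate β n ^ 2 * rate β n ^ (1 / β)) = Real.log n := by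
  have hn0 : (0 : ℝ) < n := by positivity
  have hx : 0 < Real.log n / n := by positivity
  rw [rate_rpow_inv hβ, rate, ← Real.rpow_natCast, ← Real.rpow_mul hx.le, ← Real.rpow_add hx]
  rw [show β / (2 * β + 1) * (2 : ℕ) + 1 / (2 * β + 1) = 1 by push_cast; field_simp, Real.rpow_one]
  field_simp

/-- The correction at large scales. -/
lemma corr_le_sqrt_add_one {K : ℝ} (hψ : IsKernel ψ) (hK : IsScaleConstant ψ K) {n : ℕ} (hn : 1 ≤ n)
    {p : ℝ × ℝ} (hp : p ∈ scales n K) (h : (2 * Real.log n) ^ 2 ≤ n * Lam ψ n p.1 p.2 ^ 2) :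
    corr n (2 * Real.log (1 / Lam ψ n p.1 p.2)) (Lam ψ n p.1 p.2) ≤
      √(2 * (2 * Real.log (1 / Lam ψ n p.1 p.2))) + 1 := by
  obtain ⟨h0, h1⟩ := log_inv_Lam_bounds hψ hK hn hp
  have hL := Lam_nonneg ψ n p.1 p.2
  have h2 : 2 * Real.log n ≤ √n * Lam ψ n p.1 p.2 := by
    refine (le_abs_self _).trans (abs_le_of_sq_le_sq ?_ (by positivity))
    rwa [mul_pow (√(n : ℝ)), Real.sq_sqrt (by positivity)]
  rw [corr]
  gcongr
  refine div_le_one_of_le₀ ?_ (by positivity)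
  exact le_trans (by linarith) (le_max_right _ _)

/-- The bandwidth `h = (r/8L)^{1/β}` at the detection boundary `r = cρ_n(β)`. -/
lemma bandwidth_ge {β L c r : ℝ} (hβ : 0 < β) (hL : 0 < L) (hc : 8 * L ≤ c) {n : ℕ} (hn : 1 ≤ n)
    (hl : 0 < Real.log n) (hr : r = c * rate β n) :
    (Real.log n / n) ^ (1 / (2 * β + 1)) ≤ (r / (8 * L)) ^ (1 / β) ∧
      c ^ 2 * Real.log n ≤ n * (r ^ 2 * (r / (8 * L)) ^ (1 / β)) := by
  have hρ := rate_pos (β := β) hl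
  have h1 : rate β n ^ (1 / β) ≤ (r / (8 * L)) ^ (1 / β) := by
    refine Real.rpow_le_rpow hρ.le ?_ (by positivity)
    rw [le_div_iff₀ (by positivity), hr]
    nlinarith
  refine ⟨by rwa [rate_rpow_inv hβ] at h1, ?_⟩
  rw [← rate_sq_mul hβ hn hl]
  calc c ^ 2 * (n * (rate β n ^ 2 * rate β n ^ (1 / β)))
      = n * ((c * rate β n) ^ 2 * rate β n ^ (1 / β)) := by ring
    _ ≤ n * (r ^ 2 * (r / (8 * L)) ^ (1 / β)) := by rw [← hr]; gcongr

/-- Uniformity in β comes from the extreme exponents: β/(2β+1) increases in β, so the rate is worst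
at β₁, and τ^β with τ ≤ 1 is smallest at β₂. -/
lemma eventually_bandwidth_le {β₁ β₂ L₁ M τ : ℝ} (hβ₁ : 0 < β₁) (hL₁ : 0 < L₁)
    (hM : 0 ≤ M) (hτ : 0 < τ) (hτ1 : τ ≤ 1) : ∀ᶠ n : ℕ in atTop, ∀ β ∈ Icc β₁ β₂, ∀ L, L₁ ≤ L →
      ∀ r, 0 ≤ r → r ≤ M * rate β n → (r / L) ^ (1 / β) ≤ τ := by
  have he : 0 < β₁ / (2 * β₁ + 1) := by positivity
  have h1 : Tendsto (fun n : ℕ => M * (Real.log n / n) ^ (β₁ / (2 * β₁ + 1))) atTop (𝓝 0) := by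
    have := (tendsto_log_div_self.rpow_const (Or.inr he.le)).const_mul M
    rwa [Real.zero_rpow he.ne', mul_zero] at this
  filter_upwards [h1.eventually (gt_mem_nhds (show 0 < L₁ * τ ^ β₂ by positivity)),
    tendsto_log_div_self.eventually (gt_mem_nhds one_pos), eventually_ge_atTop 2]
    with n hn hx hn2 β hβ L hL r hr0 hr
  have hβ0 : 0 < β := hβ₁.trans_le hβ.1
  have hL0 : 0 < L := hL₁.trans_le hL
  have hlog : 0 < Real.log n := Real.log_pos (by exact_mod_cast hn2)
  have hn0 : (0 : ℝ) < n := by positivity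
  have hx0 : 0 < Real.log n / n := by positivity
  have h2 : rate β n ≤ (Real.log n / n) ^ (β₁ / (2 * β₁ + 1)) := by
    refine Real.rpow_le_rpow_of_exponent_ge hx0 hx.le ?_
    rw [div_le_div_iff₀ (by positivity) (by positivity)]
    nlinarith [hβ.1]
  have h3 : r / L ≤ τ ^ β := by
    rw [div_le_iff₀ hL0]
    calc r ≤ M * rate β n := hr
      _ ≤ M * (Real.log n / n) ^ (β₁ / (2 * β₁ + 1)) := by gcongr
      _ ≤ L₁ * τ ^ β₂ := hn.le
      _ ≤ L * τ ^ β :=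
        mul_le_mul hL (Real.rpow_le_rpow_of_exponent_ge hτ hτ1 hβ.2) (by positivity) hL0.le
      _ = τ ^ β * L := mul_comm _ _
  calc (r / L) ^ (1 / β) ≤ (τ ^ β) ^ (1 / β) := Real.rpow_le_rpow (by positivity) h3 (by positivity)
    _ = τ := by rw [← Real.rpow_mul hτ.le, mul_one_div_cancel hβ0.ne', Real.rpow_one]

/-- The signal-to-noise ratio at the detection boundary. -/
lemma two_mul_sqrt_le_signal {l c c₁ C N r h Λ : ℝ} (hl : 0 ≤ l) (hc₁ : 0 < c₁) (hC : 1 ≤ C)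
    (hr : 0 ≤ r) (hN : 0 ≤ N) (hΛ : 0 < Λ) (hc : 1 + 2048 * C / c₁ ≤ c)
    (h1 : c ^ 2 * l ≤ N * (r ^ 2 * h)) (h2 : c₁ * (h / (8 * C)) ≤ Λ ^ 2) :
    2 * √(2 * l) ≤ r / 4 * (√N * Λ ^ 2) / (√2 * Λ) := by
  have hC0 : 0 < C := by linarith
  have e : r / 4 * (√N * Λ ^ 2) / (√2 * Λ) = r / 4 * √N * Λ / √2 := by field_simp
  rw [e]
  refine (le_abs_self _).trans (abs_le_of_sq_le_sq ?_ (by positivity))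
  have e1 : (2 * √(2 * l)) ^ 2 = 8 * l := by rw [mul_pow, Real.sq_sqrt (by positivity)]; ring
  have e2 : (r / 4 * √N * Λ / √2) ^ 2 = N * r ^ 2 * Λ ^ 2 / 32 := by
    rw [div_pow, mul_pow, mul_pow, Real.sq_sqrt hN, Real.sq_sqrt (by norm_num)]; ring
  rw [e1, e2]
  have hq : 0 ≤ 2048 * C / c₁ := by positivity
  have h3 : 2048 * C / c₁ ≤ c ^ 2 := by nlinarith
  have h4 : 2048 * C * l ≤ c₁ * (N * (r ^ 2 * h)) := by
    rw [div_le_iff₀ hc₁] at h3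
    calc 2048 * C * l ≤ c ^ 2 * c₁ * l := by gcongr
      _ = c₁ * (c ^ 2 * l) := by ring
      _ ≤ _ := by gcongr
  have h5 : c₁ * h ≤ Λ ^ 2 * (8 * C) := by
    rw [mul_div_assoc', div_le_iff₀ (by positivity)] at h2
    exact h2
  have h6 : N * r ^ 2 * (c₁ * h) ≤ N * r ^ 2 * (Λ ^ 2 * (8 * C)) := by gcongr
  have h7 : C * (256 * l) ≤ C * (N * r ^ 2 * Λ ^ 2) := by nlinarith
  have := le_of_mul_le_mul_left h7 hC0
  linarith

/-- A volatility density in a Hölder class that deviates from one by `r` at `t₀` deviates by `r/4`,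
with constant sign, on an interval of length comparable to `h = (r/8L)^{1/β}`. -/
lemma exists_ratio_deviation : ∃ C : ℕ → ℝ, (∀ d, 1 ≤ C d) ∧ ∀ (β L t₀ h r : ℝ) (σ g : ℝ → ℝ),
    0 < β → 0 < L → 0 < h → 0 < r → g ∈ holderClass β L → EqOn (ratio σ) g (Icc 0 1) →
    0 ≤ t₀ → t₀ + h ≤ 1 → r ≤ |ratio σ t₀ - 1| → L * h ^ β = r / 8 →
    ∃ t, t₀ ≤ t - 2 * (h / (8 * C (⌈β⌉₊ - 1))) ∧ t + 2 * (h / (8 * C (⌈β⌉₊ - 1))) ≤ t₀ + h ∧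
      ((∀ s ∈ Icc (t - 2 * (h / (8 * C (⌈β⌉₊ - 1)))) (t + 2 * (h / (8 * C (⌈β⌉₊ - 1)))),
        r / 4 ≤ ratio σ s - 1) ∨
       (∀ s ∈ Icc (t - 2 * (h / (8 * C (⌈β⌉₊ - 1)))) (t + 2 * (h / (8 * C (⌈β⌉₊ - 1)))),
        ratio σ s - 1 ≤ -(r / 4))) := by
  choose C hC1 hC using exists_subinterval
  refine ⟨C, hC1, fun β L t₀ h r σ g hβ hL hh hr hg hgσ ht0 ht1 hrt hhβ => ?_⟩
  have hsub : Icc t₀ (t₀ + h) ⊆ Icc 0 1 := Icc_subset_Icc ht0 ht1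
  have ht₀1 : t₀ ∈ Icc (0 : ℝ) 1 := hsub ⟨le_rfl, by linarith⟩
  obtain ⟨w, hw0, hw⟩ := exists_polyFun_approx_of_mem_holderClass hβ hL.le hg t₀
  -- Lowering the constant coefficient by one turns the approximation of the density into one of its
  -- deviation from one.
  have hww : ∀ x, polyFun (⌈β⌉₊ - 1) (fun i => if i = 0 then w 0 - 1 else w i) x =
      polyFun (⌈β⌉₊ - 1) w x - 1 := fun x => by
    simp only [polyFun]
    rw [Finset.sum_range_succ', Finset.sum_range_succ']
    simp
    ring
  refine hC (⌈β⌉₊ - 1) (fun s => ratio σ s - 1) (fun i => if i = 0 then w 0 - 1 else w i) t₀ h r hh hr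
    (by simp [hw0, hgσ ht₀1]) hrt (fun s hs => ?_)
  rw [hww, hgσ (hsub hs)]
  calc |g s - 1 - (polyFun (⌈β⌉₊ - 1) w (s - t₀) - 1)| =
        |g s - polyFun (⌈β⌉₊ - 1) w (s - t₀)| := by congr 1; ring
    _ ≤ L * |s - t₀| ^ β := hw s
    _ ≤ L * h ^ β := by
        gcongr
        rw [abs_of_nonneg (by linarith [hs.1])]
        linarith [hs.2]
    _ = r / 8 := hhβ

/-- A deviation at the detection boundary exceeds the correction by any given constant. -/
lemma corr_add_le_signal {K B c₁ t h r : ℝ} (hψ : IsKernel ψ) (hK : IsScaleConstant ψ K)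
    (hσ : IsVolatility σ) {n : ℕ} (hn : 1 ≤ n) (hc₁ : 0 < c₁) (hr : 0 < r)
    (hp : (t, h) ∈ scales n K) (hΛ : c₁ * h ≤ Lam ψ n t h ^ 2)
    (hnh : (1 + 4 / c₁) * (1 + Real.log n ^ 2) ≤ n * h)
    (hB : 1 + |B| ≤ √(2 * Real.log n))
    (hsn : 2 * √(2 * Real.log n) ≤ r / 4 * (√n * Lam ψ n t h ^ 2) / (√2 * Lam ψ n t h))
    (H : (∀ s ∈ Icc (t - 2 * h) (t + 2 * h), r / 4 ≤ ratio σ s - 1) ∨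
      (∀ s ∈ Icc (t - 2 * h) (t + 2 * h), ratio σ s - 1 ≤ -(r / 4))) :
    corr n (2 * Real.log (1 / Lam ψ n t h)) (Lam ψ n t h) + B ≤
      |∑ k, weight ψ n t h k * (n * cellInt n (ratio σ) k - 1)| / (√2 * Lam ψ n t h) := by
  have hn0 : (0 : ℝ) < n := Nat.cast_pos.2 hn
  have hL : 0 < √2 * Lam ψ n t h := mul_pos (Real.sqrt_pos.2 two_pos) (Lam_pos_of_scales (p := (t, h)) hK hn hp)
  have hη : 2 * Real.log (1 / Lam ψ n t h) ≤ Real.log n := (log_inv_Lam_bounds (p := (t, h)) hψ hK hn hp).2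
  have hc4 : 0 < 4 / c₁ := div_pos four_pos hc₁
  have hl2 : 0 ≤ Real.log n ^ 2 := sq_nonneg _
  have hprod := mul_nonneg hc4.le hl2
  have hnh1 : 1 / n ≤ h := by
    rw [div_le_iff₀ hn0]; linarith only [hnh, hprod, hc4, hl2]
  have hh0 : 0 < h := lt_of_lt_of_le (one_div_pos.2 hn0) hnh1
  have hsig := hψ.le_abs_sum_weight_mul (r := r / 4) hσ hn hh0 hnh1 (div_pos hr four_pos).le H
  have hlarge : (2 * Real.log n) ^ 2 ≤ n * Lam ψ n t h ^ 2 := by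
    have h1 : (2 * Real.log n) ^ 2 = c₁ * (4 / c₁ * Real.log n ^ 2) := by
      field_simp; ring
    have h2 : c₁ * (4 / c₁ * Real.log n ^ 2) ≤ c₁ * (n * h) :=
      mul_le_mul_of_nonneg_left (by linarith only [hnh, hprod, hc4, hl2]) hc₁.le
    have h3 := mul_le_mul_of_nonneg_left hΛ hn0.le
    linarith only [h1, h2, h3]
  have hcorr : corr n (2 * Real.log (1 / Lam ψ n t h)) (Lam ψ n t h) ≤
      √(2 * (2 * Real.log (1 / Lam ψ n t h))) + 1 := corr_le_sqrt_add_one (p := (t, h)) hψ hK hn hp hlarge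
  have hsq : √(2 * (2 * Real.log (1 / Lam ψ n t h))) ≤ √(2 * Real.log n) :=
    Real.sqrt_le_sqrt (by linarith only [hη])
  -- The signal is worth 2√(2 log n). One copy covers the root in the correction, as 2 log(1/Λ) ≤
  -- log n; the other covers 1 + |B|.
  have hfin := hsn.trans (div_le_div_of_nonneg_right hsig hL.le)
  linarith only [hfin, hcorr, hsq, hB, le_abs_self B]

/-- The polynomial constant depends on β only through the degree, which takes finitely many values
for β ≤ β₂. -/
lemma exists_rateConst_le {C : ℕ → ℝ} (hC : ∀ d, 1 ≤ C d) {c₁ : ℝ} (hc₁ : 0 < c₁) (β₂ L₂ : ℝ) :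
    ∃ M, ∀ β, β ≤ β₂ → ∀ L, 0 < L → L ≤ L₂ →
      (1 + 2048 * C (⌈β⌉₊ - 1) / c₁) * (1 + 8 * L) ≤ M ∧ C (⌈β⌉₊ - 1) ≤ M := by
  have hC0 : ∀ d, 0 < C d := fun d => by linarith [hC d]
  obtain ⟨S, hS⟩ : ∃ S, ∀ β, β ≤ β₂ → C (⌈β⌉₊ - 1) ≤ S :=
    ⟨∑ d ∈ Finset.range (⌈β₂⌉₊ + 1), C d, fun β hβ =>
      Finset.single_le_sum (fun d _ => (hC0 d).le) (Finset.mem_range.2 (by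
        have := Nat.ceil_mono hβ
        omega))⟩
  refine ⟨max ((1 + 2048 * S / c₁) * (1 + 8 * L₂)) S, fun β hβ L hL hLL =>
    ⟨le_max_of_le_left ?_, le_max_of_le_right (hS β hβ)⟩⟩
  have h0 := hC0 (⌈β⌉₊ - 1)
  have h1 := hS β hβ
  have h2 := h0.trans_le h1
  refine mul_le_mul ?_ (by linarith) (by positivity) (by positivity)
  gcongr

/-- Uniform power over Hölder alternatives at the minimax rate. -/
lemma exists_rate_adaptive.{u} (hψ : IsKernel ψ) :
    ∃ c : ℝ → ℝ → ℝ, (∀ β L, 0 < β → 0 < L → 0 < c β L) ∧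
      (∀ β₁ β₂ L₁ L₂ : ℝ, 0 < β₁ → 0 < L₁ →
        ∃ M, ∀ β ∈ Icc β₁ β₂, ∀ L ∈ Icc L₁ L₂, c β L ≤ M) ∧
      ∀ K, IsScaleConstant ψ K → ∀ α ∈ Ioo (0 : ℝ) 1, ∀ z₀ a b : ℝ, 0 < a → a ≤ b → b < 1 →
      ∀ ε : ℕ → ℝ, (∀ n, 0 < ε n) →
      ∀ β₁ β₂ L₁ L₂ : ℝ, 0 < β₁ → 0 < L₁ → L₁ ≤ L₂ →
      ∀ δ > 0, ∀ᶠ n : ℕ in atTop, ∀ β ∈ Icc β₁ β₂, ∀ L ∈ Icc L₁ L₂,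
        ∀ σ ∈ alternatives β L (Icc a b) ((1 + ε n) * c β L * rate β n),
          HasPower.{u} ψ K α z₀ n σ (1 - δ) := by
  obtain ⟨c₁, hc₁, C₁, hC₁, hΛ⟩ := hψ.exists_le_Lam_sq
  obtain ⟨C, hC1, hC⟩ := exists_ratio_deviation
  have hC0 : ∀ d, 0 < C d := fun d => by linarith [hC1 d]
  -- The first factor makes the signal at least 2√(2 log n). The second ensures c ≥ 8L, so that h =
  -- (r/8L)^{1/β} is at least ρ_n^{1/β}.
  obtain ⟨c, hcdef⟩ : ∃ c : ℝ → ℝ → ℝ, ∀ β L,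
      c β L = (1 + 2048 * C (⌈β⌉₊ - 1) / c₁) * (1 + 8 * L) := ⟨_, fun _ _ => rfl⟩
  refine ⟨c, fun β L _ hL => ?_, fun β₁ β₂ L₁ L₂ _ hL₁ => ?_, ?_⟩
  · have := hC0 (⌈β⌉₊ - 1)
    rw [hcdef]
    positivity
  · obtain ⟨M, hM⟩ := exists_rateConst_le hC1 hc₁ β₂ L₂
    exact ⟨M, fun β hβ L hL => hcdef β L ▸ (hM β hβ.2 L (hL₁.trans_le hL.1) hL.2).1⟩
  intro K hK α hα z₀ a b ha hab hb ε hε β₁ β₂ L₁ L₂ hβ₁ hL₁ hL₁₂ δ hδ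
  obtain ⟨Mr, hMr, hMratio⟩ := exists_ratio_le β₂ L₂ (hL₁.le.trans hL₁₂)
  obtain ⟨B, hB⟩ := exists_hasPower.{u} hψ hK hα.1 z₀ hMr hδ
  obtain ⟨M, hM⟩ := exists_rateConst_le hC1 hc₁ β₂ L₂
  have hK0 := hK.1
  have hq : 1 / (2 * β₁ + 1) < 1 := by rw [div_lt_one (by positivity)]; linarith
  -- The subinterval of large deviation is sought to the right of t₀ ≤ b, so h ≤ 1 - b keeps it
  -- inside [0,1].
  have hτ : 0 < min (1 - b) (1 / 2) := by
    rw [lt_min_iff]; constructor <;> linarith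
  filter_upwards [hB, eventually_bandwidth_le (β₂ := β₂) hβ₁ (show 0 < 8 * L₁ by positivity)
      (abs_nonneg M) hτ ((min_le_right _ _).trans (by norm_num)),
    eventually_log_sq_le (by positivity) hq (8 * |M| * (1 + 4 / c₁ + (K + C₁))),
    tendsto_log_natCast.eventually_ge_atTop (max 1 ((1 + |B|) ^ 2)), eventually_ge_atTop 2,
    tendsto_log_div_self.eventually (gt_mem_nhds one_pos)]
    with n hBn hsmall hlarge hlog hn2 hx β hβ L hL σ hσ
  clear hB
  have hβ0 : 0 < β := hβ₁.trans_le hβ.1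
  have hL0 : 0 < L := hL₁.trans_le hL.1
  have hl1 : 1 ≤ Real.log n := (le_max_left _ _).trans hlog
  have hl0 : 0 < Real.log n := by linarith
  have hn1 : 1 ≤ n := by omega
  have hn0 : (0 : ℝ) < n := by positivity
  have hx0 : 0 < Real.log n / n := by positivity
  have hρ := rate_pos (β := β) hl0
  have hMc := hM β hβ.2 L hL0 hL.2
  rw [← hcdef] at hMc
  have hCβ := hC β L
  have hcβ := hcdef β L
  have hCd := hC0 (⌈β⌉₊ - 1)
  have hCd1 := hC1 (⌈β⌉₊ - 1)
  clear hM hcdef hC hC0 hC1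
  generalize C (⌈β⌉₊ - 1) = D at *
  generalize hce : c β L = c' at *
  have hq0 : 0 ≤ 2048 * D / c₁ := by positivity
  have hc_ge : 1 + 2048 * D / c₁ ≤ c' := by rw [hcβ]; nlinarith
  have hcL : 8 * L ≤ c' := by rw [hcβ]; nlinarith
  have hc0 : 0 < c' := by linarith
  have hcM : c' ≤ |M| := hMc.1.trans (le_abs_self M)
  obtain ⟨r, hr⟩ : ∃ r, r = c' * rate β n := ⟨_, rfl⟩
  have hr0 : 0 < r := by rw [hr]; positivity
  obtain ⟨t₀, ht₀, hrt⟩ := exists_le_abs_of_mem_alternatives ha hab hb hσ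
  have hr_le : r ≤ |ratio σ t₀ - 1| := by
    refine le_trans ?_ hrt
    rw [mul_assoc, ← hr]
    exact le_mul_of_one_le_left hr0.le (by linarith [hε n])
  obtain ⟨hge1, hge2⟩ := bandwidth_ge hβ0 hL0 hcL hn1 hl0 hr
  have hhτ := hsmall β hβ (8 * L) (by linarith [hL.1]) r hr0.le
    (hr.le.trans (mul_le_mul_of_nonneg_right hcM hρ.le))
  have hhβ : L * ((r / (8 * L)) ^ (1 / β)) ^ β = r / 8 := by
    rw [← Real.rpow_mul (by positivity), one_div_mul_cancel hβ0.ne', Real.rpow_one]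
    field_simp
  have hh0 : 0 < (r / (8 * L)) ^ (1 / β) := by positivity
  generalize (r / (8 * L)) ^ (1 / β) = h at *
  have hhb : h ≤ 1 - b := hhτ.trans (min_le_left _ _)
  have hh2 : h ≤ 1 / 2 := hhτ.trans (min_le_right _ _)
  have hv := hσ.1
  obtain ⟨g, hg, hgσ⟩ := hσ.2.1
  obtain ⟨t, ht1, ht2, ht3⟩ := hCβ t₀ h r σ g hβ0 hL0 hh0 hr0 hg hgσ (ha.le.trans ht₀.1)
    (by linarith only [ht₀.2, hhb]) hr_le hhβ
  have hh1 : (Real.log n / n) ^ (1 / (2 * β₁ + 1)) ≤ h := by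
    refine le_trans (Real.rpow_le_rpow_of_exponent_ge hx0 hx.le ?_) hge1
    exact one_div_le_one_div_of_le (by positivity) (by linarith only [hβ.1])
  have hnh : (1 + 4 / c₁ + (K + C₁)) * (1 + Real.log n ^ 2) ≤ n * (h / (8 * D)) := by
    rw [mul_div_assoc', le_div_iff₀ (by positivity)]
    have hDM : D ≤ |M| := hMc.2.trans (le_abs_self M)
    calc _ = 8 * D * (1 + 4 / c₁ + (K + C₁)) * (1 + Real.log n ^ 2) := by ring
      _ ≤ 8 * |M| * (1 + 4 / c₁ + (K + C₁)) * (1 + Real.log n ^ 2) := by gcongr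
      _ ≤ _ := hlarge
      _ ≤ n * h := by gcongr
  have hl2 : 0 ≤ Real.log n ^ 2 := sq_nonneg _
  have hc4 : 0 < 4 / c₁ := by positivity
  have hnh' : (1 + 4 / c₁) * (1 + Real.log n ^ 2) + (K + C₁) ≤ n * (h / (8 * D)) := by
    refine le_trans ?_ hnh
    nlinarith only [mul_nonneg (add_nonneg hK0.le hC₁.le) hl2]
  have h14 : 0 ≤ (1 + 4 / c₁) * (1 + Real.log n ^ 2) := by positivity
  have hdiv : ∀ x, x ≤ K + C₁ → x / n ≤ h / (8 * D) := fun x hx => by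
    rw [div_le_iff₀ hn0]; linarith only [hx, h14, hnh']
  have hh'h : h / (8 * D) ≤ h / 8 :=
    div_le_div_of_nonneg_left hh0.le (by norm_num) (by linarith only [hCd1])
  have hh'0 : 0 < h / (8 * D) := by positivity
  have ht0h : 0 ≤ t - h / (8 * D) := by linarith only [ht1, hh'0, ht₀.1, ha]
  have ht1h : t + h / (8 * D) ≤ 1 := by linarith only [ht2, hh'0, ht₀.2, hhb]
  have hp : (t, h / (8 * D)) ∈ scales n K :=
    ⟨⟨hdiv K (by linarith only [hC₁]), by linarith only [hh'h, hh2, hh0]⟩,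
      by linarith only [ht0h], by linarith only [ht1h]⟩
  have hΛh := hΛ n hn1 t (h / (8 * D)) (hdiv C₁ (by linarith only [hK0])) ht0h ht1h
  refine hBn σ hv (hMratio β hβ0 hβ.2 L hL0.le hL.2 _ _ σ hσ) (t, h / (8 * D)) hp ?_
  have hsn := two_mul_sqrt_le_signal hl0.le hc₁ hCd1 hr0.le hn0.le 
    (Lam_pos_of_scales (p := (t, h / (8 * D))) hK hn1 hp)
    hc_ge hge2 hΛh
  refine corr_add_le_signal hψ hK hv hn1 hc₁ hr0 hp hΛh (by linarith only [hnh', hK0, hC₁])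
    (Real.le_sqrt_of_sq_le ?_) hsn ht3
  linarith only [(le_max_right _ _).trans hlog, hl0]

end

end VolTest

namespace VolTest

noncomputable section

/-! ### The optimal recovery kernel -/

variable {β : ℝ}

lemma recoveryKernel_eq_max (hβ : 0 < β) (x : ℝ) :
    recoveryKernel β x = max (1 - |x| ^ β) 0 := by
  rw [recoveryKernel]
  split_ifs with h
  · exact (max_eq_left (sub_nonneg.2 (Real.rpow_le_one (abs_nonneg _) h hβ.le))).symm
  · exact (max_eq_right (sub_nonpos.2 (Real.one_le_rpow (not_le.1 h).le hβ.le))).symm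

/-- Subadditivity of x ↦ x^β for β ≤ 1. -/
lemma abs_rpow_sub_rpow_le (hβ : 0 < β) (hβ1 : β ≤ 1) (x y : ℝ) :
    |(|x| ^ β - |y| ^ β)| ≤ |x - y| ^ β := by
  have key : ∀ x y : ℝ, |x| ^ β - |y| ^ β ≤ |x - y| ^ β := fun x y => by
    have h1 : |x| ≤ |x - y| + |y| := by simpa using abs_add_le (x - y) y
    have h2 : |x| ^ β ≤ (|x - y| + |y|) ^ β := Real.rpow_le_rpow (abs_nonneg _) h1 hβ.le
    have h3 := Real.rpow_add_le_add_rpow (abs_nonneg (x - y)) (abs_nonneg y) hβ.le hβ1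
    linarith
  rw [abs_le]
  have h1 := key x y
  have h2 := key y x
  rw [abs_sub_comm] at h2
  constructor <;> linarith

lemma abs_recoveryKernel_sub_le (hβ : 0 < β) (hβ1 : β ≤ 1) (x y : ℝ) :
    |recoveryKernel β x - recoveryKernel β y| ≤ |x - y| ^ β := by
  rw [recoveryKernel_eq_max hβ, recoveryKernel_eq_max hβ]
  refine (abs_max_sub_max_le_abs _ _ _).trans ?_
  rw [show 1 - |x| ^ β - (1 - |y| ^ β) = |y| ^ β - |x| ^ β by ring, abs_sub_comm]
  exact abs_rpow_sub_rpow_le hβ hβ1 x y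

lemma holderWith_recoveryKernel (hβ : 0 < β) (hβ1 : β ≤ 1) :
    HolderWith 1 ⟨β, hβ.le⟩ (recoveryKernel β) := fun x y => by
  rw [edist_dist, edist_dist, Real.dist_eq, Real.dist_eq, ENNReal.coe_one, one_mul]
  change _ ≤ ENNReal.ofReal |x - y| ^ β
  rw [ENNReal.ofReal_rpow_of_nonneg (abs_nonneg _) hβ.le]
  exact ENNReal.ofReal_le_ofReal (abs_recoveryKernel_sub_le hβ hβ1 x y)

lemma monotoneOn_recoveryKernel (hβ : 0 < β) : MonotoneOn (recoveryKernel β) (Iic 0) :=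
  fun x hx y hy hxy => by
    rw [recoveryKernel_eq_max hβ, recoveryKernel_eq_max hβ]
    refine max_le_max_right _ (sub_le_sub_left (Real.rpow_le_rpow (abs_nonneg _) ?_ hβ.le) _)
    rw [abs_of_nonpos (mem_Iic.1 hx), abs_of_nonpos (mem_Iic.1 hy)]
    linarith

lemma recoveryKernel_neg (β x : ℝ) : recoveryKernel β (-x) = recoveryKernel β x := by
  simp [recoveryKernel]

lemma recoveryKernel_nonneg (hβ : 0 < β) (x : ℝ) : 0 ≤ recoveryKernel β x := by
  rw [recoveryKernel_eq_max hβ]; exact le_max_right _ _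

lemma recoveryKernel_le_one (hβ : 0 < β) (x : ℝ) : recoveryKernel β x ≤ 1 := by
  rw [recoveryKernel_eq_max hβ]
  exact max_le (sub_le_self _ (Real.rpow_nonneg (abs_nonneg _) _)) zero_le_one

lemma recoveryKernel_zero (hβ : 0 < β) : recoveryKernel β 0 = 1 := by
  simp [recoveryKernel, Real.zero_rpow hβ.ne']

/-- Monotone and bounded on the negative half-line; the other half follows by reflection. -/
lemma boundedVariationOn_recoveryKernel (hβ : 0 < β) :
    BoundedVariationOn (recoveryKernel β) univ := by
  have h1 : BoundedVariationOn (recoveryKernel β) (Iic 0) :=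
    (monotoneOn_recoveryKernel hβ).boundedVariationOn (C := 1) fun x _ => by
      rw [abs_of_nonneg (recoveryKernel_nonneg hβ x)]; exact recoveryKernel_le_one hβ x
  have h2 : eVariationOn (recoveryKernel β) (Ici 0) ≤ eVariationOn (recoveryKernel β) (Iic 0) := by
    have := eVariationOn.comp_le_of_antitoneOn (recoveryKernel β) (s := Iic 0) (t := Ici 0)
      (fun x : ℝ => -x) (fun x _ y _ h => neg_le_neg h) (fun x hx => by simpa using hx)
    rwa [show recoveryKernel β ∘ (fun x : ℝ => -x) = recoveryKernel β from
      funext fun x => recoveryKernel_neg β x] at this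
  rw [BoundedVariationOn, ← Iic_union_Ici (a := (0 : ℝ)),
    eVariationOn.union _ isGreatest_Iic isLeast_Ici]
  exact ENNReal.add_ne_top.2 ⟨h1, ne_top_of_le_ne_top h1 h2⟩

lemma isKernel_recoveryKernel (hβ : 0 < β) (hβ1 : β ≤ 1) : IsKernel (recoveryKernel β) where
  nonneg := recoveryKernel_nonneg hβ
  zero := recoveryKernel_zero hβ
  le_one := recoveryKernel_le_one hβ
  support := fun x hx => by
    by_contra h
    refine hx (if_neg fun h' => h (abs_le.1 h'))
  boundedVariation := boundedVariationOn_recoveryKernel hβ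
  holder := ⟨⟨β, hβ.le⟩, hβ, hβ1, holderWith_recoveryKernel hβ hβ1⟩

lemma mem_holderClass_iff_of_le_one (hβ1 : β ≤ 1) {L : ℝ} {f : ℝ → ℝ} :
    f ∈ holderClass β L ↔ Continuous f ∧ ∀ x y, |f x - f y| ≤ L * |x - y| ^ β := by
  have h : ⌈β⌉₊ - 1 = 0 := by
    have : ⌈β⌉₊ ≤ 1 := Nat.ceil_le.2 (by simpa using hβ1)
    omega
  rw [holderClass, mem_ofPred_eq, h]
  simp

/-- Any competitor satisfies χ(x) ≥ χ(0) - |x|^β ≥ 1 - |x|^β, so |χ| dominates the recovery kernel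
pointwise. -/
lemma isOptimalRecoveryKernel_recoveryKernel (hβ : 0 < β) (hβ1 : β ≤ 1) :
    IsOptimalRecoveryKernel β (recoveryKernel β) := by
  refine ⟨⟨(mem_holderClass_iff_of_le_one hβ1).2
    ⟨(isKernel_recoveryKernel hβ hβ1).continuous, fun x y => ?_⟩, (recoveryKernel_zero hβ).ge⟩,
    fun χ hχ hχ0 => eLpNorm_mono fun x => ?_⟩
  · rw [one_mul]; exact abs_recoveryKernel_sub_le hβ hβ1 x y
  · have h1 := (abs_le.1 (((mem_holderClass_iff_of_le_one hβ1).1 hχ).2 x 0)).1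
    rw [one_mul, sub_zero] at h1
    rw [Real.norm_eq_abs, Real.norm_eq_abs, abs_of_nonneg (recoveryKernel_nonneg hβ x),
      recoveryKernel_eq_max hβ]
    exact max_le (by linarith [le_abs_self (χ x)]) (abs_nonneg _)

/-! ### Sharp adaptivity -/

variable {σ : ℝ → ℝ}

/-- The deviation of a Hölder function dominates the rescaled recovery kernel. -/
lemma recoveryKernel_rescale_sq_le (hβ : 0 < β) {L h r t s : ℝ} (hh : 0 < h) (hr : L * h ^ β = r)
    {f : ℝ → ℝ} (hf : f t - f s ≤ L * |s - t| ^ β) (hrt : r ≤ f t) :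
    r * rescale (recoveryKernel β) t h s ^ 2 ≤ rescale (recoveryKernel β) t h s * f s := by
  have h0 : 0 ≤ rescale (recoveryKernel β) t h s := recoveryKernel_nonneg hβ _
  rcases h0.eq_or_lt with h1 | h1
  · simp [← h1]
  have h2 : rescale (recoveryKernel β) t h s = 1 - |(s - t) / h| ^ β := by
    have h3 : rescale (recoveryKernel β) t h s = max (1 - |(s - t) / h| ^ β) 0 :=
      recoveryKernel_eq_max hβ _
    rw [h3] at h1 ⊢
    exact max_eq_left ((lt_max_iff.1 h1).resolve_right (lt_irrefl _)).le
  have h3 : r * rescale (recoveryKernel β) t h s ≤ f s := by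
    have e : L * |s - t| ^ β = r * |(s - t) / h| ^ β := by
      rw [abs_div, abs_of_pos hh, Real.div_rpow (abs_nonneg _) hh.le, ← hr]
      have := Real.rpow_pos_of_pos hh β
      field_simp
    rw [h2]
    linarith
  calc r * rescale (recoveryKernel β) t h s ^ 2
      = rescale (recoveryKernel β) t h s * (r * rescale (recoveryKernel β) t h s) := by ring
    _ ≤ _ := mul_le_mul_of_nonneg_left h3 h0

lemma le_abs_integral_recoveryKernel (hβ : 0 < β) (hβ1 : β ≤ 1) {L h r t : ℝ} (hh : 0 < h)
    (h0 : 0 ≤ t - h) (h1 : t + h ≤ 1) (hr : L * h ^ β = r) {f : ℝ → ℝ}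
    (hc : ContinuousOn f (Icc 0 1))
    (hf : ∀ x ∈ Icc (0 : ℝ) 1, ∀ y ∈ Icc (0 : ℝ) 1, |f x - f y| ≤ L * |x - y| ^ β)
    (hrt : r ≤ |f t|) :
    r * (h * ∫ x, recoveryKernel β x ^ 2) ≤
      |∫ s in (0 : ℝ)..1, rescale (recoveryKernel β) t h s * f s| := by
  have hk := isKernel_recoveryKernel hβ hβ1
  have ht : t ∈ Icc (0 : ℝ) 1 := ⟨by linarith, by linarith⟩
  have hg := hk.continuous_rescale t h
  rw [← hk.integral_rescale hh h0 h1 (fun y => y ^ 2) (by simp),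
    ← intervalIntegral.integral_const_mul]
  have hi1 : IntervalIntegrable (fun s => r * rescale (recoveryKernel β) t h s ^ 2) volume 0 1 :=
    (continuous_const.mul (hg.pow 2)).intervalIntegrable _ _
  have hi2 : IntervalIntegrable (fun s => rescale (recoveryKernel β) t h s * f s) volume 0 1 :=
    ContinuousOn.intervalIntegrable (by
      rw [uIcc_of_le zero_le_one]; exact hg.continuousOn.mul hc)
  rcases abs_cases (f t) with ⟨h2, -⟩ | ⟨h2, -⟩
  · refine le_trans (intervalIntegral.integral_mono_on zero_le_one hi1 hi2 fun s hs => ?_)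
      (le_abs_self _)
    refine recoveryKernel_rescale_sq_le hβ hh hr ?_ (h2 ▸ hrt)
    rw [abs_sub_comm]
    exact (le_abs_self _).trans (hf t ht s hs)
  · refine le_trans ?_ (neg_le_abs _)
    rw [← intervalIntegral.integral_neg]
    refine intervalIntegral.integral_mono_on zero_le_one hi1 hi2.neg fun s hs => ?_
    have := recoveryKernel_rescale_sq_le (f := fun s => -f s) hβ hh hr (s := s) (t := t) ?_ (h2 ▸ hrt)
    · linarith
    · have := (le_abs_self _).trans (hf s hs t ht)
      linarith

/-- The signal of a Hölder deviation seen by the recovery kernel. -/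
lemma le_abs_sum_weight_recoveryKernel (hβ : 0 < β) (hβ1 : β ≤ 1) (hσ : IsVolatility σ)
    {n : ℕ} (hn : 1 ≤ n) {L h r t : ℝ} (hL : 0 < L) (hh : 0 < h)
    (h0 : 0 ≤ t - h) (h1 : t + h ≤ 1) (hr : L * h ^ β = r)
    (hc : ContinuousOn (ratio σ) (Icc 0 1))
    (hf : ∀ x ∈ Icc (0 : ℝ) 1, ∀ y ∈ Icc (0 : ℝ) 1, |ratio σ x - ratio σ y| ≤ L * |x - y| ^ β)
    (hrt : r ≤ |ratio σ t - 1|) :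
    √n * (r * (h * ∫ x, recoveryKernel β x ^ 2) - L * (1 / n) ^ β * (2 * h)) ≤
      |∑ k, weight (recoveryKernel β) n t h k * (n * cellInt n (ratio σ) k - 1)| := by
  have hk := isKernel_recoveryKernel hβ hβ1
  have hf' : ∀ x ∈ Icc (0 : ℝ) 1, ∀ y ∈ Icc (0 : ℝ) 1,
      |(ratio σ x - 1) - (ratio σ y - 1)| ≤ L * |x - y| ^ β := fun x hx y hy => by
    rw [sub_sub_sub_cancel_right]; exact hf x hx y hy
  have hc' : ContinuousOn (fun s => ratio σ s - 1) (Icc 0 1) := hc.sub continuousOn_const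
  have e : ∑ k, weight (recoveryKernel β) n t h k * (n * cellInt n (ratio σ) k - 1) =
      √n * ∑ k, cellInt n (rescale (recoveryKernel β) t h) k *
        (n * cellInt n (fun s => ratio σ s - 1) k) := by
    rw [Finset.mul_sum]
    refine Finset.sum_congr rfl fun k _ => ?_
    rw [hσ.cellInt_ratio_sub_one, weight_eq, mul_assoc]
  have happ := abs_sum_cellInt_mul_sub_le hn hc' (hk.continuous_rescale t h)
    (hk.rescale_nonneg t h) (e := L * (1 / n) ^ β) (fun x hx y hy hxy => by
      refine (hf' x hx y hy).trans (mul_le_mul_of_nonneg_left ?_ hL.le)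
      exact Real.rpow_le_rpow (abs_nonneg _) hxy hβ.le)
  have hint := le_abs_integral_recoveryKernel hβ hβ1 hh h0 h1 hr hc' hf' hrt
  have hle := hk.integral_rescale_le hh h0 h1
  have hpos : 0 ≤ L * (1 / (n : ℝ)) ^ β := by positivity
  rw [e, abs_mul, abs_of_nonneg (Real.sqrt_nonneg _)]
  refine mul_le_mul_of_nonneg_left ?_ (Real.sqrt_nonneg _)
  have h2 := mul_le_mul_of_nonneg_left hle hpos
  have h3 := abs_sub_abs_le_abs_sub (∫ s in (0 : ℝ)..1, rescale (recoveryKernel β) t h s *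
    (ratio σ s - 1)) (∑ k, cellInt n (rescale (recoveryKernel β) t h) k *
        (n * cellInt n (fun s => ratio σ s - 1) k))
  rw [abs_sub_comm] at happ
  linarith only [h2, h3, hint, happ]

/-- Normalization of the signal by the noise level. -/
lemma normalized_signal_ge {L h r I Λ S N : ℝ} (hN : 0 < N) (hh : 0 < h) (hr : 0 < r) (hI : 0 < I)
    (hΛ : 0 < Λ) (hΛI : Λ ^ 2 ≤ h * I) (hrh : L * h ^ β = r) (hu : 2 / I / (N * h) ^ β ≤ 1)
    (hS : √N * (r * (h * I) - L * (1 / N) ^ β * (2 * h)) ≤ S) :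
    √(N * r ^ 2 * h * I / 2) * (1 - 2 / I / (N * h) ^ β) ≤ S / (√2 * Λ) := by
  have hΛ' : Λ ≤ √(h * I) := Real.le_sqrt_of_sq_le hΛI
  have e1 : √(N * r ^ 2 * h * I / 2) = √N * r * √(h * I) / √2 := by
    rw [show N * r ^ 2 * h * I / 2 = N * r ^ 2 * (h * I) / 2 by ring,
      Real.sqrt_div (by positivity), Real.sqrt_mul (by positivity), Real.sqrt_mul hN.le,
      Real.sqrt_sq hr.le]
  -- Because r = Lh^β, the discretization error L N^{-β}·2h is the fraction 2/(I (Nh)^β) of the main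
  -- term rhI.
  have e2 : √N * (r * (h * I) - L * (1 / N) ^ β * (2 * h)) =
      √N * r * (√(h * I) * √(h * I)) * (1 - 2 / I / (N * h) ^ β) := by
    have h1 := Real.rpow_pos_of_pos hN β
    have h2 := Real.rpow_pos_of_pos hh β
    rw [Real.mul_self_sqrt (by positivity), Real.mul_rpow hN.le hh.le,
      Real.div_rpow zero_le_one hN.le, Real.one_rpow, ← hrh]
    field_simp
  rw [le_div_iff₀ (by positivity)]
  refine le_trans ?_ hS
  rw [e1, e2]
  have h3 : 0 ≤ 1 - 2 / I / (N * h) ^ β := by linarith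
  have h4 : √N * r * √(h * I) / √2 * (1 - 2 / I / (N * h) ^ β) * (√2 * Λ) =
      √N * r * √(h * I) * (1 - 2 / I / (N * h) ^ β) * Λ := by
    field_simp
  rw [h4]
  calc √N * r * √(h * I) * (1 - 2 / I / (N * h) ^ β) * Λ
      ≤ √N * r * √(h * I) * (1 - 2 / I / (N * h) ^ β) * √(h * I) :=
        mul_le_mul_of_nonneg_left hΛ' (by positivity)
    _ = _ := by ring

end

end VolTest

/-! ### The sharp constant and the comparison at the detection boundary. -/

namespace VolTest

noncomputable section

variable {β : ℝ}

lemma integral_recoveryKernel_sq_pos (hβ : 0 < β) (hβ1 : β ≤ 1) :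
    0 < ∫ x, recoveryKernel β x ^ 2 := (isKernel_recoveryKernel hβ hβ1).integral_sq_pos

lemma cStar_pos (hβ : 0 < β) (hβ1 : β ≤ 1) {L : ℝ} (hL : 0 < L) : 0 < cStar β L := by
  have := integral_recoveryKernel_sq_pos hβ hβ1
  unfold cStar; positivity

lemma cStar_mono (hβ : 0 < β) (hβ1 : β ≤ 1) {L L' : ℝ} (hL : 0 < L) (h : L ≤ L') :
    cStar β L ≤ cStar β L' := by
  have := integral_recoveryKernel_sq_pos hβ hβ1
  unfold cStar; gcongr

/-- The equation solved by c_*: with r = c_*ρ_n and h = (r/L)^{1/β}, the quantity n r² h ‖ψ_β‖²/2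
equals 2q log n, q = 1/(2β+1). -/
lemma cStar_sq_mul (hβ : 0 < β) (hβ1 : β ≤ 1) {L : ℝ} (hL : 0 < L) :
    cStar β L ^ 2 * (cStar β L / L) ^ (1 / β) * ∫ x, recoveryKernel β x ^ 2 = 4 / (2 * β + 1) := by
  have hI := integral_recoveryKernel_sq_pos hβ hβ1
  have hc := cStar_pos hβ hβ1 hL
  have hLp : 0 < L ^ (1 / β) := by positivity
  have key : cStar β L ^ 2 * cStar β L ^ (1 / β) =
      4 * L ^ (1 / β) / ((2 * β + 1) * ∫ x, recoveryKernel β x ^ 2) := by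
    rw [← Real.rpow_natCast, ← Real.rpow_add hc, cStar, ← Real.rpow_mul (by positivity)]
    rw [show β / (2 * β + 1) * ((2 : ℕ) + 1 / β) = 1 by push_cast; field_simp, Real.rpow_one]
  rw [Real.div_rpow hc.le hL.le, mul_div_assoc', key]
  field_simp

/-- The signal-to-noise ratio at the sharp detection boundary. -/
lemma le_signal_cStar (hβ : 0 < β) (hβ1 : β ≤ 1) {L ε r : ℝ} (hL : 0 < L) (hε : 0 ≤ ε) {n : ℕ}
    (hn : 1 ≤ n) (hl : 0 < Real.log n) (hr : r = (1 + ε) * cStar β L * rate β n) :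
    (1 + ε) * √(2 * (1 / (2 * β + 1) * Real.log n)) ≤
      √(n * r ^ 2 * (r / L) ^ (1 / β) * (∫ x, recoveryKernel β x ^ 2) / 2) := by
  have hI := integral_recoveryKernel_sq_pos hβ hβ1
  have hc := cStar_pos hβ hβ1 hL
  have hρ := rate_pos (β := β) hl
  have h1 : (cStar β L * rate β n / L) ^ (1 / β) ≤ (r / L) ^ (1 / β) := by
    refine Real.rpow_le_rpow (by positivity) ?_ (by positivity)
    refine div_le_div_of_nonneg_right ?_ hL.le
    rw [hr, mul_assoc]
    exact le_mul_of_one_le_left (by positivity) (by linarith)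
  have h2 : (cStar β L * rate β n / L) ^ (1 / β) =
      (cStar β L / L) ^ (1 / β) * rate β n ^ (1 / β) := by
    rw [← Real.mul_rpow (by positivity) hρ.le]; congr 1; ring
  have h3 := rate_sq_mul hβ hn hl
  have h4 := cStar_sq_mul hβ hβ1 hL
  refine Real.le_sqrt_of_sq_le ?_
  rw [mul_pow, Real.sq_sqrt (by positivity)]
  generalize ∫ x, recoveryKernel β x ^ 2 = I at *
  have e : (1 + ε) ^ 2 * (2 * (1 / (2 * β + 1) * Real.log n)) =
      n * r ^ 2 * (cStar β L * rate β n / L) ^ (1 / β) * I / 2 := by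
    rw [h2, hr]
    rw [show 2 * (1 / (2 * β + 1) * Real.log n) = 4 / (2 * β + 1) * Real.log n / 2 by ring,
      ← h4, ← h3]
    ring
  rw [e]
  gcongr

/-- A lower bound on the bandwidth uniform in L: c_* increases in L, so L₁ is taken in the numerator
and L₂ in the denominator. -/
lemma bandwidth_ge_of_cStar (hβ : 0 < β) (hβ1 : β ≤ 1) {L L₁ L₂ ε r : ℝ} (hL₁ : 0 < L₁)
    (hL : L₁ ≤ L) (hL₂ : L ≤ L₂) (hε : 0 ≤ ε) {n : ℕ} (hl : 0 < Real.log n)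
    (hr : r = (1 + ε) * cStar β L * rate β n) :
    (cStar β L₁ / L₂) ^ (1 / β) * (Real.log n / n) ^ (1 / (2 * β + 1)) ≤ (r / L) ^ (1 / β) := by
  have hL0 := hL₁.trans_le hL
  have hL20 := hL0.trans_le hL₂
  have hc₁ := cStar_pos hβ hβ1 hL₁
  have hcL := cStar_pos hβ hβ1 hL0
  have hcc := cStar_mono hβ hβ1 hL₁ hL
  have hρ := rate_pos (β := β) hl
  rw [← rate_rpow_inv hβ, ← Real.mul_rpow (by positivity) hρ.le]
  refine Real.rpow_le_rpow (by positivity) ?_ (by positivity)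
  have h1 : cStar β L₁ * rate β n ≤ r := by
    rw [hr, mul_assoc]
    refine le_trans ?_ (le_mul_of_one_le_left (by positivity) (by linarith : 1 ≤ 1 + ε))
    gcongr
  rw [div_mul_eq_mul_div]
  exact div_le_div₀ ((mul_pos hc₁ hρ).le.trans h1) h1 hL0 hL₂

/-- Bounds the relative discretization error (nh)^{-β} by a small multiple of 1/log n. -/
lemma eventually_log_le_rpow {q A : ℝ} (hq0 : 0 ≤ q) (hq1 : q < 1) (hA : 0 < A) (hβ : 0 < β)
    (c : ℝ) :
    ∀ᶠ n : ℕ in atTop, c * Real.log n ≤ (A * (n * (Real.log n / n) ^ q)) ^ β := by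
  have hp : 0 < (1 - q) * β := mul_pos (by linarith) hβ
  have h1 := (isLittleO_log_rpow_atTop hp).tendsto_div_nhds_zero.comp tendsto_natCast_atTop_atTop
  have h2 : ∀ᶠ n : ℕ in atTop, Real.log n / (n : ℝ) ^ ((1 - q) * β) < A ^ β / (1 + |c|) :=
    h1.eventually (gt_mem_nhds (by positivity))
  filter_upwards [h2, tendsto_log_natCast.eventually_ge_atTop 1, eventually_ge_atTop 1] with n h hl hn
  have hn0 : (0 : ℝ) < n := Nat.cast_pos.2 hn
  rw [div_lt_div_iff₀ (by positivity) (by positivity)] at h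
  have h3 : (n : ℝ) ^ (1 - q) ≤ n * (Real.log n / n) ^ q := by
    rw [Real.rpow_sub hn0, Real.rpow_one, Real.div_rpow (by linarith) hn0.le, ← mul_div_assoc]
    gcongr
    exact le_mul_of_one_le_right hn0.le (Real.one_le_rpow hl hq0)
  calc c * Real.log n ≤ Real.log n * (1 + |c|) := by nlinarith [le_abs_self c]
    _ ≤ A ^ β * (n : ℝ) ^ ((1 - q) * β) := h.le
    _ = (A * (n : ℝ) ^ (1 - q)) ^ β := by
        rw [Real.mul_rpow hA.le (by positivity), ← Real.rpow_mul hn0.le]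
    _ ≤ _ := Real.rpow_le_rpow (by positivity) (by gcongr) hβ.le

lemma sqrt_add_le_add_sqrt {x y : ℝ} (hx : 0 ≤ x) (hy : 0 ≤ y) : √(x + y) ≤ √x + √y := by
  rw [Real.sqrt_le_left (by positivity), add_sq, Real.sq_sqrt hx, Real.sq_sqrt hy]
  have : 0 ≤ 2 * √x * √y := by positivity
  linarith

/-- The correction at this scale is governed by q log n rather than by log n. The factor q is what
allows the sharp constant; the constant w costs only O(1). -/
lemma sqrt_log_inv_le {w q Λ : ℝ} {n : ℕ} (hn : 1 ≤ n) (hw : 0 < w) (hq : 0 ≤ q)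
    (hl : 1 ≤ Real.log n) (h : w * (Real.log n / n) ^ q ≤ Λ ^ 2) :
    √(2 * (2 * Real.log (1 / Λ))) ≤ √(2 * (q * Real.log n)) + √(2 * |Real.log w|) := by
  have hn0 : (0 : ℝ) < n := Nat.cast_pos.2 hn
  refine le_trans (Real.sqrt_le_sqrt ?_) (sqrt_add_le_add_sqrt (by positivity) (by positivity))
  have h1 : w * (1 / (n : ℝ)) ^ q ≤ Λ ^ 2 := by
    refine le_trans ?_ h
    gcongr
  have h2 := Real.log_le_log (by positivity) h1
  rw [Real.log_mul hw.ne' (by positivity), Real.log_rpow (by positivity), one_div, Real.log_inv] at h2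
  rw [two_log_inv_eq, one_div, Real.log_inv]
  linarith [neg_abs_le (Real.log w)]

/-- The signal exceeds the noise by any given constant. -/
lemma sharp_arith {s ε u T Y : ℝ} (hs : 0 ≤ s) (hε : 0 ≤ ε) (hε1 : ε ≤ 1) (hu : u ≤ ε / 4)
    (hT : (1 + ε) * s ≤ T) (hY : Y ≤ ε * s / 2) : s + Y ≤ T * (1 - u) := by
  have h1 : (1 + ε) * s * (1 - ε / 4) ≤ T * (1 - u) :=
    mul_le_mul hT (by linarith) (by linarith) (le_trans (by positivity) hT)
  refine le_trans ?_ h1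
  nlinarith [mul_nonneg hs (mul_nonneg hε (sub_nonneg.2 hε1))]

/-- Uniform power over Hölder alternatives at the sharp constant. -/
lemma sharp_adaptive.{u} (hβ : 0 < β) (hβ1 : β ≤ 1) {K : ℝ}
    (hK : IsScaleConstant (recoveryKernel β) K) {α : ℝ} (hα : 0 < α) (z₀ : ℝ) {a b : ℝ} (ha : 0 < a)
    (hab : a ≤ b) (hb : b < 1) {ε : ℕ → ℝ} (hε : ∀ n, 0 < ε n) (hε0 : Tendsto ε atTop (𝓝 0))
    (hεl : Tendsto (fun n : ℕ => ε n ^ 2 * Real.log n) atTop atTop) {L₁ L₂ : ℝ} (hL₁ : 0 < L₁)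
    (hL₁₂ : L₁ ≤ L₂) {δ : ℝ} (hδ : 0 < δ) : ∀ᶠ n : ℕ in atTop, ∀ L ∈ Icc L₁ L₂,
      ∀ σ ∈ alternatives β L (Icc a b) ((1 + ε n) * cStar β L * rate β n),
        HasPower.{u} (recoveryKernel β) K α z₀ n σ (1 - δ) := by
  have hψ := isKernel_recoveryKernel hβ hβ1
  obtain ⟨c₀, hc₀, hΛ⟩ := hK.exists_le_Lam_sq hψ
  obtain ⟨Mr, hMr, hMratio⟩ := exists_ratio_le β L₂ (hL₁.le.trans hL₁₂)
  obtain ⟨B, hB⟩ := exists_hasPower.{u} hψ hK hα z₀ hMr hδ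
  have hI := integral_recoveryKernel_sq_pos hβ hβ1
  have hL₂ : 0 < L₂ := hL₁.trans_le hL₁₂
  have hc₁ := cStar_pos hβ hβ1 hL₁
  have hc₂ := cStar_pos hβ hβ1 hL₂
  have hK0 := hK.1
  obtain ⟨q, hq⟩ : ∃ q, q = 1 / (2 * β + 1) := ⟨_, rfl⟩
  have hq0 : 0 < q := by rw [hq]; positivity
  have hq1 : q < 1 := by rw [hq, div_lt_one (by positivity)]; linarith
  obtain ⟨A, hA⟩ : ∃ A, A = (cStar β L₁ / L₂) ^ (1 / β) := ⟨_, rfl⟩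
  have hA0 : 0 < A := by rw [hA]; positivity
  obtain ⟨I, hIe⟩ : ∃ I, I = ∫ x, recoveryKernel β x ^ 2 := ⟨_, rfl⟩
  -- Everything bounded that the surplus of the signal has to pay for: the constant in log(1/Λ²),
  -- the linear part of the correction, and the margin B.
  obtain ⟨Y, hY⟩ : ∃ Y, Y = √(2 * |Real.log (c₀ * A)|) + 1 + |B| := ⟨_, rfl⟩
  have hY0 : 0 ≤ Y := by rw [hY]; positivity
  have hτ : 0 < min (min a (1 - b)) (1 / 4) := by
    rw [lt_min_iff, lt_min_iff]
    exact ⟨⟨ha, by linarith⟩, by norm_num⟩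
  rw [← hIe] at hI
  filter_upwards [hB, eventually_bandwidth_le (β₁ := β) (β₂ := β) (M := 2 * cStar β L₂) hβ hL₁
      (by positivity) hτ ((min_le_right _ _).trans (by norm_num)),
    eventually_log_sq_le hq0.le hq1 ((K + 4 / c₀) / A),
    eventually_log_le_rpow hq0.le hq1 hA0 hβ (8 / I),
    tendsto_log_natCast.eventually_ge_atTop 1, eventually_ge_atTop 1,
    hε0.eventually (ge_mem_nhds one_pos),
    hεl.eventually_ge_atTop (max 1 ((2 * Y) ^ 2 / (2 * q)))]
    with n hBn hsmall hlarge hlarge' hl1 hn hεn hεln L hL σ hσ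
  clear hB hε0 hεl
  have hL0 : 0 < L := hL₁.trans_le hL.1
  have hl0 : 0 < Real.log n := by linarith only [hl1]
  have hn0 : (0 : ℝ) < n := Nat.cast_pos.2 hn
  have hρ := rate_pos (β := β) hl0
  have he := hε n
  have hcL := cStar_pos hβ hβ1 hL0
  obtain ⟨t, ht, hrt⟩ := exists_le_abs_of_mem_alternatives ha hab hb hσ
  obtain ⟨r, hr⟩ : ∃ r, r = (1 + ε n) * cStar β L * rate β n := ⟨_, rfl⟩
  rw [← hr] at hrt
  have hr0 : 0 < r := by rw [hr]; positivity
  have hsig := le_signal_cStar hβ hβ1 hL0 he.le hn hl0 hr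
  have hhge := bandwidth_ge_of_cStar hβ hβ1 hL₁ hL.1 hL.2 he.le hl0 hr
  have hhτ := hsmall β ⟨le_rfl, le_rfl⟩ L hL.1 r hr0.le (by
    rw [hr]
    refine mul_le_mul_of_nonneg_right ?_ hρ.le
    exact mul_le_mul (by linarith only [hεn]) (cStar_mono hβ hβ1 hL0 hL.2) hcL.le two_pos.le)
  have hhβ : L * ((r / L) ^ (1 / β)) ^ β = r := by
    rw [← Real.rpow_mul (by positivity), one_div_mul_cancel hβ.ne', Real.rpow_one]
    field_simp
  have hh0 : 0 < (r / L) ^ (1 / β) := by positivity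
  rw [← hq, ← hIe] at hsig
  rw [← hq, ← hA] at hhge
  generalize (r / L) ^ (1 / β) = h at *
  have hha : h ≤ a := hhτ.trans ((min_le_left _ _).trans (min_le_left _ _))
  have hhb : h ≤ 1 - b := hhτ.trans ((min_le_left _ _).trans (min_le_right _ _))
  have hh4 : h ≤ 1 / 4 := hhτ.trans (min_le_right _ _)
  have hth0 : 0 ≤ t - h := by linarith only [ht.1, hha]
  have hth1 : t + h ≤ 1 := by linarith only [ht.2, hhb]
  have hnh : A * (n * (Real.log n / n) ^ q) ≤ n * h := by
    have := mul_le_mul_of_nonneg_left hhge hn0.le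
    linarith only [this]
  have hnh2 : (K + 4 / c₀) * (1 + Real.log n ^ 2) ≤ n * h := by
    refine le_trans ?_ hnh
    rw [div_mul_eq_mul_div, div_le_iff₀ hA0] at hlarge
    linarith only [hlarge]
  have hl2 : 0 ≤ Real.log n ^ 2 := sq_nonneg _
  have hc4 : 0 < 4 / c₀ := div_pos four_pos hc₀
  have hKl := mul_nonneg hK0.le hl2
  have hcl := mul_nonneg hc4.le hl2
  have hp : (t, h) ∈ scales n K := by
    refine ⟨⟨?_, by linarith only [hh4]⟩, by linarith only [hth0], by linarith only [hth1]⟩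
    rw [div_le_iff₀ hn0]
    linarith only [hnh2, hKl, hcl, hc4]
  have hΛh : c₀ * h ≤ Lam (recoveryKernel β) n t h ^ 2 := hΛ n hn (t, h) hp
  have hLpos : 0 < Lam (recoveryKernel β) n t h := Lam_pos_of_scales (p := (t, h)) hK hn hp
  -- The noise level enters through the exact constant ‖ψ_β‖²; the bound Λ² ≤ 2h would lose
  -- sharpness.
  have hΛI : Lam (recoveryKernel β) n t h ^ 2 ≤ h * I := by
    rw [hIe, ← hψ.integral_rescale hh0 hth0 hth1 (fun y => y ^ 2) (by simp)]
    exact hψ.Lam_sq_le_integral hn t h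
  have hlam : (2 * Real.log n) ^ 2 ≤ n * Lam (recoveryKernel β) n t h ^ 2 := by
    have h1 : (2 * Real.log n) ^ 2 = c₀ * (4 / c₀ * Real.log n ^ 2) := by field_simp; ring
    have h2 : c₀ * (4 / c₀ * Real.log n ^ 2) ≤ c₀ * (n * h) :=
      mul_le_mul_of_nonneg_left (by linarith only [hnh2, hKl, hcl, hc4, hK0]) hc₀.le
    have h3 := mul_le_mul_of_nonneg_left hΛh hn0.le
    linarith only [h1, h2, h3]
  have hcorr := corr_le_sqrt_add_one (p := (t, h)) hψ hK hn hp hlam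
  have hsqrt := sqrt_log_inv_le (w := c₀ * A) (q := q) (Λ := Lam (recoveryKernel β) n t h) hn
    (mul_pos hc₀ hA0) hq0.le hl1 (by
      refine le_trans ?_ hΛh
      rw [mul_assoc]
      exact mul_le_mul_of_nonneg_left hhge hc₀.le)
  -- The discretization error is at most 1/(4 log n), and ε_n log n ≥ ε_n² log n ≥ 1 because ε_n ≤
  -- 1.
  have hu : 2 / I / (n * h) ^ β ≤ ε n / 4 := by
    have h1 : 8 / I * Real.log n ≤ (n * h) ^ β :=
      hlarge'.trans (Real.rpow_le_rpow (by positivity) hnh hβ.le)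
    have h2 : 1 ≤ ε n * Real.log n := by
      have h3 : 1 ≤ ε n ^ 2 * Real.log n := (le_max_left _ _).trans hεln
      have h4 : ε n ^ 2 ≤ ε n := by nlinarith only [he, hεn]
      exact h3.trans (mul_le_mul_of_nonneg_right h4 hl0.le)
    have h5 : 0 < (n * h) ^ β := Real.rpow_pos_of_pos (mul_pos hn0 hh0) β
    rw [div_le_iff₀ h5]
    have h6 : 0 < 2 / I := div_pos two_pos hI
    have h7 := mul_le_mul_of_nonneg_left h1 he.le
    have h8 := mul_le_mul_of_nonneg_left h2 h6.le
    have h9 : ε n * (8 / I * Real.log n) = 4 * (2 / I * (ε n * Real.log n)) := by ring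
    linarith only [h7, h8, h9]
  have hv := hσ.1
  obtain ⟨g, hg, hgσ⟩ := hσ.2.1
  obtain ⟨hgc, hgH⟩ := (mem_holderClass_iff_of_le_one hβ1).1 hg
  have hS := le_abs_sum_weight_recoveryKernel hβ hβ1 hv hn hL0 hh0 hth0 hth1 hhβ
    (hgc.continuousOn.congr hgσ) (fun x hx y hy => by rw [hgσ hx, hgσ hy]; exact hgH x y) hrt
  rw [← hIe] at hS
  have hnorm := normalized_signal_ge (β := β) hn0 hh0 hr0 hI hLpos hΛI hhβ
    (by linarith only [hu, hεn]) hS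
  refine hBn σ hv (hMratio β hβ le_rfl L hL0.le hL.2 _ _ σ hσ) (t, h) hp ?_
  refine le_trans ?_ hnorm
  -- The divergence of ε_n² log n makes half of the surplus ε_n √(2q log n) exceed the fixed cost Y;
  -- the other half absorbs the discretization error.
  have hYs : Y ≤ ε n * √(2 * (q * Real.log n)) / 2 := by
    have h1 : (2 * Y) ^ 2 / (2 * q) ≤ ε n ^ 2 * Real.log n := (le_max_right _ _).trans hεln
    rw [div_le_iff₀ (by linarith only [hq0])] at h1
    have h2 : 2 * Y ≤ √(ε n ^ 2 * (2 * (q * Real.log n))) :=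
      Real.le_sqrt_of_sq_le (by linarith only [h1])
    rw [Real.sqrt_mul (sq_nonneg _), Real.sqrt_sq he.le] at h2
    linarith only [h2]
  have hfin := sharp_arith (Real.sqrt_nonneg _) he.le hεn hu hsig hYs
  simp only at hcorr ⊢
  linarith only [hfin, hcorr, hsqrt, hY, le_abs_self B]

end

end VolTest

theorem theorem4 :
    -- rate adaptivity in `(β, L)`, for every admissible kernel `ψ`
    (∀ ψ : ℝ → ℝ, IsKernel ψ →
      (∃ K, IsScaleConstant ψ K) ∧
      ∃ c : ℝ → ℝ → ℝ, (∀ β L, 0 < β → 0 < L → 0 < c β L) ∧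
        (∀ β₁ β₂ L₁ L₂ : ℝ, 0 < β₁ → 0 < L₁ →
          ∃ M, ∀ β ∈ Icc β₁ β₂, ∀ L ∈ Icc L₁ L₂, c β L ≤ M) ∧
        ∀ K, IsScaleConstant ψ K → ∀ α ∈ Ioo (0 : ℝ) 1, ∀ z₀ a b : ℝ, 0 < a → a ≤ b → b < 1 →
        ∀ ε : ℕ → ℝ, (∀ n, 0 < ε n) → Tendsto ε atTop (𝓝 0) →
          Tendsto (fun n : ℕ => ε n ^ 2 * Real.log n) atTop atTop →
        ∀ β₁ β₂ L₁ L₂ : ℝ, 0 < β₁ → β₁ ≤ β₂ → 0 < L₁ → L₁ ≤ L₂ →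
        ∀ δ > 0, ∀ᶠ n : ℕ in atTop, ∀ β ∈ Icc β₁ β₂, ∀ L ∈ Icc L₁ L₂,
          ∀ σ ∈ alternatives β L (Icc a b) ((1 + ε n) * c β L * rate β n),
            HasPower ψ K α z₀ n σ (1 - δ)) ∧
    -- sharp adaptivity in `L` for `β ≤ 1`, for the optimal recovery kernel
    (∀ β ∈ Ioc (0 : ℝ) 1,
      IsOptimalRecoveryKernel β (recoveryKernel β) ∧ IsKernel (recoveryKernel β) ∧
        ∀ K, IsScaleConstant (recoveryKernel β) K →
        ∀ α ∈ Ioo (0 : ℝ) 1, ∀ z₀ a b : ℝ, 0 < a → a ≤ b → b < 1 →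
        ∀ ε : ℕ → ℝ, (∀ n, 0 < ε n) → Tendsto ε atTop (𝓝 0) →
          Tendsto (fun n : ℕ => ε n ^ 2 * Real.log n) atTop atTop →
        ∀ L₁ L₂ : ℝ, 0 < L₁ → L₁ ≤ L₂ →
        ∀ δ > 0, ∀ᶠ n : ℕ in atTop, ∀ L ∈ Icc L₁ L₂,
          ∀ σ ∈ alternatives β L (Icc a b) ((1 + ε n) * cStar β L * rate β n),
            HasPower (recoveryKernel β) K α z₀ n σ (1 - δ)) := by
  refine ⟨fun ψ hψ => ⟨hψ.exists_isScaleConstant, ?_⟩, fun β hβ => ⟨?_, ?_, ?_⟩⟩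
  · obtain ⟨c, h1, h2, h3⟩ := exists_rate_adaptive hψ
    refine ⟨c, h1, h2, fun K hK α hα z₀ a b ha hab hb ε hε _ _ β₁ β₂ L₁ L₂ hβ₁ _ hL₁ hL => ?_⟩
    exact h3 K hK α hα z₀ a b ha hab hb ε hε β₁ β₂ L₁ L₂ hβ₁ hL₁ hL
  · exact isOptimalRecoveryKernel_recoveryKernel hβ.1 hβ.2
  · exact isKernel_recoveryKernel hβ.1 hβ.2
  · intro K hK α hα z₀ a b ha hab hb ε hε hε0 hεl L₁ L₂ hL₁ hL δ hδ
    exact sharp_adaptive hβ.1 hβ.2 hK hα.1 z₀ ha hab hb hε hε0 hεl hL₁ hL hδ
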